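/- **Setting.** Vectors of $\mathbb R^{2n}$ are written $u=(p|x)$ with $p,x\in\mathbb R^n$; the symplectic product is $u\odot u'=p\cdot x'-x\cdot p'$, and $V^\perp=\{w: w\odot u=0\ \forall u\in V\}$. For a subspace $V$ put $\mathrm{iso}(V)=V\cap V^\perp$. For finitely many modes with quadratures $\hat x_i$ (multiplication by $x_i$) and $\hat p_i=-i\partial_{x_i}$, acting on generalized states (tempered distributions on configuration space, which contain $L^2$ and the infinitely squeezed states), let $$M(p|x)=\sum_i (p_i\hat x_i-x_i\hat p_i),\qquad D(p|x)=\exp\{i\sqrt\pi\, M(p|x)\}.$$ The sender has $n$ modes; a receiver has $c$ further noiseless modes. The canonical encoder $U_0$ sends a (generalized) $k$-mode state $\varphi$ to $|\Phi\rangle^{\otimes c}\otimes|0\rangle^{\otimes l}\otimes\varphi$, where $|\Phi\rangle=\pi^{-1/2}\int|x\rangle|x\rangle\,dx$ is shared by sender and receiver and $|0\rangle$ is the zero-position eigenstate; the sender's modes are ordered as $c$ entangled, $l$ ancilla and $k$ data modes. **Theorem.** Let $C$ be an arbitrary subspace of $\mathbb R^{2n}$. There are $c,l,k\ge 0$ with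 $c+l+k=n$, $\dim C^\perp=2c+l$ and $\dim \mathrm{iso}(C^\perp)=l$, and the following objects: * a symplectic basis $u_1,\dots,u_n,v_1,\dots,v_n$ of $\mathbb R^{2n}$ ($u_i\odot v_j=\delta_{ij}$, $u_i\odot u_j=v_i\odot v_j=0$) such that $u_1,\dots,u_{c+l},v_1,\dots,v_c$ span $C^\perp$ and $u_{c+1},\dots,u_{c+l}$ span $\mathrm{iso}(C^\perp)$; * the symplectic map $\Upsilon$ with $\Upsilon u_i=e_i$, $\Upsilon v_i=e_{n+i}$; * a unitary operator $U_\Upsilon$ on the sender's space $L^2(\mathbb R^n)$ such that (the continuous extension to generalized states of the $n+c$ modes of) $U_\Upsilon\otimes 1$ satisfies, for all $a\in\mathbb R^{2n}$, $b\in\mathbb R^{2c}$, $U_\Upsilon D(a,b)U_\Upsilon^{-1}=D(\Upsilon a,b)$ up to a global phase and $U_\Upsilon M(a,b)U_\Upsilon^{-1}=M(\Upsilon a,b)$. Let $H_{\mathrm{aug}}$ be the matrix with rows $u_1,\dots,u_{c+l},v_1,\dots,v_c$, extended on the receiver's $c$ modes by $(-\delta_i|0)$ in row $u_i$ ($i\le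 c$), by $(0|\delta_i)$ in row $v_i$ ($i\le c$), and by $0$ in the other rows, and let $F_{\mathrm{aug}}$ be the same matrix formed from $e_i,e_{n+i}$ in place of $u_i,v_i$. Then: 1. The observables $M(h)$, $h$ a row of $H_{\mathrm{aug}}$, commute, and $U_\Upsilon M(h)=M(f)U_\Upsilon$ for the corresponding row $f$ of $F_{\mathrm{aug}}$. 2. The code $\mathcal C$ with encoding $U_\Upsilon^{-1}U_0$, that is, $\mathcal C=\{U_\Upsilon^{-1}U_0\varphi\}$ with $\varphi$ ranging over all generalized $k$-mode states, is the simultaneous zero eigenspace of the observables $M(h)$, $h$ a row of $H_{\mathrm{aug}}$. It uses $c$ shared entangled modes. 3. For a set $S\subseteq\mathbb R^{2n}$ of errors $D(u)$ on the sender's modes, $\mathcal C$ corrects $S$ if and only if for all distinct $u,u'\in S$ either $u-u'\notin C$ or $u-u'\in\mathrm{iso}(C^\perp)$. Here "$\mathcal C$ corrects $S$" means: there is a rule $R$ assigning to each syndrome a vector $R(s)\in\mathbb R^{2n}$, such that for every $u\in S$ there are real numbers $s=(s_h)$ with $M(h)D(u)T=s_h D(u)T$ for all $T\in\mathcal C$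 and all rows $h$ of $H_{\mathrm{aug}}$, and a global phase $\beta$, $|\beta|=1$, with $D(-R(s))D(u)T=\beta T$ for all $T\in\mathcal C$. -/

import Mathlib

open scoped SchwartzMap FourierTransform LineDeriv ENNReal
open MeasureTheory

/-! ### Symplectic algebra of phase space -/

/-- The phase space `ℝ^{2n}` of a finite family `ι` of modes; its elements are written
`(p | x)`, momentum part first. -/
abbrev PhaseSpace (ι : Type) : Type := (ι → ℝ) × (ι → ℝ)

/-- The symplectic product `(p | x) ⊙ (p' | x') = p · x' - x · p'`. -/
def sympProd {ι : Type} [Fintype ι] (u v : PhaseSpace ι) : ℝ :=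
  ∑ i, (u.1 i * v.2 i - u.2 i * v.1 i)

/-- The symplectic dual `V^⊥ = {w | w ⊙ u = 0 for all u ∈ V}`. -/
def sympDual {ι : Type} [Fintype ι] (V : Submodule ℝ (PhaseSpace ι)) :
    Submodule ℝ (PhaseSpace ι) where
  carrier := {w | ∀ u ∈ V, sympProd w u = 0}
  zero_mem' := by intro u _; simp [sympProd]
  add_mem' := by
    intro a b ha hb u hu
    have h : sympProd (a + b) u = sympProd a u + sympProd b u := by
      simp only [sympProd, Prod.fst_add, Prod.snd_add, Pi.add_apply, ← Finset.sum_add_distrib]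
      exact Finset.sum_congr rfl fun i _ => by ring
    rw [h, ha u hu, hb u hu, add_zero]
  smul_mem' := by
    intro r a ha u hu
    have h : sympProd (r • a) u = r * sympProd a u := by
      simp only [sympProd, Prod.smul_fst, Prod.smul_snd, Pi.smul_apply, smul_eq_mul,
        Finset.mul_sum]
      exact Finset.sum_congr rfl fun i _ => by ring
    rw [h, ha u hu, mul_zero]

/-- The isotropic part `iso(V)`: the vectors of `V` that are symplectically orthogonal to all
of `V`. -/
def isoPart {ι : Type} [Fintype ι] (V : Submodule ℝ (PhaseSpace ι)) :
    Submodule ℝ (PhaseSpace ι) :=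
  V ⊓ sympDual V

/-- `Υ` preserves the symplectic product. -/
def IsSymplecticMap {ι : Type} [Fintype ι] (Υ : PhaseSpace ι →ₗ[ℝ] PhaseSpace ι) : Prop :=
  ∀ u v, sympProd (Υ u) (Υ v) = sympProd u v

/-- `(u_i, v_i)` are mutually orthogonal hyperbolic pairs; as there is one pair for each mode, they
form a symplectic basis of phase space. -/
def IsSymplecticBasis {ι : Type} [Fintype ι] [DecidableEq ι] (u v : ι → PhaseSpace ι) : Prop :=
  (∀ i j, sympProd (u i) (v j) = if i = j then 1 else 0) ∧
    (∀ i j, sympProd (u i) (u j) = 0) ∧ (∀ i j, sympProd (v i) (v j) = 0)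

/-- The standard vectors `e_i = (δ_i | 0)`. -/
def stdP {ι : Type} [DecidableEq ι] (i : ι) : PhaseSpace ι := (Pi.single i 1, 0)

/-- The standard vectors `e_{n+i} = (0 | δ_i)`. -/
def stdX {ι : Type} [DecidableEq ι] (i : ι) : PhaseSpace ι := (0, Pi.single i 1)

/-- The vector of the joint phase space with sender part `a` and receiver part `b`. -/
def joint {ι κ : Type} (a : PhaseSpace ι) (b : PhaseSpace κ) : PhaseSpace (ι ⊕ κ) :=
  (Sum.elim a.1 b.1, Sum.elim a.2 b.2)

/-! ### States and observables of a continuous-variable system -/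

/-- The configuration space `ℝ^n` of the modes `ι`. -/
abbrev Config (ι : Type) : Type := EuclideanSpace ℝ ι

/-- The Hilbert space `L²(ℝ^n)` of normalizable states. -/
abbrev HilbertState (ι : Type) [Fintype ι] : Type :=
  Lp ℂ 2 (volume : Measure (Config ι))

/-- Generalized states: tempered distributions on configuration space. They contain `L²(ℝ^n)`
and the infinitely squeezed states. -/
abbrev GenState (ι : Type) [Fintype ι] : Type := 𝓢'(Config ι, ℂ)

/-- The position quadrature `x̂_i`: multiplication by the `i`-th coordinate. -/
noncomputable def posOp {ι : Type} [Fintype ι] (i : ι) : GenState ι →L[ℂ] GenState ι :=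
  TemperedDistribution.smulLeftCLM ℂ (fun x : Config ι => ((x i : ℝ) : ℂ))

/-- The momentum quadrature `p̂_i = -i ∂/∂x_i`, so that `[x̂_i, p̂_j] = i δ_{ij}`. -/
noncomputable def momOp {ι : Type} [Fintype ι] [DecidableEq ι] (i : ι) :
    GenState ι →L[ℂ] GenState ι :=
  (-Complex.I) • LineDeriv.lineDerivOpCLM ℂ (GenState ι) (EuclideanSpace.single i (1 : ℝ))

/-- The quadrature observable `M(p | x) = ∑ i, (p_i x̂_i - x_i p̂_i)`. -/
noncomputable def quadObs {ι : Type} [Fintype ι] [DecidableEq ι] (u : PhaseSpace ι) :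
    GenState ι →L[ℂ] GenState ι :=
  ∑ i, (((u.1 i : ℝ) : ℂ) • posOp i - ((u.2 i : ℝ) : ℂ) • momOp i)

/-- The phase factor of the displacement by `u = (p | ξ)` at the point `y`:
`exp(i (√π p · y - π p · ξ / 2))`. -/
noncomputable def dispPhase {ι : Type} [Fintype ι] (u : PhaseSpace ι) (y : Config ι) : ℂ :=
  Complex.exp (Complex.I *
    ((Real.sqrt Real.pi * ∑ i, u.1 i * y i - Real.pi / 2 * ∑ i, u.1 i * u.2 i : ℝ) : ℂ))

/-- Translation `f ↦ f(· - a)` on generalized states. -/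
noncomputable def translateOp {ι : Type} [Fintype ι] (a : Config ι) :
    GenState ι →L[ℂ] GenState ι :=
  PointwiseConvergenceCLM.precomp ℂ (SchwartzMap.compSubConstCLM ℂ (-a))

/-- The displacement operator `D(u) = exp(i √π ∑ j, (p_j x̂_j - ξ_j p̂_j))` for `u = (p | ξ)`.
By the Baker-Campbell-Hausdorff formula it acts by
`f(y) ↦ exp(i (√π p · y - π p · ξ / 2)) f(y - √π ξ)`. -/
noncomputable def dispOp {ι : Type} [Fintype ι] (u : PhaseSpace ι) :
    GenState ι →L[ℂ] GenState ι :=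
  (TemperedDistribution.smulLeftCLM ℂ (dispPhase u)).comp
    (translateOp (WithLp.toLp 2 (fun i => Real.sqrt Real.pi * u.2 i)))

/-- Two operators agree up to a global phase: `[A] = [B]`. -/
def PhaseEq {ι : Type} [Fintype ι] (A B : GenState ι →L[ℂ] GenState ι) : Prop :=
  ∃ β : ℂ, ‖β‖ = 1 ∧ A = β • B

/-- The function `t ↦ e^{it}` has temperate growth, so `dispPhase` is an admissible multiplier of
tempered distributions. -/
theorem hasTemperateGrowth_exp_I :
    Function.HasTemperateGrowth (fun t : ℝ => Complex.exp (Complex.I * (t : ℂ))) := by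
  have hd : ∀ n : ℕ, iteratedDeriv n (fun t : ℝ => Complex.exp (Complex.I * (t : ℂ))) =
      fun t : ℝ => Complex.I ^ n * Complex.exp (Complex.I * (t : ℂ)) := by
    intro n
    induction n with
    | zero => funext t; simp
    | succ n ih =>
      rw [iteratedDeriv_succ, ih]
      funext t
      have h1 : HasDerivAt (fun t : ℝ => Complex.exp (Complex.I * (t : ℂ)))
          (Complex.exp (Complex.I * (t : ℂ)) * (Complex.I * 1)) t :=
        ((Complex.ofRealCLM.hasDerivAt (x := t)).const_mul Complex.I).cexp
      rw [(h1.const_mul (Complex.I ^ n)).deriv]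
      ring
  refine ⟨?_, fun n => ⟨0, 1, fun t => ?_⟩⟩
  · exact (contDiff_const.mul Complex.ofRealCLM.contDiff).cexp
  · rw [norm_iteratedFDeriv_eq_norm_iteratedDeriv, hd n]
    simp [mul_comm Complex.I, Complex.norm_exp_ofReal_mul_I]

theorem hasTemperateGrowth_dispPhase {ι : Type} [Fintype ι] (u : PhaseSpace ι) :
    Function.HasTemperateGrowth (dispPhase u) := by
  have h : Function.HasTemperateGrowth (fun y : Config ι =>
      Real.sqrt Real.pi * ∑ i, u.1 i * y i - Real.pi / 2 * ∑ i, u.1 i * u.2 i) := by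
    have hc : ∀ i, Function.HasTemperateGrowth (fun y : Config ι => y i) := fun i =>
      (EuclideanSpace.proj (𝕜 := ℝ) i : Config ι →L[ℝ] ℝ).hasTemperateGrowth
    have hs : Function.HasTemperateGrowth (fun y : Config ι => ∑ i, u.1 i * y i) :=
      Function.HasTemperateGrowth.sum fun i _ =>
        (Function.HasTemperateGrowth.const (u.1 i)).mul (hc i)
    exact ((Function.HasTemperateGrowth.const _).mul hs).sub
      (Function.HasTemperateGrowth.const _)
  exact hasTemperateGrowth_exp_I.comp h

/-! ### Joining modes, tensor products, partial integrals -/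

/-- The configuration of `ι ⊕ κ` with parts `y` and `z`. -/
def joinPt {ι κ : Type} (y : Config ι) (z : Config κ) : Config (ι ⊕ κ) :=
  WithLp.toLp 2 (Sum.elim y.ofLp z.ofLp)

theorem measurePreserving_joinPt {ι κ : Type} [Fintype ι] [Fintype κ] :
    MeasurePreserving (fun q : Config ι × Config κ => joinPt q.1 q.2)
      ((volume : Measure (Config ι)).prod (volume : Measure (Config κ))) volume := by
  have h1 : MeasurePreserving (fun q : Config ι × Config κ => (q.1.ofLp, q.2.ofLp))
      ((volume : Measure (Config ι)).prod (volume : Measure (Config κ)))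
      ((volume : Measure (ι → ℝ)).prod (volume : Measure (κ → ℝ))) :=
    (PiLp.volume_preserving_ofLp ι).prod (PiLp.volume_preserving_ofLp κ)
  have h2 := volume_measurePreserving_sumPiEquivProdPi_symm (fun _ : ι ⊕ κ => ℝ)
  have h3 := (PiLp.volume_preserving_toLp (ι ⊕ κ)).comp (h2.comp h1)
  convert! h3 using 1

/-- Joining as a measurable equivalence. -/
def joinEquiv (ι κ : Type) [Fintype ι] [Fintype κ] :
    Config ι × Config κ ≃ᵐ Config (ι ⊕ κ) where
  toFun q := joinPt q.1 q.2
  invFun w := (WithLp.toLp 2 fun i => w (Sum.inl i), WithLp.toLp 2 fun i => w (Sum.inr i))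
  left_inv _ := rfl
  right_inv w := by
    ext i
    rcases i with i | i <;> rfl
  measurable_toFun := measurePreserving_joinPt.measurable
  measurable_invFun := by
    refine Measurable.prodMk ?_ ?_
    · exact (PiLp.continuous_toLp 2 _).measurable.comp
        (measurable_pi_lambda _ fun i => (EuclideanSpace.proj (𝕜 := ℝ) (Sum.inl i) :
          Config (ι ⊕ κ) →L[ℝ] ℝ).continuous.measurable)
    · exact (PiLp.continuous_toLp 2 _).measurable.comp
        (measurable_pi_lambda _ fun i => (EuclideanSpace.proj (𝕜 := ℝ) (Sum.inr i) :
          Config (ι ⊕ κ) →L[ℝ] ℝ).continuous.measurable)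

theorem measurePreserving_joinEquiv {ι κ : Type} [Fintype ι] [Fintype κ] :
    MeasurePreserving (joinEquiv ι κ)
      ((volume : Measure (Config ι)).prod (volume : Measure (Config κ))) volume :=
  measurePreserving_joinPt

/-- The product function `F(y) G(z)` on the joint configuration space. -/
noncomputable def tensorFun {ι κ : Type} [Fintype ι] [Fintype κ]
    (F : HilbertState ι) (G : HilbertState κ) (w : Config (ι ⊕ κ)) : ℂ :=
  F (WithLp.toLp 2 fun i => w (Sum.inl i)) * G (WithLp.toLp 2 fun i => w (Sum.inr i))

theorem memLp_tensorFun {ι κ : Type} [Fintype ι] [Fintype κ]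
    (F : HilbertState ι) (G : HilbertState κ) : MemLp (tensorFun F G) 2 volume := by
  have hF := Lp.memLp F
  have hG := Lp.memLp G
  have hm : MemLp (fun q : Config ι × Config κ => F q.1 * G q.2) 2
      ((volume : Measure (Config ι)).prod (volume : Measure (Config κ))) := by
    have ha : AEStronglyMeasurable (fun q : Config ι × Config κ => F q.1 * G q.2)
        ((volume : Measure (Config ι)).prod (volume : Measure (Config κ))) :=
      (hF.1.comp_fst).mul (hG.1.comp_snd)
    rw [memLp_two_iff_integrable_sq_norm ha]
    have hF2 := (memLp_two_iff_integrable_sq_norm hF.1).1 hF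
    have hG2 := (memLp_two_iff_integrable_sq_norm hG.1).1 hG
    refine (hF2.mul_prod hG2).congr (Filter.Eventually.of_forall fun q => ?_)
    simp [mul_pow]
  exact hm.comp_measurePreserving (measurePreserving_joinEquiv (ι := ι) (κ := κ)).symm

/-- The tensor product `F ⊗ G ∈ L²` of two normalizable states. -/
noncomputable def tensorState {ι κ : Type} [Fintype ι] [Fintype κ]
    (F : HilbertState ι) (G : HilbertState κ) : HilbertState (ι ⊕ κ) :=
  (memLp_tensorFun F G).toLp

/-- Pullback `f ↦ f ∘ L` of Schwartz functions along an injective linear map. -/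
noncomputable def pullback {ι κ : Type} [Fintype ι] [Fintype κ]
    (L : Config ι →ₗ[ℝ] Config κ) (hL : LinearMap.ker L = ⊥) :
    𝓢(Config κ, ℂ) →L[ℂ] 𝓢(Config ι, ℂ) :=
  SchwartzMap.compCLMOfAntilipschitz ℂ (g := L)
    (LinearMap.toContinuousLinearMap L).hasTemperateGrowth
    (L.exists_antilipschitzWith hL).choose_spec.2

/-- The inclusion `z ↦ (0, z)`. -/
def inrPt {ι κ : Type} : Config κ →ₗ[ℝ] Config (ι ⊕ κ) where
  toFun z := joinPt 0 z
  map_add' y z := by ext i; rcases i with i | i <;> simp [joinPt]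
  map_smul' r z := by ext i; rcases i with i | i <;> simp [joinPt]

theorem ker_inrPt {ι κ : Type} : LinearMap.ker (inrPt : Config κ →ₗ[ℝ] Config (ι ⊕ κ)) = ⊥ := by
  rw [LinearMap.ker_eq_bot']
  intro z hz
  ext i
  have := congrArg (fun w : Config (ι ⊕ κ) => w (Sum.inr i)) hz
  simpa [inrPt, joinPt] using this

/-- The partial integral `f ↦ (z ↦ ∫ f(y, z) dy)` as a continuous map of Schwartz spaces. It is
built from the Fourier transform, in terms of which it is restriction to frequencies `(0, ζ)`; see
`integrateOut_apply`. -/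
noncomputable def integrateOut (ι κ : Type) [Fintype ι] [Fintype κ] :
    𝓢(Config (ι ⊕ κ), ℂ) →L[ℂ] 𝓢(Config κ, ℂ) :=
  (FourierTransform.fourierInvCLM ℂ 𝓢(Config κ, ℂ)).comp
    ((pullback inrPt ker_inrPt).comp (FourierTransform.fourierCLM ℂ 𝓢(Config (ι ⊕ κ), ℂ)))

theorem integrateOut_apply {ι κ : Type} [Fintype ι] [Fintype κ] (f : 𝓢(Config (ι ⊕ κ), ℂ))
    (z : Config κ) : integrateOut ι κ f z = ∫ y : Config ι, f (joinPt y z) := by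
  set G : Config κ → ℂ := fun z => ∫ y : Config ι, f (joinPt y z) with hG
  have hmp := measurePreserving_joinEquiv (ι := ι) (κ := κ)
  have hint : Integrable (fun q : Config ι × Config κ => f (joinPt q.1 q.2))
      ((volume : Measure (Config ι)).prod (volume : Measure (Config κ))) :=
    hmp.integrable_comp_of_integrable f.integrable
  have hGint : Integrable G := hint.integral_prod_right
  have hF : ∀ ζ, 𝓕 G ζ = pullback inrPt ker_inrPt (𝓕 f) ζ := by
    intro ζ
    have h1 : pullback inrPt ker_inrPt (𝓕 f) ζ = 𝓕 (f : Config (ι ⊕ κ) → ℂ) (joinPt 0 ζ) := rfl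
    rw [h1, Real.fourier_eq, Real.fourier_eq]
    have hin : ∀ (y : Config ι) (z : Config κ),
        inner ℝ (joinPt y z) (joinPt (0 : Config ι) ζ) = inner ℝ z ζ := by
      intro y z
      simp [joinPt, PiLp.inner_apply, Fintype.sum_sum_type]
    have h2 : Integrable (fun w : Config (ι ⊕ κ) =>
        Real.fourierChar (-(inner ℝ w (joinPt (0 : Config ι) ζ))) • f w) :=
      (Real.fourierIntegral_convergent_iff _).2 f.integrable
    have h3 := hmp.integral_comp' (g := fun w : Config (ι ⊕ κ) =>
        Real.fourierChar (-(inner ℝ w (joinPt (0 : Config ι) ζ))) • f w)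
    rw [← h3]
    have h5 := integral_prod_symm _ (hmp.integrable_comp_of_integrable h2)
    simp only [Function.comp_def] at h5
    rw [h5]
    refine integral_congr_ae (Filter.Eventually.of_forall fun z => ?_)
    have : ∀ y : Config ι, joinEquiv ι κ (y, z) = joinPt y z := fun _ => rfl
    simp only [this, hin, hG, Circle.smul_def, integral_smul]
  have hFi : Integrable (𝓕 G) := by
    have : 𝓕 G = (pullback inrPt ker_inrPt (𝓕 f) : Config κ → ℂ) := funext hF
    rw [this]
    exact (pullback inrPt ker_inrPt (𝓕 f)).integrable
  have hcont : Continuous G := by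
    set k := (volume : Measure (Config ι)).integrablePower with hk
    set B : ℝ := 2 ^ k * ((Finset.Iic (k, 0)).sup fun m => SchwartzMap.seminorm ℂ m.1 m.2) f
    have hB : ∀ w : Config (ι ⊕ κ), (1 + ‖w‖) ^ k * ‖f w‖ ≤ B := by
      intro w
      have := SchwartzMap.one_add_le_sup_seminorm_apply (𝕜 := ℂ) (m := (k, 0)) (k := k) (n := 0)
        le_rfl le_rfl f w
      simpa using this
    have hnorm : ∀ (y : Config ι) (z : Config κ), ‖y‖ ≤ ‖joinPt y z‖ := by
      intro y z
      rw [EuclideanSpace.norm_eq, EuclideanSpace.norm_eq]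
      refine Real.sqrt_le_sqrt ?_
      simp only [joinPt, Fintype.sum_sum_type, Sum.elim_inl, Sum.elim_inr]
      exact le_add_of_nonneg_right (Finset.sum_nonneg fun i _ => by positivity)
    have hjz : ∀ y : Config ι, Continuous fun z : Config κ => joinPt y z := by
      intro y
      refine (PiLp.continuous_toLp 2 _).comp (continuous_pi fun i => ?_)
      rcases i with i | i
      · exact continuous_const
      · exact (EuclideanSpace.proj (𝕜 := ℝ) i : Config κ →L[ℝ] ℝ).continuous
    have hjy : ∀ z : Config κ, Continuous fun y : Config ι => joinPt y z := by
      intro z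
      refine (PiLp.continuous_toLp 2 _).comp (continuous_pi fun i => ?_)
      rcases i with i | i
      · exact (EuclideanSpace.proj (𝕜 := ℝ) i : Config ι →L[ℝ] ℝ).continuous
      · exact continuous_const
    refine continuous_of_dominated
      (bound := fun y : Config ι => B * (1 + ‖y‖) ^ (-(k : ℝ))) ?_ ?_ ?_ ?_
    · exact fun z => (f.continuous.comp (hjy z)).aestronglyMeasurable
    · intro z
      refine Filter.Eventually.of_forall fun y => ?_
      have hpos : (0 : ℝ) < 1 + ‖y‖ := by positivity
      rw [Real.rpow_neg hpos.le, Real.rpow_natCast, ← div_eq_mul_inv, le_div_iff₀ (by positivity),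
        mul_comm]
      refine le_trans ?_ (hB (joinPt y z))
      have := hnorm y z
      gcongr
    · exact (Measure.integrable_pow_neg_integrablePower _).const_mul B
    · exact Filter.Eventually.of_forall fun y => f.continuous.comp (hjz y)
  have h4 := congrFun (hcont.fourierInv_fourier_eq hGint hFi) z
  change (𝓕⁻ (pullback inrPt ker_inrPt (𝓕 f))) z = G z
  rw [SchwartzMap.fourierInv_coe, ← h4]
  rw [funext hF]

/-! ### Parity-check matrices -/

/-- The ordering of the sender's `n = c + l + k` modes: first the `c` modes entangled with the
receiver, then the `l` ancilla modes, then the `k` modes carrying the state to be encoded. -/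
def modeLayout {n c l k : ℕ} (hn : c + l + k = n) : (Fin c ⊕ Fin l) ⊕ Fin k ≃ Fin n :=
  ((finSumFinEquiv.sumCongr (Equiv.refl (Fin k))).trans finSumFinEquiv).trans (finCongr hn)

/-- The rows `u_1, …, u_{c+l}, v_1, …, v_c` of the parity-check matrix of a symplectic basis. -/
def parityRows {n c l k : ℕ} (σ : (Fin c ⊕ Fin l) ⊕ Fin k ≃ Fin n)
    (u v : Fin n → PhaseSpace (Fin n)) : (Fin c ⊕ Fin l) ⊕ Fin c → PhaseSpace (Fin n)
  | Sum.inl a => u (σ (Sum.inl a))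
  | Sum.inr i => v (σ (Sum.inl (Sum.inl i)))

/-- The additional entries, for the receiver's `c` modes, of the augmented parity-check matrix:
`(-δ_i | 0)` in the row of `u_i` with `i ≤ c`, `(0 | δ_i)` in the row of `v_i`, and zero in the
rows of `u_{c+1}, …, u_{c+l}`. -/
def receiverRows (c l : ℕ) : (Fin c ⊕ Fin l) ⊕ Fin c → PhaseSpace (Fin c)
  | Sum.inl (Sum.inl i) => -stdP i
  | Sum.inl (Sum.inr _) => 0
  | Sum.inr i => stdX i

/-- The rows of the augmented parity-check matrix. -/
def augmentedRows {n c l k : ℕ} (σ : (Fin c ⊕ Fin l) ⊕ Fin k ≃ Fin n)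
    (u v : Fin n → PhaseSpace (Fin n)) :
    (Fin c ⊕ Fin l) ⊕ Fin c → PhaseSpace (Fin n ⊕ Fin c) :=
  fun r => joint (parityRows σ u v r) (receiverRows c l r)

/-! ### Encoding operations -/

/-- The configuration of the `n + c` modes in which the entangled modes of sender and receiver
are all at the same positions `y`, the ancillas are at `0`, and the data modes are at `z`. -/
def encPoint {n c l k : ℕ} (σ : (Fin c ⊕ Fin l) ⊕ Fin k ≃ Fin n) :
    Config (Fin c ⊕ Fin k) →ₗ[ℝ] Config (Fin n ⊕ Fin c) where
  toFun w := WithLp.toLp 2 (Sum.elim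
    (fun i => Sum.elim (Sum.elim (fun j => w (Sum.inl j)) (fun _ => 0))
      (fun m => w (Sum.inr m)) (σ.symm i))
    (fun j => w (Sum.inl j)))
  map_add' w w' := by
    ext i
    rcases i with i | i
    · rcases h : σ.symm i with (a | a) | a <;> simp [h]
    · simp
  map_smul' r w := by
    ext i
    rcases i with i | i
    · rcases h : σ.symm i with (a | a) | a <;> simp [h]
    · simp

theorem ker_encPoint {n c l k : ℕ} (σ : (Fin c ⊕ Fin l) ⊕ Fin k ≃ Fin n) :
    LinearMap.ker (encPoint σ) = ⊥ := by
  rw [LinearMap.ker_eq_bot']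
  intro w hw
  ext i
  rcases i with i | i
  · have := congrArg (fun q : Config (Fin n ⊕ Fin c) => q (Sum.inr i)) hw
    simpa [encPoint] using this
  · have := congrArg (fun q : Config (Fin n ⊕ Fin c) => q (Sum.inl (σ (Sum.inr i)))) hw
    simpa [encPoint] using this

/-- The canonical encoder `U_0 : |φ⟩ |Φ⟩^{⊗c} ↦ |φ⟩ |0⟩^{⊗l} |Φ⟩^{⊗c}`, as a function of the `k`-mode
state `φ`. Here `|0⟩` is the position eigenstate `δ(x)` and
`|Φ⟩ = π^{-1/2} ∫ |x⟩ |x⟩ dx = π^{-1/2} δ(x_A - x_B)`, so that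
`(U_0 φ)(f) = π^{-c/2} φ(z ↦ ∫ f(y, 0, z; y) dy)`. -/
noncomputable def canonicalEncoder {n c l k : ℕ} (σ : (Fin c ⊕ Fin l) ⊕ Fin k ≃ Fin n) :
    GenState (Fin k) →L[ℂ] GenState (Fin n ⊕ Fin c) :=
  (((Real.sqrt Real.pi)⁻¹ ^ c : ℝ) : ℂ) •
    PointwiseConvergenceCLM.precomp ℂ
      ((integrateOut (Fin c) (Fin k)).comp (pullback (encPoint σ) (ker_encPoint σ)))

/-- `W` is the continuous extension to generalized states of `U ⊗ 1`, where the unitary `U` acts on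
the sender's modes `ι` only. -/
def IsLocalExtension {ι κ : Type} [Fintype ι] [Fintype κ]
    (U : HilbertState ι ≃ₗᵢ[ℂ] HilbertState ι)
    (W : GenState (ι ⊕ κ) ≃L[ℂ] GenState (ι ⊕ κ)) : Prop :=
  ∀ (F : HilbertState ι) (G : HilbertState κ),
    W (Lp.toTemperedDistribution (tensorState F G)) =
      Lp.toTemperedDistribution (tensorState (U F) G)

/-- `W` implements the symplectic map `Υ` on the sender's modes:
`[W D(a, b) W⁻¹] = [D(Υ a, b)]` and `W M(a, b) W⁻¹ = M(Υ a, b)`. -/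
def Implements {ι κ : Type} [Fintype ι] [Fintype κ] [DecidableEq ι] [DecidableEq κ]
    (Υ : PhaseSpace ι →ₗ[ℝ] PhaseSpace ι) (W : GenState (ι ⊕ κ) ≃L[ℂ] GenState (ι ⊕ κ)) : Prop :=
  (∀ (a : PhaseSpace ι) (b : PhaseSpace κ),
    PhaseEq ((W : GenState (ι ⊕ κ) →L[ℂ] GenState (ι ⊕ κ)).comp
      ((dispOp (joint a b)).comp (W.symm : GenState (ι ⊕ κ) →L[ℂ] GenState (ι ⊕ κ))))
      (dispOp (joint (Υ a) b))) ∧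
  (∀ (a : PhaseSpace ι) (b : PhaseSpace κ),
    (W : GenState (ι ⊕ κ) →L[ℂ] GenState (ι ⊕ κ)).comp
      ((quadObs (joint a b)).comp (W.symm : GenState (ι ⊕ κ) →L[ℂ] GenState (ι ⊕ κ))) =
      quadObs (joint (Υ a) b))

/-! ### Error correction -/

/-- The simultaneous zero eigenspace of the observables `M(h_r)`. -/
def zeroEigenspace {ι ρ : Type} [Fintype ι] [DecidableEq ι] (H : ρ → PhaseSpace ι) :
    Set (GenState ι) :=
  {T | ∀ r, quadObs (H r) T = 0}

/-- The code `𝒞`, with syndrome measurement of the observables `M(h_r)`, corrects the set `S` of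
displacement errors on the sender's modes: there is a recovery rule `R`, a function of the measured
syndrome only, such that for each error `w ∈ S`, all the states `D(w) T` with `T ∈ 𝒞` are
simultaneous eigenstates of the `M(h_r)` with common eigenvalues `s_r` (the syndrome), and
applying `D(-R(s))` restores every `T ∈ 𝒞` up to one global phase. -/
def Corrects {ι κ ρ : Type} [Fintype ι] [Fintype κ] [DecidableEq ι] [DecidableEq κ]
    (code : Set (GenState (ι ⊕ κ))) (H : ρ → PhaseSpace (ι ⊕ κ)) (S : Set (PhaseSpace ι)) : Prop :=
  ∃ R : (ρ → ℝ) → PhaseSpace ι, ∀ w ∈ S, ∃ s : ρ → ℝ,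
    (∀ T ∈ code, ∀ r, quadObs (H r) (dispOp (joint w 0) T) =
      ((s r : ℝ) : ℂ) • dispOp (joint w 0) T) ∧
    ∃ β : ℂ, ‖β‖ = 1 ∧
      ∀ T ∈ code, dispOp (joint (-R s) 0) (dispOp (joint w 0) T) = β • T

/-! The code of `C` is reduced to the canonical code by symplectic linear algebra and a unitary that
realises it. Splitting off hyperbolic pairs adapted to `C^⊥` (`exists_isAdaptedFamily`) gives the
symplectic basis; `c`, `l`, `k` count the pairs with two, one or no members in `C^⊥`.

The map taking this basis to the standard one is a product of transvections `u ↦ u + s (a ⊙ u) a`.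
Two vectors with nonzero product are joined by one transvection, others through an intermediate
vector, and a Witt-type induction moves one hyperbolic pair after another
(`exists_fixing_map_pair`). Each transvection is implemented without any phase: for `a = (p|0)` by
multiplication with `exp(i s (p · x)² / 2)`, for `a = (0|x)` by a Fourier conjugate of such a
multiplication, and for general `a` by conjugating the first kind with products of these two
(`isImplementable_transv`).

In the canonical code the observables are multiplication by relative positions of the entangled
pairs and by ancilla positions, and differentiation along joint translations of the pairs. A
tempered distribution annihilated by coordinates factors through restriction to their common zero
set, since a Schwartz function vanishing on `x_j = 0` is `x_j` times a Schwartz function; by the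
Fourier transform, one annihilated by partial derivatives factors through the partial integral.
Hence the zero eigenspace is exactly the range of the encoder (`range_canonicalEncoder`), and `W`
transports this to the general code.

For error correction, `D(w)` turns code states into eigenstates of `M(h)` with eigenvalue `-√π (w ⊙
h)`, so two errors share a syndrome iff their difference lies in `C`. If both are corrected, `D(w -
w')` is a scalar on the code; comparing it with the sender observables `M(h)`, `h ∈ C`, which
preserve the code, forces `w - w' ∈ C^⊥`. Conversely, displacements along `iso(C^⊥)` become momentum
displacements of ancillas at position zero, where their phase is `1`; they fix the code, so any
error in the set with the observed syndrome serves as recovery (`corrects_zeroEigenspace_iff`). -/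

/-! ### Displacements and quadratures as transposes of operators on Schwartz functions -/

/-- The linear form `x ↦ p · x`. -/
noncomputable def linForm {ι : Type} [Fintype ι] (p : ι → ℝ) (x : Config ι) : ℂ :=
  ((∑ i, p i * x i : ℝ) : ℂ)

theorem hasTemperateGrowth_coord {ι : Type} [Fintype ι] (i : ι) :
    Function.HasTemperateGrowth (fun x : Config ι => x i) :=
  (EuclideanSpace.proj (𝕜 := ℝ) i : Config ι →L[ℝ] ℝ).hasTemperateGrowth

theorem hasTemperateGrowth_ofReal {E : Type*} [NormedAddCommGroup E] [NormedSpace ℝ E] {f : E → ℝ}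
    (hf : f.HasTemperateGrowth) : Function.HasTemperateGrowth (fun x => (f x : ℂ)) :=
  Complex.ofRealCLM.hasTemperateGrowth.comp hf

theorem hasTemperateGrowth_sum_mul {ι : Type} [Fintype ι] (p : ι → ℝ) :
    Function.HasTemperateGrowth (fun x : Config ι => ∑ i, p i * x i) :=
  Function.HasTemperateGrowth.sum fun i _ =>
    (Function.HasTemperateGrowth.const (p i)).mul (hasTemperateGrowth_coord i)

theorem hasTemperateGrowth_linForm {ι : Type} [Fintype ι] (p : ι → ℝ) :
    Function.HasTemperateGrowth (linForm p) :=
  hasTemperateGrowth_ofReal (hasTemperateGrowth_sum_mul p)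

theorem hasTemperateGrowth_coordC {ι : Type} [Fintype ι] (i : ι) :
    Function.HasTemperateGrowth (fun x : Config ι => ((x i : ℝ) : ℂ)) :=
  hasTemperateGrowth_ofReal (hasTemperateGrowth_coord i)

/-- The transpose of `quadObs u`. -/
noncomputable def quadS {ι : Type} [Fintype ι] (u : PhaseSpace ι) :
    𝓢(Config ι, ℂ) →L[ℂ] 𝓢(Config ι, ℂ) :=
  SchwartzMap.smulLeftCLM ℂ (linForm u.1) -
    Complex.I • LineDeriv.lineDerivOpCLM ℂ 𝓢(Config ι, ℂ) (WithLp.toLp 2 u.2)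

theorem quadS_apply {ι : Type} [Fintype ι] (u : PhaseSpace ι) (f : 𝓢(Config ι, ℂ))
    (x : Config ι) : quadS u f x =
      linForm u.1 x * f x - Complex.I * fderiv ℝ f x (WithLp.toLp 2 u.2) := by
  simp [quadS, SchwartzMap.smulLeftCLM_apply_apply (hasTemperateGrowth_linForm u.1),
    SchwartzMap.lineDerivOp_apply_eq_fderiv]

theorem posOp_apply {ι : Type} [Fintype ι] (i : ι) (T : GenState ι) (f : 𝓢(Config ι, ℂ)) :
    posOp i T f = T (SchwartzMap.smulLeftCLM ℂ (fun x : Config ι => ((x i : ℝ) : ℂ)) f) := rfl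

theorem momOp_apply {ι : Type} [Fintype ι] [DecidableEq ι] (i : ι) (T : GenState ι)
    (f : 𝓢(Config ι, ℂ)) :
    momOp i T f = T (Complex.I • ∂_{(EuclideanSpace.single i (1 : ℝ) : Config ι)} f) := by
  simp [momOp]

/-- This reduces operator identities to computations with test functions. The momentum term is `-i
∂` on the test function because transposing `∂` produces a sign. -/
theorem quadObs_apply {ι : Type} [Fintype ι] [DecidableEq ι] (u : PhaseSpace ι) (T : GenState ι)
    (f : 𝓢(Config ι, ℂ)) : quadObs u T f = T (quadS u f) := by
  have h : quadObs u T f = T (∑ i, (((u.1 i : ℝ) : ℂ) •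
      SchwartzMap.smulLeftCLM ℂ (fun x : Config ι => ((x i : ℝ) : ℂ)) f -
      ((u.2 i : ℝ) : ℂ) • (Complex.I • ∂_{(EuclideanSpace.single i (1 : ℝ) : Config ι)} f))) := by
    rw [map_sum]
    simp only [quadObs, map_sub, map_smul]
    rw [sum_apply]
    rw [sum_apply]
    refine Finset.sum_congr rfl fun i _ => ?_
    have h1 := posOp_apply i T f
    have h2 := momOp_apply i T f
    rw [map_smul] at h2
    rw [← h1, ← h2]
    rfl
  rw [h]
  congr 1
  ext x
  rw [quadS_apply]
  have hx : (WithLp.toLp 2 u.2 : Config ι) = ∑ i, u.2 i • EuclideanSpace.single i (1 : ℝ) := by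
    ext j
    simp [Finset.sum_apply, Pi.single_apply]
  rw [hx, map_sum]
  simp only [map_smul, linForm]
  rw [sum_apply]
  simp only [sub_apply, smul_apply, smul_eq_mul,
    SchwartzMap.smulLeftCLM_apply_apply (hasTemperateGrowth_coordC _),
    SchwartzMap.lineDerivOp_apply_eq_fderiv, Finset.sum_sub_distrib]
  push_cast
  rw [Finset.sum_mul, Finset.mul_sum]
  congr 1
  · exact Finset.sum_congr rfl fun i _ => by ring
  · refine Finset.sum_congr rfl fun i _ => ?_
    rw [Complex.real_smul]; ring

/-- The transpose of `dispOp u`. -/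
noncomputable def dispS {ι : Type} [Fintype ι] (u : PhaseSpace ι) :
    𝓢(Config ι, ℂ) →L[ℂ] 𝓢(Config ι, ℂ) :=
  (SchwartzMap.compSubConstCLM ℂ
      (-(WithLp.toLp 2 (fun i => Real.sqrt Real.pi * u.2 i) : Config ι))).comp
    (SchwartzMap.smulLeftCLM ℂ (dispPhase u))

/-- The shift of position effected by `dispOp u`. -/
noncomputable def shiftVec {ι : Type} [Fintype ι] (u : PhaseSpace ι) : Config ι :=
  WithLp.toLp 2 (fun i => Real.sqrt Real.pi * u.2 i)

theorem dispOp_apply {ι : Type} [Fintype ι] (u : PhaseSpace ι) (T : GenState ι)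
    (f : 𝓢(Config ι, ℂ)) : dispOp u T f = T (dispS u f) := rfl

theorem dispS_apply {ι : Type} [Fintype ι] (u : PhaseSpace ι) (f : 𝓢(Config ι, ℂ))
    (x : Config ι) : dispS u f x = dispPhase u (x + shiftVec u) * f (x + shiftVec u) := by
  simp [dispS, shiftVec, SchwartzMap.smulLeftCLM_apply_apply (hasTemperateGrowth_dispPhase u)]

theorem dispPhase_eq {ι : Type} [Fintype ι] (u : PhaseSpace ι) (y : Config ι) :
    dispPhase u y = Complex.exp (Complex.I * (Real.sqrt Real.pi * linForm u.1 y -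
      Real.pi / 2 * ∑ i, (u.1 i : ℂ) * u.2 i)) := by
  simp [dispPhase, linForm]

theorem linForm_add {ι : Type} [Fintype ι] (p : ι → ℝ) (x y : Config ι) :
    linForm p (x + y) = linForm p x + linForm p y := by
  simp [linForm, mul_add, Finset.sum_add_distrib]

theorem linForm_shiftVec {ι : Type} [Fintype ι] (p : ι → ℝ) (u : PhaseSpace ι) :
    linForm p (shiftVec u) = Real.sqrt Real.pi * ∑ i, (p i : ℂ) * u.2 i := by
  simp only [linForm, shiftVec, Finset.mul_sum]
  push_cast
  exact Finset.sum_congr rfl fun i _ => by ring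

theorem shiftVec_add {ι : Type} [Fintype ι] (u v : PhaseSpace ι) :
    shiftVec (u + v) = shiftVec u + shiftVec v := by
  ext i; simp [shiftVec, mul_add]

theorem sympProd_eq_sub {ι : Type} [Fintype ι] (u v : PhaseSpace ι) :
    sympProd u v = ∑ i, u.1 i * v.2 i - ∑ i, v.1 i * u.2 i := by
  rw [sympProd, Finset.sum_sub_distrib]
  congr 1
  exact Finset.sum_congr rfl fun i _ => mul_comm _ _

theorem hasFDerivAt_linForm {ι : Type} [Fintype ι] (p : ι → ℝ) (x v : Config ι) :
    DifferentiableAt ℝ (linForm p) x ∧ fderiv ℝ (linForm p) x v = linForm p v := by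
  set L : Config ι →L[ℝ] ℂ := Complex.ofRealCLM.comp
    (∑ i, p i • (EuclideanSpace.proj (𝕜 := ℝ) i : Config ι →L[ℝ] ℝ))
  have h : linForm p = L := by
    ext y; simp [L, linForm]
  rw [h]
  exact ⟨L.differentiableAt, by rw [L.fderiv]⟩

/-- Weyl relation. -/
theorem dispOp_dispOp {ι : Type} [Fintype ι] (u v : PhaseSpace ι) (T : GenState ι) :
    dispOp u (dispOp v T) =
      Complex.exp (Complex.I * (Real.pi / 2 * sympProd u v : ℝ)) • dispOp (u + v) T := by
  ext f
  -- Transposes compose in the opposite order.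
  change T (dispS v (dispS u f)) = (_ : ℂ) • T (dispS (u + v) f)
  rw [← map_smul]
  congr 1
  ext x
  simp only [smul_apply, dispS_apply, smul_eq_mul, shiftVec_add]
  rw [← mul_assoc, ← mul_assoc, add_assoc, add_comm (shiftVec u) (shiftVec v)]
  congr 1
  simp only [dispPhase_eq, ← Complex.exp_add]
  congr 1
  have hpi : (Real.sqrt Real.pi : ℂ) * Real.sqrt Real.pi = Real.pi := by
    rw [← Complex.ofReal_mul, Real.mul_self_sqrt Real.pi_pos.le]
  have h1 : ∀ y, linForm (u + v).1 y = linForm u.1 y + linForm v.1 y := by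
    intro y; simp [linForm, add_mul, Finset.sum_add_distrib]
  simp only [linForm_add, linForm_shiftVec, h1]
  rw [sympProd_eq_sub]
  push_cast
  simp only [Prod.fst_add, Prod.snd_add, Pi.add_apply, Complex.ofReal_add, add_mul, mul_add,
    Finset.sum_add_distrib]
  -- On the right `v.1` is also evaluated on the shift of `u`; this contributes `√π · √π` times `v.1
  -- · u.2`, the only discrepancy to be resolved by `hpi`.
  linear_combination (-Complex.I * ∑ i, (v.1 i : ℂ) * u.2 i) * hpi

theorem dispOp_zero {ι : Type} [Fintype ι] (T : GenState ι) : dispOp 0 T = T := by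
  ext f
  rw [dispOp_apply]
  congr 1
  ext x
  have h : shiftVec (0 : PhaseSpace ι) = 0 := by ext i; simp [shiftVec]
  simp [dispS_apply, dispPhase, h]

theorem norm_exp_I_mul (t : ℝ) : ‖Complex.exp (Complex.I * (t : ℂ))‖ = 1 := by
  rw [mul_comm, Complex.norm_exp_ofReal_mul_I]

theorem dispPhase_differentiableAt {ι : Type} [Fintype ι] (u : PhaseSpace ι) (y v : Config ι) :
    DifferentiableAt ℝ (dispPhase u) y ∧ fderiv ℝ (dispPhase u) y v =
      Complex.I * Real.sqrt Real.pi * linForm u.1 v * dispPhase u y := by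
  have h1 := (hasFDerivAt_linForm u.1 y v)
  have hd : HasFDerivAt (dispPhase u) _ y :=
    ((((h1.1.hasFDerivAt.const_mul (Real.sqrt Real.pi : ℂ)).sub_const
      (Real.pi / 2 * ∑ i, (u.1 i : ℂ) * u.2 i)).const_mul Complex.I).cexp).congr_of_eventuallyEq
      (Filter.Eventually.of_forall fun y => dispPhase_eq u y)
  refine ⟨hd.differentiableAt, ?_⟩
  rw [hd.fderiv, dispPhase_eq]
  simp only [smul_apply, smul_eq_mul, h1.2]
  ring

/-- Displacements shift the quadratures. -/
theorem quadObs_dispOp {ι : Type} [Fintype ι] [DecidableEq ι] (h u : PhaseSpace ι)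
    (T : GenState ι) : quadObs h (dispOp u T) =
      dispOp u (quadObs h T) - ((Real.sqrt Real.pi * sympProd u h : ℝ) : ℂ) • dispOp u T := by
  ext f
  rw [quadObs_apply, dispOp_apply]
  change _ = quadObs h T (dispS u f) - (_ : ℂ) • T (dispS u f)
  rw [quadObs_apply, ← map_smul, ← map_sub]
  congr 1
  ext x
  set a := shiftVec u with ha
  have hdf : HasFDerivAt (fun x => dispS u f x) _ x :=
    (HasFDerivAt.comp (g := dispPhase u * (f : Config ι → ℂ)) (f := fun y => id y + a) x
      ((dispPhase_differentiableAt u (x + a) 0).1.hasFDerivAt.mul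
        (f.differentiableAt (x := x + a)).hasFDerivAt)
      ((hasFDerivAt_id x).add_const a)).congr_of_eventuallyEq
      (Filter.Eventually.of_forall fun y => dispS_apply u f y)
  simp only [sub_apply, smul_apply, smul_eq_mul]
  rw [dispS_apply, quadS_apply, quadS_apply, hdf.fderiv, dispS_apply]
  simp only [ContinuousLinearMap.comp_id, add_apply, smul_apply, smul_eq_mul,
    (dispPhase_differentiableAt u _ _).2, ← ha, linForm_add]
  -- The form `h.1` on the shift gives `√π h.1 · u.2`, and the derivative of the phase along `h.2`
  -- gives `√π u.1 · h.2`; their difference is the symplectic product.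
  rw [ha, linForm_shiftVec, sympProd_eq_sub]
  have h2 : linForm u.1 (WithLp.toLp 2 h.2) = ∑ i, (u.1 i : ℂ) * h.2 i := by simp [linForm]
  rw [h2]
  push_cast
  linear_combination (Real.sqrt Real.pi * (∑ i, (u.1 i : ℂ) * h.2 i) *
    dispPhase u (x + a) * f (x + a)) * Complex.I_mul_I

/-- The canonical commutation relations. -/
theorem quadObs_quadObs {ι : Type} [Fintype ι] [DecidableEq ι] (u v : PhaseSpace ι)
    (T : GenState ι) : quadObs u (quadObs v T) - quadObs v (quadObs u T) =
      (-Complex.I * (sympProd u v : ℂ)) • T := by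
  ext f
  change quadObs u (quadObs v T) f - quadObs v (quadObs u T) f = (_ : ℂ) • T f
  simp only [quadObs_apply]
  rw [← map_smul, ← map_sub]
  congr 1
  -- All terms except the one with `∑ u.1 i * v.2 i` are symmetric in `u` and `v` (the two
  -- first-order terms trade places), so it alone survives in the commutator.
  have key : ∀ (u v : PhaseSpace ι) (x : Config ι), quadS v (quadS u f) x =
      linForm v.1 x * linForm u.1 x * f x
      - Complex.I * linForm v.1 x * fderiv ℝ f x (WithLp.toLp 2 u.2)
      - Complex.I * linForm u.1 x * fderiv ℝ f x (WithLp.toLp 2 v.2)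
      - Complex.I * (∑ i, (u.1 i : ℂ) * v.2 i) * f x
      - (∂_{(WithLp.toLp 2 v.2 : Config ι)} (∂_{(WithLp.toLp 2 u.2 : Config ι)} f)) x := by
    intro u v x
    set g : 𝓢(Config ι, ℂ) := ∂_{(WithLp.toLp 2 u.2 : Config ι)} f with hg
    have hgx : ∀ y, fderiv ℝ f y (WithLp.toLp 2 u.2) = g y := fun y =>
      (SchwartzMap.lineDerivOp_apply_eq_fderiv _ _ _).symm
    have hd : HasFDerivAt (fun x => quadS u f x) _ x :=
      (((hasFDerivAt_linForm u.1 x 0).1.hasFDerivAt.mul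
        (f.differentiableAt (x := x)).hasFDerivAt).sub
        ((g.differentiableAt (x := x)).hasFDerivAt.const_mul Complex.I)).congr_of_eventuallyEq
      (Filter.Eventually.of_forall fun y => by
        change quadS u f y = _
        rw [quadS_apply, hgx]; rfl)
    rw [quadS_apply, hd.fderiv, quadS_apply, hgx]
    have h2 : linForm u.1 (WithLp.toLp 2 v.2) = ∑ i, (u.1 i : ℂ) * v.2 i := by simp [linForm]
    simp only [add_apply, sub_apply, smul_apply, smul_eq_mul, (hasFDerivAt_linForm u.1 _ _).2, h2,
      SchwartzMap.lineDerivOp_apply_eq_fderiv]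
    linear_combination (fderiv ℝ g x (WithLp.toLp 2 v.2)) * Complex.I_mul_I
  have hcomm : ∀ x, (∂_{(WithLp.toLp 2 v.2 : Config ι)} (∂_{(WithLp.toLp 2 u.2 : Config ι)} f)) x =
      (∂_{(WithLp.toLp 2 u.2 : Config ι)} (∂_{(WithLp.toLp 2 v.2 : Config ι)} f)) x := by
    intro x
    have hs : IsSymmSndFDerivAt ℝ f x :=
      (f.smooth 2).contDiffAt.isSymmSndFDerivAt (by simp)
    have hd : ∀ w w' : Config ι, (∂_{w'} (∂_{w} f : 𝓢(Config ι, ℂ)) : 𝓢(Config ι, ℂ)) x = fderiv ℝ (fderiv ℝ f) x w' w := by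
      intro w w'
      rw [SchwartzMap.lineDerivOp_apply_eq_fderiv]
      have : ((∂_{w} f : 𝓢(Config ι, ℂ)) : Config ι → ℂ) = fun y => fderiv ℝ f y w :=
        funext fun y => SchwartzMap.lineDerivOp_apply_eq_fderiv _ _ _
      rw [this]
      have hdd : DifferentiableAt ℝ (fderiv ℝ f) x :=
        (((f.smooth 2).fderiv_right (m := 1) (by norm_num)).differentiable (by norm_num)) x
      rw [fderiv_clm_apply hdd (differentiableAt_const w)]
      simp
    rw [hd, hd, hs.eq]
  ext x
  simp only [sub_apply, smul_apply, smul_eq_mul, key, hcomm, sympProd_eq_sub]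
  push_cast
  ring

/-! ### Chirps -/

/-- The symplectic transvection `u ↦ u + s (a ⊙ u) a`. -/
def transv {ι : Type} [Fintype ι] (s : ℝ) (a u : PhaseSpace ι) : PhaseSpace ι :=
  u + (s * sympProd a u) • a

/-- The quadratic phase `exp(i s (p · x)² / 2)`. -/
noncomputable def chirp {ι : Type} [Fintype ι] (s : ℝ) (p : ι → ℝ) (x : Config ι) : ℂ :=
  Complex.exp (Complex.I * ((s / 2 * (∑ i, p i * x i) ^ 2 : ℝ) : ℂ))

theorem chirp_eq {ι : Type} [Fintype ι] (s : ℝ) (p : ι → ℝ) (x : Config ι) :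
    chirp s p x = Complex.exp (Complex.I * (s / 2 * linForm p x ^ 2)) := by
  simp [chirp, linForm]

theorem hasTemperateGrowth_chirp {ι : Type} [Fintype ι] (s : ℝ) (p : ι → ℝ) :
    Function.HasTemperateGrowth (chirp s p) := by
  have h : Function.HasTemperateGrowth (fun x : Config ι => s / 2 * (∑ i, p i * x i) ^ 2) := by
    have := hasTemperateGrowth_sum_mul p
    simp only [pow_two]
    exact (Function.HasTemperateGrowth.const _).mul (this.mul this)
  exact hasTemperateGrowth_exp_I.comp h

theorem norm_chirp {ι : Type} [Fintype ι] (s : ℝ) (p : ι → ℝ) (x : Config ι) :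
    ‖chirp s p x‖ = 1 := norm_exp_I_mul _

theorem chirp_neg_mul {ι : Type} [Fintype ι] (s : ℝ) (p : ι → ℝ) (x : Config ι) :
    chirp (-s) p x * chirp s p x = 1 := by
  simp only [chirp_eq, ← Complex.exp_add]
  rw [← Complex.exp_zero]
  congr 1
  push_cast
  ring

/-- Multiplication of generalized states by a quadratic phase. -/
noncomputable def chirpEquiv {ι : Type} [Fintype ι] (s : ℝ) (p : ι → ℝ) :
    GenState ι ≃L[ℂ] GenState ι :=
  ContinuousLinearEquiv.equivOfInverse
    (TemperedDistribution.smulLeftCLM ℂ (chirp s p))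
    (TemperedDistribution.smulLeftCLM ℂ (chirp (-s) p))
    (fun T => by
      rw [TemperedDistribution.smulLeftCLM_smulLeftCLM_apply (hasTemperateGrowth_chirp _ _)
        (hasTemperateGrowth_chirp _ _)]
      have : chirp s p * chirp (-s) p = fun _ => 1 := by
        ext x; rw [Pi.mul_apply, mul_comm, chirp_neg_mul]
      rw [this]; simp)
    (fun T => by
      rw [TemperedDistribution.smulLeftCLM_smulLeftCLM_apply (hasTemperateGrowth_chirp _ _)
        (hasTemperateGrowth_chirp _ _)]
      have : chirp (-s) p * chirp s p = fun _ => 1 := by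
        ext x; rw [Pi.mul_apply, chirp_neg_mul]
      rw [this]; simp)

theorem chirpEquiv_apply {ι : Type} [Fintype ι] (s : ℝ) (p : ι → ℝ) (T : GenState ι)
    (f : 𝓢(Config ι, ℂ)) :
    chirpEquiv s p T f = T (SchwartzMap.smulLeftCLM ℂ (chirp s p) f) := rfl

theorem sympProd_fst_zero {ι : Type} [Fintype ι] (p : ι → ℝ) (u : PhaseSpace ι) :
    sympProd (p, 0) u = ∑ i, p i * u.2 i := by
  simp [sympProd]

theorem linForm_transv {ι : Type} [Fintype ι] (s : ℝ) (p : ι → ℝ) (u : PhaseSpace ι)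
    (y : Config ι) : linForm (transv s (p, 0) u).1 y =
      linForm u.1 y + s * (∑ i, (p i : ℂ) * u.2 i) * linForm p y := by
  simp only [linForm, transv, sympProd_fst_zero, Prod.fst_add, Prod.smul_fst, Pi.add_apply,
    Pi.smul_apply, smul_eq_mul, add_mul, Finset.sum_add_distrib, mul_assoc, ← Finset.mul_sum]
  push_cast
  ring

theorem transv_snd {ι : Type} [Fintype ι] (s : ℝ) (p : ι → ℝ) (u : PhaseSpace ι) :
    (transv s (p, 0) u).2 = u.2 := by
  simp [transv]

/-- Equality is exact, not just up to phase: the increment of the quadratic phase under the shift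
has a constant part `s π (p · u.2)² / 2`, which the symmetric term `-π p · ξ / 2` in the definition
of `D` accounts for. -/
theorem chirpEquiv_dispOp {ι : Type} [Fintype ι] (s : ℝ) (p : ι → ℝ) (u : PhaseSpace ι)
    (T : GenState ι) :
    chirpEquiv s p (dispOp u T) = dispOp (transv s (p, 0) u) (chirpEquiv s p T) := by
  ext f
  rw [chirpEquiv_apply, dispOp_apply, dispOp_apply, chirpEquiv_apply]
  congr 1
  ext x
  set u' := transv s (p, 0) u with hu'
  have hs : shiftVec u' = shiftVec u := by simp [shiftVec, u', transv_snd]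
  simp only [dispS_apply, SchwartzMap.smulLeftCLM_apply_apply (hasTemperateGrowth_chirp s p),
    smul_eq_mul, hs]
  rw [← mul_assoc, ← mul_assoc]
  congr 1
  simp only [dispPhase_eq, chirp_eq, ← Complex.exp_add]
  congr 1
  have hpi : (Real.sqrt Real.pi : ℂ) * Real.sqrt Real.pi = Real.pi := by
    rw [← Complex.ofReal_mul, Real.mul_self_sqrt Real.pi_pos.le]
  have h3 : ∑ i, (u'.1 i : ℂ) * u'.2 i =
      ∑ i, (u.1 i : ℂ) * u.2 i + s * (∑ i, (p i : ℂ) * u.2 i) * ∑ i, (p i : ℂ) * u.2 i := by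
    have := linForm_transv s p u (WithLp.toLp 2 u.2)
    rw [← hu'] at this
    have h2 : u'.2 = u.2 := transv_snd s p u
    simp only [linForm] at this
    push_cast at this
    rw [h2]
    exact this
  rw [h3, hu', linForm_transv]
  simp only [linForm_add, linForm_shiftVec]
  linear_combination (-Complex.I * s / 2 * (∑ i, (p i : ℂ) * u.2 i) ^ 2) * hpi

/-- Differentiating the quadratic phase along `u.2` brings down `i s (p · u.2)(p · x)`, a multiple
of the position form `p`; this is the transvection term. -/
theorem chirpEquiv_quadObs {ι : Type} [Fintype ι] [DecidableEq ι] (s : ℝ) (p : ι → ℝ)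
    (u : PhaseSpace ι) (T : GenState ι) :
    chirpEquiv s p (quadObs u T) = quadObs (transv s (p, 0) u) (chirpEquiv s p T) := by
  ext f
  rw [chirpEquiv_apply, quadObs_apply, quadObs_apply, chirpEquiv_apply]
  congr 1
  ext x
  have h1 := hasFDerivAt_linForm p x (WithLp.toLp 2 u.2)
  have hc : HasFDerivAt (chirp s p) _ x :=
    (((h1.1.hasFDerivAt.pow 2).const_mul (s / 2 : ℂ)).const_mul
      Complex.I).cexp.congr_of_eventuallyEq (Filter.Eventually.of_forall fun y => chirp_eq s p y)
  have hd : HasFDerivAt (fun x => SchwartzMap.smulLeftCLM ℂ (chirp s p) f x) _ x :=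
    (hc.mul (f.differentiableAt (x := x)).hasFDerivAt).congr_of_eventuallyEq
      (Filter.Eventually.of_forall fun y => by
        change SchwartzMap.smulLeftCLM ℂ (chirp s p) f y = _
        rw [SchwartzMap.smulLeftCLM_apply_apply (hasTemperateGrowth_chirp s p)]; rfl)
  have h2 : linForm p (WithLp.toLp 2 u.2) = ∑ i, (p i : ℂ) * u.2 i := by simp [linForm]
  rw [quadS_apply, hd.fderiv]
  simp only [SchwartzMap.smulLeftCLM_apply_apply (hasTemperateGrowth_chirp s p), quadS_apply,
    transv_snd, linForm_transv, add_apply, smul_apply, smul_eq_mul, h1.2, h2, nsmul_eq_mul]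
  rw [← chirp_eq]
  push_cast
  linear_combination (-s * linForm p x * (∑ i, (p i : ℂ) * u.2 i) *
    chirp s p x * f x) * Complex.I_mul_I

/-! ### Unimodular multipliers on `L²` and their local extensions -/

theorem memLp_unimodular_mul {ι : Type} [Fintype ι] (m : Config ι → ℂ) (hm : Continuous m)
    (hn : ∀ x, ‖m x‖ = 1) (F : HilbertState ι) : MemLp (fun x => m x * F x) 2 volume :=
  (memLp_congr_norm (hm.aestronglyMeasurable.mul (Lp.memLp F).1) (Lp.memLp F).1
    (Filter.Eventually.of_forall fun x => by simp [hn])).2 (Lp.memLp F)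

/-- Multiplication by a continuous unimodular function as a unitary operator on `L²`. -/
noncomputable def unimodularMul {ι : Type} [Fintype ι] (m : Config ι → ℂ) (hm : Continuous m)
    (hn : ∀ x, ‖m x‖ = 1) : HilbertState ι ≃ₗᵢ[ℂ] HilbertState ι :=
  have hi : ∀ x, m x * (m x)⁻¹ = 1 := fun x =>
    mul_inv_cancel₀ (norm_ne_zero_iff.1 (by rw [hn]; exact one_ne_zero))
  have hm' : Continuous fun x => (m x)⁻¹ :=
    hm.inv₀ fun x => norm_ne_zero_iff.1 (by rw [hn]; exact one_ne_zero)
  have hn' : ∀ x, ‖(m x)⁻¹‖ = 1 := fun x => by rw [norm_inv, hn, inv_one]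
  { toFun := fun F => (memLp_unimodular_mul m hm hn F).toLp
    invFun := fun F => (memLp_unimodular_mul _ hm' hn' F).toLp
    map_add' := fun F G => by
      apply Lp.ext
      filter_upwards [(memLp_unimodular_mul m hm hn (F + G)).coeFn_toLp, (memLp_unimodular_mul m hm hn F).coeFn_toLp,
        (memLp_unimodular_mul m hm hn G).coeFn_toLp, Lp.coeFn_add F G,
        Lp.coeFn_add (memLp_unimodular_mul m hm hn F).toLp (memLp_unimodular_mul m hm hn G).toLp] with x h1 h2 h3 h4 h5
      rw [h1, h5, Pi.add_apply, h2, h3, h4, Pi.add_apply, mul_add]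
    map_smul' := fun c F => by
      apply Lp.ext
      filter_upwards [(memLp_unimodular_mul m hm hn (c • F)).coeFn_toLp, (memLp_unimodular_mul m hm hn F).coeFn_toLp,
        Lp.coeFn_smul c F, Lp.coeFn_smul c (memLp_unimodular_mul m hm hn F).toLp] with x h1 h2 h3 h4
      rw [h1, RingHom.id_apply, h4, Pi.smul_apply, h2, h3, Pi.smul_apply, smul_eq_mul, smul_eq_mul]
      ring
    left_inv := fun F => by
      apply Lp.ext
      filter_upwards [(memLp_unimodular_mul _ hm' hn' (memLp_unimodular_mul m hm hn F).toLp).coeFn_toLp,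
        (memLp_unimodular_mul m hm hn F).coeFn_toLp] with x h1 h2
      rw [h1, h2, ← mul_assoc, mul_comm (m x)⁻¹, hi, one_mul]
    right_inv := fun F => by
      apply Lp.ext
      filter_upwards [(memLp_unimodular_mul m hm hn (memLp_unimodular_mul _ hm' hn' F).toLp).coeFn_toLp,
        (memLp_unimodular_mul _ hm' hn' F).coeFn_toLp] with x h1 h2
      rw [h1, h2, ← mul_assoc, hi, one_mul]
    norm_map' := fun F => by
      change ‖(memLp_unimodular_mul m hm hn F).toLp‖ = ‖F‖
      rw [Lp.norm_toLp, Lp.norm_def]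
      congr 1
      exact eLpNorm_congr_norm_ae (Filter.Eventually.of_forall fun x => by simp [hn]) }

theorem coeFn_unimodularMul {ι : Type} [Fintype ι] (m : Config ι → ℂ) (hm : Continuous m)
    (hn : ∀ x, ‖m x‖ = 1) (F : HilbertState ι) :
    unimodularMul m hm hn F =ᵐ[volume] fun x => m x * F x :=
  (memLp_unimodular_mul m hm hn F).coeFn_toLp

/-- The sender's part of a joint configuration. -/
def inlPart {ι κ : Type} (w : Config (ι ⊕ κ)) : Config ι := WithLp.toLp 2 fun i => w (Sum.inl i)

/-- The receiver's part of a joint configuration. -/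
def inrPart {ι κ : Type} (w : Config (ι ⊕ κ)) : Config κ := WithLp.toLp 2 fun i => w (Sum.inr i)

theorem quasiMeasurePreserving_inlPart {ι κ : Type} [Fintype ι] [Fintype κ] :
    Measure.QuasiMeasurePreserving (inlPart : Config (ι ⊕ κ) → Config ι) volume volume :=
  Measure.quasiMeasurePreserving_fst.comp
    (measurePreserving_joinEquiv (ι := ι) (κ := κ)).symm.quasiMeasurePreserving

theorem quasiMeasurePreserving_inrPart {ι κ : Type} [Fintype ι] [Fintype κ] :
    Measure.QuasiMeasurePreserving (inrPart : Config (ι ⊕ κ) → Config κ) volume volume :=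
  Measure.quasiMeasurePreserving_snd.comp
    (measurePreserving_joinEquiv (ι := ι) (κ := κ)).symm.quasiMeasurePreserving

theorem coeFn_tensorState {ι κ : Type} [Fintype ι] [Fintype κ] (F : HilbertState ι)
    (G : HilbertState κ) :
    tensorState F G =ᵐ[volume] fun w => F (inlPart w) * G (inrPart w) :=
  MemLp.coeFn_toLp _

theorem chirp_inlPart {ι κ : Type} [Fintype ι] [Fintype κ] (s : ℝ) (p : ι → ℝ)
    (w : Config (ι ⊕ κ)) : chirp s (Sum.elim p 0) w = chirp s p (inlPart w) := by
  simp [chirp, inlPart]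

/-- The quadratic form attached to `Sum.elim p 0` ignores the receiver's coordinates, so the chirp
on all modes is the sender's chirp tensored with the identity. -/
theorem isLocalExtension_chirp {ι κ : Type} [Fintype ι] [Fintype κ] (s : ℝ) (p : ι → ℝ) :
    IsLocalExtension (κ := κ)
      (unimodularMul (chirp s p) (hasTemperateGrowth_chirp s p).1.continuous (norm_chirp s p))
      (chirpEquiv s (Sum.elim p 0)) := by
  intro F G
  ext f
  rw [chirpEquiv_apply, Lp.toTemperedDistribution_apply, Lp.toTemperedDistribution_apply]
  refine integral_congr_ae ?_
  filter_upwards [coeFn_tensorState F G, coeFn_tensorState (unimodularMul (chirp s p)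
    (hasTemperateGrowth_chirp s p).1.continuous (norm_chirp s p) F) G,
    quasiMeasurePreserving_inlPart.ae (coeFn_unimodularMul (chirp s p)
      (hasTemperateGrowth_chirp s p).1.continuous (norm_chirp s p) F)] with w h1 h2 h3
  rw [h1, h2, h3, SchwartzMap.smulLeftCLM_apply_apply (hasTemperateGrowth_chirp _ _),
    chirp_inlPart]
  simp only [smul_eq_mul]
  ring

/-! ### Tensor products and the Fourier transform -/

/-- `inlPart` as a continuous linear map. -/
noncomputable def inlCLM (ι κ : Type) [Fintype ι] [Fintype κ] : Config (ι ⊕ κ) →L[ℝ] Config ι :=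
  LinearMap.toContinuousLinearMap
    { toFun := inlPart
      map_add' := fun _ _ => rfl
      map_smul' := fun _ _ => rfl }

/-- `inrPart` as a continuous linear map. -/
noncomputable def inrCLM (ι κ : Type) [Fintype ι] [Fintype κ] : Config (ι ⊕ κ) →L[ℝ] Config κ :=
  LinearMap.toContinuousLinearMap
    { toFun := inrPart
      map_add' := fun _ _ => rfl
      map_smul' := fun _ _ => rfl }

theorem joinPt_inlPart_inrPart {ι κ : Type} (w : Config (ι ⊕ κ)) :
    joinPt (inlPart w) (inrPart w) = w := by
  ext i; rcases i with i | i <;> rfl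

theorem norm_le_inlPart_add_inrPart {ι κ : Type} [Fintype ι] [Fintype κ] (w : Config (ι ⊕ κ)) :
    ‖w‖ ≤ ‖inlPart w‖ + ‖inrPart w‖ := by
  refine (sq_le_sq₀ (norm_nonneg _) (by positivity)).1 ?_
  have h : ‖w‖ ^ 2 = ‖inlPart w‖ ^ 2 + ‖inrPart w‖ ^ 2 := by
    simp only [EuclideanSpace.norm_sq_eq, Fintype.sum_sum_type]
    rfl
  rw [h]
  nlinarith [norm_nonneg (inlPart w), norm_nonneg (inrPart w)]

theorem norm_iteratedFDeriv_comp_clm_le {E F : Type*} [NormedAddCommGroup E] [NormedSpace ℝ E]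
    [NormedAddCommGroup F] [NormedSpace ℝ F] (L : F →L[ℝ] E) (f : 𝓢(E, ℂ)) (i : ℕ) (x : F) :
    ‖iteratedFDeriv ℝ i (f ∘ L) x‖ ≤ ‖iteratedFDeriv ℝ i f (L x)‖ * ‖L‖ ^ i := by
  rw [L.iteratedFDeriv_comp_right (f.smooth i) x le_rfl]
  refine (ContinuousMultilinearMap.norm_compContinuousLinearMap_le _ _).trans ?_
  simp

/-- The tensor product `ρ ⊗ g` of Schwartz functions, as a continuous linear map in `g`. -/
noncomputable def tensorS {ι κ : Type} [Fintype ι] [Fintype κ] (ρ : 𝓢(Config ι, ℂ)) :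
    𝓢(Config κ, ℂ) →L[ℂ] 𝓢(Config (ι ⊕ κ), ℂ) :=
  SchwartzMap.mkCLM (σ := RingHom.id ℂ) (fun g w => ρ (inlPart w) * g (inrPart w))
    (fun f g w => by simp [mul_add])
    (fun a f w => by simp only [smul_apply, smul_eq_mul, RingHom.id_apply]; ring)
    (fun g => ((ρ.smooth ⊤).comp (inlCLM ι κ).contDiff).mul
      ((g.smooth ⊤).comp (inrCLM ι κ).contDiff))
    (by
      rintro ⟨k, n⟩
      set A := 2 ^ k * ((Finset.Iic (k, n)).sup fun m => SchwartzMap.seminorm ℂ m.1 m.2) ρ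
      have hA : 0 ≤ A := by positivity
      refine ⟨Finset.Iic (k, n), ∑ i ∈ Finset.range (n + 1), (n.choose i : ℝ) * ‖inlCLM ι κ‖ ^ i *
        ‖inrCLM ι κ‖ ^ (n - i) * A * 2 ^ k, Finset.sum_nonneg fun i _ => by positivity,
        fun g w => ?_⟩
      set y := inlPart w with hy
      set z := inrPart w with hz
      -- The polynomial weight is split between the factors by `‖y‖ + ‖z‖ ≤ (1 + ‖y‖)(1 + ‖z‖)`; the
      -- Leibniz bound then splits the derivatives.
      have hw : ‖w‖ ^ k ≤ (1 + ‖y‖) ^ k * (1 + ‖z‖) ^ k := by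
        rw [← mul_pow]
        refine pow_le_pow_left₀ (norm_nonneg _) ?_ _
        nlinarith [norm_le_inlPart_add_inrPart w, norm_nonneg y, norm_nonneg z]
      have hd := norm_iteratedFDeriv_mul_le (n := n) (N := n)
        ((ρ.smooth n).comp (inlCLM ι κ).contDiff) ((g.smooth n).comp (inrCLM ι κ).contDiff) w le_rfl
      change ‖w‖ ^ k * ‖iteratedFDeriv ℝ n
        (fun w => (ρ ∘ inlCLM ι κ) w * (g ∘ inrCLM ι κ) w) w‖ ≤ _
      refine (mul_le_mul_of_nonneg_left hd (by positivity)).trans ?_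
      rw [Finset.mul_sum, Finset.sum_mul]
      refine Finset.sum_le_sum fun i hi => ?_
      have hi' : i ≤ n := Nat.lt_succ_iff.1 (Finset.mem_range.1 hi)
      have h1 := SchwartzMap.one_add_le_sup_seminorm_apply (𝕜 := ℂ) (m := (k, n)) (k := k)
        (n := i) le_rfl hi' ρ y
      have h2 := SchwartzMap.one_add_le_sup_seminorm_apply (𝕜 := ℂ) (m := (k, n)) (k := k)
        (n := n - i) le_rfl (Nat.sub_le _ _) g z
      have h3 := norm_iteratedFDeriv_comp_clm_le (inlCLM ι κ) ρ i w
      have h4 := norm_iteratedFDeriv_comp_clm_le (inrCLM ι κ) g (n - i) w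
      set B := ((Finset.Iic (k, n)).sup (schwartzSeminormFamily ℂ (Config κ) ℂ)) g
      change (1 + ‖z‖) ^ k * _ ≤ 2 ^ k * B at h2
      change (1 + ‖y‖) ^ k * _ ≤ A at h1
      calc _ ≤ ((1 + ‖y‖) ^ k * (1 + ‖z‖) ^ k) * ((n.choose i : ℝ) *
            (‖iteratedFDeriv ℝ i ρ y‖ * ‖inlCLM ι κ‖ ^ i) *
            (‖iteratedFDeriv ℝ (n - i) g z‖ * ‖inrCLM ι κ‖ ^ (n - i))) := by
            gcongr
            · exact h3
            · exact h4
        _ = (n.choose i : ℝ) * ‖inlCLM ι κ‖ ^ i * ‖inrCLM ι κ‖ ^ (n - i) *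
            ((1 + ‖y‖) ^ k * ‖iteratedFDeriv ℝ i ρ y‖) *
            ((1 + ‖z‖) ^ k * ‖iteratedFDeriv ℝ (n - i) g z‖) := by ring
        _ ≤ (n.choose i : ℝ) * ‖inlCLM ι κ‖ ^ i * ‖inrCLM ι κ‖ ^ (n - i) * A * (2 ^ k * B) := by
            gcongr
        _ = _ := by ring)

theorem tensorS_apply {ι κ : Type} [Fintype ι] [Fintype κ] (ρ : 𝓢(Config ι, ℂ))
    (g : 𝓢(Config κ, ℂ)) (w : Config (ι ⊕ κ)) :
    tensorS ρ g w = ρ (inlPart w) * g (inrPart w) := rfl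

theorem fourier_tensorS {ι κ : Type} [Fintype ι] [Fintype κ] (f : 𝓢(Config ι, ℂ))
    (g : 𝓢(Config κ, ℂ)) : 𝓕 (tensorS f g) = tensorS (𝓕 f) (𝓕 g) := by
  ext ζ
  rw [tensorS_apply]
  simp only [SchwartzMap.fourier_coe]
  rw [Real.fourier_eq, Real.fourier_eq, Real.fourier_eq, ← integral_prod_mul]
  rw [← (measurePreserving_joinEquiv (ι := ι) (κ := κ)).integral_comp']
  refine integral_congr_ae (Filter.Eventually.of_forall fun q => ?_)
  have h1 : inner ℝ (joinEquiv ι κ q) ζ = inner ℝ q.1 (inlPart ζ) + inner ℝ q.2 (inrPart ζ) := by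
    simp [PiLp.inner_apply, Fintype.sum_sum_type, joinEquiv, joinPt, inlPart, inrPart]
  have h2 : tensorS f g (joinEquiv ι κ q) = f q.1 * g q.2 := rfl
  simp only [h1, h2, neg_add, AddChar.map_add_eq_mul, Circle.smul_def, Circle.coe_mul,
    smul_eq_mul]
  ring

theorem tensorState_toLp {ι κ : Type} [Fintype ι] [Fintype κ] (f : 𝓢(Config ι, ℂ))
    (g : 𝓢(Config κ, ℂ)) : tensorState (f.toLp 2) (g.toLp 2) = (tensorS f g).toLp 2 := by
  apply Lp.ext
  filter_upwards [coeFn_tensorState (f.toLp 2) (g.toLp 2), (tensorS f g).coeFn_toLp 2,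
    quasiMeasurePreserving_inlPart.ae (f.coeFn_toLp 2 volume),
    quasiMeasurePreserving_inrPart.ae (g.coeFn_toLp 2 volume)] with w h1 h2 h3 h4
  rw [h1, h2, h3, h4, tensorS_apply]

/-- Gives continuity in each factor, and with it the density argument for the Fourier transform. -/
theorem norm_tensorState {ι κ : Type} [Fintype ι] [Fintype κ] (F : HilbertState ι)
    (G : HilbertState κ) : ‖tensorState F G‖ = ‖F‖ * ‖G‖ := by
  have h : ∀ {ι : Type} [Fintype ι] (F : HilbertState ι), ‖F‖ ^ 2 = ∫ x, ‖F x‖ ^ 2 := by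
    intro ι _ F
    have := L2.inner_def (𝕜 := ℂ) F F
    rw [inner_self_eq_norm_sq_to_K] at this
    have h2 : (((‖F‖ ^ 2 : ℝ)) : ℂ) = ((∫ x, ‖F x‖ ^ 2 : ℝ) : ℂ) := by
      rw [← integral_complex_ofReal]
      push_cast
      refine Eq.trans this (integral_congr_ae (Filter.Eventually.of_forall fun x => ?_))
      simp [inner_self_eq_norm_sq_to_K]
    exact_mod_cast h2
  refine (sq_eq_sq₀ (norm_nonneg _) (by positivity)).1 ?_
  rw [mul_pow, h, h, h, ← integral_prod_mul,
    ← (measurePreserving_joinEquiv (ι := ι) (κ := κ)).integral_comp']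
  refine integral_congr_ae ?_
  filter_upwards [(measurePreserving_joinEquiv (ι := ι) (κ := κ)).quasiMeasurePreserving.ae
    (coeFn_tensorState F G)] with q hq
  rw [hq, norm_mul, mul_pow]
  rfl

theorem tensorState_add_left {ι κ : Type} [Fintype ι] [Fintype κ] (F F' : HilbertState ι)
    (G : HilbertState κ) : tensorState (F + F') G = tensorState F G + tensorState F' G := by
  apply Lp.ext
  filter_upwards [coeFn_tensorState (F + F') G, coeFn_tensorState F G, coeFn_tensorState F' G,
    Lp.coeFn_add (tensorState F G) (tensorState F' G),
    quasiMeasurePreserving_inlPart.ae (Lp.coeFn_add F F')] with w h1 h2 h3 h4 h5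
  rw [h1, h4, Pi.add_apply, h2, h3, h5, Pi.add_apply, add_mul]

theorem tensorState_add_right {ι κ : Type} [Fintype ι] [Fintype κ] (F : HilbertState ι)
    (G G' : HilbertState κ) : tensorState F (G + G') = tensorState F G + tensorState F G' := by
  apply Lp.ext
  filter_upwards [coeFn_tensorState F (G + G'), coeFn_tensorState F G, coeFn_tensorState F G',
    Lp.coeFn_add (tensorState F G) (tensorState F G'),
    quasiMeasurePreserving_inrPart.ae (Lp.coeFn_add G G')] with w h1 h2 h3 h4 h5
  rw [h1, h4, Pi.add_apply, h2, h3, h5, Pi.add_apply, mul_add]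

theorem continuous_tensorState_left {ι κ : Type} [Fintype ι] [Fintype κ] (G : HilbertState κ) :
    Continuous fun F : HilbertState ι => tensorState F G :=
  AddMonoidHomClass.continuous_of_bound (AddMonoidHom.mk' (fun F : HilbertState ι => tensorState F G)
    fun _ _ => tensorState_add_left _ _ _) ‖G‖ fun F => by
      simp [norm_tensorState, mul_comm]

theorem continuous_tensorState_right {ι κ : Type} [Fintype ι] [Fintype κ] (F : HilbertState ι) :
    Continuous fun G : HilbertState κ => tensorState F G :=
  AddMonoidHomClass.continuous_of_bound (AddMonoidHom.mk' (fun G : HilbertState κ => tensorState F G)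
    fun _ _ => tensorState_add_right _ _ _) ‖F‖ fun G => by
      simp [norm_tensorState]

/-- The Fourier transform of `F ⊗ G` is the tensor product of the Fourier transforms. -/
theorem fourier_tensorState {ι κ : Type} [Fintype ι] [Fintype κ] (F : HilbertState ι)
    (G : HilbertState κ) : 𝓕 (tensorState F G) = tensorState (𝓕 F) (𝓕 G) := by
  have hc : ∀ (ι : Type) [Fintype ι], Continuous fun F : HilbertState ι => 𝓕 F := fun ι _ =>
    (Lp.fourierTransformₗᵢ (Config ι) ℂ).continuous
  -- Both sides are continuous in each factor separately, so it suffices to take first `F` and then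
  -- `G` Schwartz.
  refine DenseRange.induction_on (p := fun F => 𝓕 (tensorState F G) = tensorState (𝓕 F) (𝓕 G))
    (SchwartzMap.denseRange_toLpCLM (p := 2) ENNReal.ofNat_ne_top) F
    (isClosed_eq ((hc _).comp (continuous_tensorState_left G))
      ((continuous_tensorState_left (𝓕 G)).comp (hc ι))) fun f => ?_
  refine DenseRange.induction_on
    (p := fun G => 𝓕 (tensorState (SchwartzMap.toLpCLM ℂ ℂ 2 volume f) G) =
      tensorState (𝓕 (SchwartzMap.toLpCLM ℂ ℂ 2 volume f)) (𝓕 G))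
    (SchwartzMap.denseRange_toLpCLM (p := 2) ENNReal.ofNat_ne_top) G
    (isClosed_eq ((hc _).comp (continuous_tensorState_right _))
      ((continuous_tensorState_right _).comp (hc κ))) fun g => ?_
  simp only [SchwartzMap.toLpCLM_apply, SchwartzMap.toLp_fourier_eq, tensorState_toLp,
    fourier_tensorS]

/-! ### Implementable symplectic maps -/

/-- The action of the Fourier transform on phase space. -/
noncomputable def fourierRot {ι : Type} (u : PhaseSpace ι) : PhaseSpace ι :=
  ((-(2 * Real.pi)) • u.2, (2 * Real.pi)⁻¹ • u.1)

/-- With the kernel `exp(-2πi x · ξ)`, multiplication by `x_i` becomes `(i / 2π) ∂_i` and `-i ∂_i`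
becomes multiplication by `2π x_i`; hence the factors in `fourierRot`. -/
theorem fourier_quadObs {ι : Type} [Fintype ι] [DecidableEq ι] (u : PhaseSpace ι)
    (T : GenState ι) : 𝓕 (quadObs u T) = quadObs (fourierRot u) (𝓕 T) := by
  ext f
  rw [TemperedDistribution.fourier_apply, quadObs_apply, quadObs_apply,
    TemperedDistribution.fourier_apply]
  congr 1
  have hi : ∀ m : Config ι, Function.HasTemperateGrowth (fun x : Config ι => (inner ℝ x m : ℝ)) :=
    fun m => by fun_prop
  have hs : ∀ (m : Config ι) (g : 𝓢(Config ι, ℂ)) (x : Config ι),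
      SchwartzMap.smulLeftCLM ℂ (fun x : Config ι => (inner ℝ x m : ℝ)) g x =
        ((inner ℝ x m : ℝ) : ℂ) * g x := fun m g x => by
    rw [SchwartzMap.smulLeftCLM_apply_apply (hi _), Complex.real_smul]
  have h1 : quadS (fourierRot u) f = (-(2 * Real.pi) : ℂ) • SchwartzMap.smulLeftCLM ℂ
      (fun x : Config ι => inner ℝ x (WithLp.toLp 2 u.2)) f -
      (Complex.I * (2 * Real.pi)⁻¹ : ℂ) • ∂_{(WithLp.toLp 2 u.1 : Config ι)} f := by
    ext x
    have hv : (WithLp.toLp 2 ((2 * Real.pi)⁻¹ • u.1) : Config ι) =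
      (2 * Real.pi)⁻¹ • WithLp.toLp 2 u.1 := rfl
    rw [quadS_apply, sub_apply, smul_apply, hs]
    simp only [fourierRot, hv, map_smul, smul_apply, smul_eq_mul,
      SchwartzMap.lineDerivOp_apply_eq_fderiv, Complex.real_smul, linForm, PiLp.inner_apply]
    simp only [Pi.smul_apply, smul_eq_mul, mul_assoc, ← Finset.mul_sum]
    simp only [RCLike.inner_apply, conj_trivial]
    push_cast
    ring
  rw [h1]
  have h2 := SchwartzMap.fourier_lineDerivOp_eq f (WithLp.toLp 2 u.1 : Config ι)
  have h3 := SchwartzMap.lineDerivOp_fourier_eq f (WithLp.toLp 2 u.2 : Config ι)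
  have h4 : 𝓕 (SchwartzMap.smulLeftCLM ℂ
      (fun x : Config ι => inner ℝ x (WithLp.toLp 2 u.2)) f) =
      (Complex.I * (2 * Real.pi)⁻¹ : ℂ) • ∂_{(WithLp.toLp 2 u.2 : Config ι)} (𝓕 f) := by
    rw [h3, FourierTransform.fourier_smul, smul_smul]
    have : (Complex.I * (2 * Real.pi)⁻¹ * -(2 * Real.pi * Complex.I) : ℂ) = 1 := by
      have := Complex.ofReal_ne_zero.2 Real.pi_ne_zero
      push_cast
      field_simp
      rw [Complex.I_sq]; ring
    rw [this, one_smul]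
  rw [sub_eq_add_neg, FourierTransform.fourier_add, FourierTransform.fourier_neg,
    FourierTransform.fourier_smul, FourierTransform.fourier_smul, h2, h4]
  ext x
  rw [quadS_apply]
  simp only [add_apply, neg_apply, smul_apply, smul_eq_mul,
      hs, SchwartzMap.lineDerivOp_apply_eq_fderiv]
  have h5 : linForm u.1 x = (inner ℝ x (WithLp.toLp 2 u.1 : Config ι) : ℝ) := by
    simp [linForm, PiLp.inner_apply]
  rw [h5]
  have := Complex.ofReal_ne_zero.2 Real.pi_ne_zero
  push_cast
  field_simp
  linear_combination (((inner ℝ x (WithLp.toLp 2 u.1 : Config ι) : ℝ) : ℂ) * (𝓕 f) x) *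
    Complex.I_mul_I

theorem fourier_dispOp {ι : Type} [Fintype ι] (u : PhaseSpace ι) (T : GenState ι) :
    𝓕 (dispOp u T) = dispOp (fourierRot u) (𝓕 T) := by
  ext f
  rw [TemperedDistribution.fourier_apply, dispOp_apply, dispOp_apply,
    TemperedDistribution.fourier_apply]
  congr 1
  ext x
  rw [dispS_apply]
  simp only [SchwartzMap.fourier_coe]
  rw [Real.fourier_eq', Real.fourier_eq']
  rw [← integral_const_mul]
  -- Translation invariance moves the shift from the test function into the Fourier kernel, where it
  -- becomes the momentum phase of `u`.
  refine Eq.trans ?_ (integral_add_right_eq_self _ (-shiftVec (fourierRot u)))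
  refine integral_congr_ae (Filter.Eventually.of_forall fun y => ?_)
  simp only [dispS_apply, neg_add_cancel_right, smul_eq_mul]
  rw [← mul_assoc, ← mul_assoc]
  congr 1
  simp only [dispPhase_eq, ← Complex.exp_add]
  congr 1
  have hpi : (Real.sqrt Real.pi : ℂ) * Real.sqrt Real.pi = Real.pi := by
    rw [← Complex.ofReal_mul, Real.mul_self_sqrt Real.pi_pos.le]
  have hpi0 := Complex.ofReal_ne_zero.2 Real.pi_ne_zero
  have e1 : ((inner ℝ (y + -shiftVec (fourierRot u)) x : ℝ) : ℂ) =
      ((inner ℝ y x : ℝ) : ℂ) - Real.sqrt Real.pi * (2 * (Real.pi : ℂ))⁻¹ * linForm u.1 x := by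
    rw [inner_add_left, inner_neg_left]
    simp only [PiLp.inner_apply, shiftVec, fourierRot, linForm]
    push_cast
    simp only [Finset.mul_sum]
    simp
    rw [sub_eq_add_neg]
    congr 2
    refine Finset.sum_congr rfl fun i _ => by ring
  have e2 : ((inner ℝ y (x + shiftVec u) : ℝ) : ℂ) =
      ((inner ℝ y x : ℝ) : ℂ) + Real.sqrt Real.pi * linForm u.2 y := by
    rw [inner_add_right]
    simp only [PiLp.inner_apply, shiftVec, linForm]
    push_cast
    simp only [Finset.mul_sum]
    simp
    refine Finset.sum_congr rfl fun i _ => by ring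
  have e3 : linForm (fourierRot u).1 y = -(2 * Real.pi) * linForm u.2 y := by
    simp only [linForm, fourierRot]
    push_cast
    simp only [Finset.mul_sum]
    simp [mul_assoc]
  -- The rotation reverses the sign of `p · ξ`. The two half-phases therefore differ by a full `π p
  -- · ξ`, which is what evaluating `u.1` on the shift of `u` produces; no extra phase remains.
  have e4 : ∑ i, ((fourierRot u).1 i : ℂ) * (fourierRot u).2 i =
      -∑ i, (u.1 i : ℂ) * u.2 i := by
    rw [← Finset.sum_neg_distrib]
    refine Finset.sum_congr rfl fun i _ => ?_
    simp [fourierRot]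
    field_simp
  have e5 : linForm u.1 (x + shiftVec u) = linForm u.1 x +
      Real.sqrt Real.pi * ∑ i, (u.1 i : ℂ) * u.2 i := by
    rw [linForm_add, linForm_shiftVec]
  rw [e3, e4, e5]
  push_cast
  rw [e1, e2]
  field_simp
  linear_combination (2 * ∑ i, (u.1 i : ℂ) * u.2 i) * hpi

/-! ### Bilinearity of the symplectic product -/

theorem sympProd_add_left {ι : Type} [Fintype ι] (u v w : PhaseSpace ι) :
    sympProd (u + v) w = sympProd u w + sympProd v w := by
  simp only [sympProd, Prod.fst_add, Prod.snd_add, Pi.add_apply, ← Finset.sum_add_distrib]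
  exact Finset.sum_congr rfl fun i _ => by ring

theorem sympProd_smul_left {ι : Type} [Fintype ι] (r : ℝ) (u w : PhaseSpace ι) :
    sympProd (r • u) w = r * sympProd u w := by
  simp only [sympProd, Prod.smul_fst, Prod.smul_snd, Pi.smul_apply, smul_eq_mul, Finset.mul_sum]
  exact Finset.sum_congr rfl fun i _ => by ring

theorem sympProd_swap {ι : Type} [Fintype ι] (u v : PhaseSpace ι) :
    sympProd u v = -sympProd v u := by
  simp only [sympProd, ← Finset.sum_neg_distrib]
  exact Finset.sum_congr rfl fun i _ => by ring

theorem sympProd_self {ι : Type} [Fintype ι] (u : PhaseSpace ι) : sympProd u u = 0 := by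
  have := sympProd_swap u u; linarith

theorem sympProd_add_right {ι : Type} [Fintype ι] (u v w : PhaseSpace ι) :
    sympProd u (v + w) = sympProd u v + sympProd u w := by
  rw [sympProd_swap, sympProd_add_left, sympProd_swap v, sympProd_swap w]; ring

theorem sympProd_smul_right {ι : Type} [Fintype ι] (r : ℝ) (u w : PhaseSpace ι) :
    sympProd u (r • w) = r * sympProd u w := by
  rw [sympProd_swap, sympProd_smul_left, sympProd_swap w]; ring

theorem sympProd_neg_left {ι : Type} [Fintype ι] (u w : PhaseSpace ι) :
    sympProd (-u) w = -sympProd u w := by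
  rw [← neg_one_smul ℝ u, sympProd_smul_left]; ring

theorem sympProd_neg_right {ι : Type} [Fintype ι] (u w : PhaseSpace ι) :
    sympProd u (-w) = -sympProd u w := by
  rw [← neg_one_smul ℝ w, sympProd_smul_right]; ring

theorem sympProd_sub_left {ι : Type} [Fintype ι] (u v w : PhaseSpace ι) :
    sympProd (u - v) w = sympProd u w - sympProd v w := by
  rw [sub_eq_add_neg, sympProd_add_left, sympProd_neg_left]; ring

theorem sympProd_sub_right {ι : Type} [Fintype ι] (u v w : PhaseSpace ι) :
    sympProd u (v - w) = sympProd u v - sympProd u w := by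
  rw [sub_eq_add_neg, sympProd_add_right, sympProd_neg_right]; ring

theorem sympProd_zero_left {ι : Type} [Fintype ι] (w : PhaseSpace ι) : sympProd 0 w = 0 := by
  simp [sympProd]

theorem sympProd_zero_right {ι : Type} [Fintype ι] (w : PhaseSpace ι) : sympProd w 0 = 0 := by
  simp [sympProd]

theorem sympProd_joint {ι κ : Type} [Fintype ι] [Fintype κ] (a a' : PhaseSpace ι)
    (b b' : PhaseSpace κ) :
    sympProd (joint a b) (joint a' b') = sympProd a a' + sympProd b b' := by
  simp [sympProd, joint, Fintype.sum_sum_type]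
  ring

/-! ### Linear maps implemented by unitaries -/

/-- A linear automorphism of the sender's phase space that is implemented, without phase factors, by
a unitary operator on the sender's modes. -/
def IsImplementable (κ : Type) {ι : Type} [Fintype ι] [Fintype κ] [DecidableEq ι] [DecidableEq κ]
    (Υ : PhaseSpace ι ≃ₗ[ℝ] PhaseSpace ι) : Prop :=
  ∃ (U : HilbertState ι ≃ₗᵢ[ℂ] HilbertState ι) (W : GenState (ι ⊕ κ) ≃L[ℂ] GenState (ι ⊕ κ)),
    IsLocalExtension U W ∧
    (∀ a b T, W (dispOp (joint a b) T) = dispOp (joint (Υ a) b) (W T)) ∧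
    ∀ a b T, W (quadObs (joint a b) T) = quadObs (joint (Υ a) b) (W T)

theorem IsImplementable.refl (κ : Type) {ι : Type} [Fintype ι] [Fintype κ] [DecidableEq ι]
    [DecidableEq κ] : IsImplementable κ (LinearEquiv.refl ℝ (PhaseSpace ι)) :=
  ⟨LinearIsometryEquiv.refl ℂ _, ContinuousLinearEquiv.refl ℂ _, fun _ _ => rfl,
    fun _ _ _ => rfl, fun _ _ _ => rfl⟩

theorem IsImplementable.trans {κ ι : Type} [Fintype ι] [Fintype κ] [DecidableEq ι]
    [DecidableEq κ] {Υ Υ' : PhaseSpace ι ≃ₗ[ℝ] PhaseSpace ι} (h : IsImplementable κ Υ)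
    (h' : IsImplementable κ Υ') : IsImplementable κ (Υ.trans Υ') := by
  obtain ⟨U, W, h1, h2, h3⟩ := h
  obtain ⟨U', W', h1', h2', h3'⟩ := h'
  refine ⟨U.trans U', W.trans W', fun F G => ?_, fun a b T => ?_, fun a b T => ?_⟩
  · simp only [ContinuousLinearEquiv.trans_apply, h1 F G, h1' (U F) G,
      LinearIsometryEquiv.trans_apply]
  · simp only [ContinuousLinearEquiv.trans_apply, h2, h2', LinearEquiv.trans_apply]
  · simp only [ContinuousLinearEquiv.trans_apply, h3, h3', LinearEquiv.trans_apply]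

theorem IsImplementable.symm {κ ι : Type} [Fintype ι] [Fintype κ] [DecidableEq ι]
    [DecidableEq κ] {Υ : PhaseSpace ι ≃ₗ[ℝ] PhaseSpace ι} (h : IsImplementable κ Υ) :
    IsImplementable κ Υ.symm := by
  obtain ⟨U, W, h1, h2, h3⟩ := h
  refine ⟨U.symm, W.symm, fun F G => ?_, fun a b T => ?_, fun a b T => ?_⟩
  · rw [ContinuousLinearEquiv.symm_apply_eq, h1 (U.symm F) G, LinearIsometryEquiv.apply_symm_apply]
  · rw [ContinuousLinearEquiv.symm_apply_eq, h2, ContinuousLinearEquiv.apply_symm_apply,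
      LinearEquiv.apply_symm_apply]
  · rw [ContinuousLinearEquiv.symm_apply_eq, h3, ContinuousLinearEquiv.apply_symm_apply,
      LinearEquiv.apply_symm_apply]

/-! ### Symplectic transvections are implementable -/

theorem transv_neg_transv {ι : Type} [Fintype ι] (s : ℝ) (a u : PhaseSpace ι) :
    transv (-s) a (transv s a u) = u := by
  simp only [transv, sympProd_add_right, sympProd_smul_right, sympProd_self]
  module

/-- A symplectic transvection as a linear automorphism. -/
def transvEquiv {ι : Type} [Fintype ι] (s : ℝ) (a : PhaseSpace ι) :
    PhaseSpace ι ≃ₗ[ℝ] PhaseSpace ι where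
  toFun := transv s a
  invFun := transv (-s) a
  map_add' u v := by simp only [transv, sympProd_add_right]; module
  map_smul' r u := by simp only [transv, sympProd_smul_right, RingHom.id_apply]; module
  left_inv u := transv_neg_transv s a u
  right_inv u := by simpa using transv_neg_transv (-s) a u

theorem transvEquiv_apply {ι : Type} [Fintype ι] (s : ℝ) (a u : PhaseSpace ι) :
    transvEquiv s a u = transv s a u := rfl

theorem sympProd_transv {ι : Type} [Fintype ι] (s : ℝ) (a u v : PhaseSpace ι) :
    sympProd (transv s a u) (transv s a v) = sympProd u v := by
  simp only [transv, sympProd_add_right, sympProd_smul_right, sympProd_self, sympProd_add_left,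
    sympProd_smul_left]
  rw [sympProd_swap u a]
  ring

theorem transv_joint {ι κ : Type} [Fintype ι] [Fintype κ] (s : ℝ) (p : ι → ℝ) (a : PhaseSpace ι)
    (b : PhaseSpace κ) :
    transv s (Sum.elim p 0, 0) (joint a b) = joint (transv s (p, 0) a) b := by
  have h : sympProd ((Sum.elim p 0, 0) : PhaseSpace (ι ⊕ κ)) (joint a b) =
      sympProd (p, 0) a := by
    simp [sympProd, joint, Fintype.sum_sum_type]
  simp only [transv, h]
  ext i <;> rcases i with i | i <;> simp [joint]

theorem isImplementable_transv_fst (κ : Type) {ι : Type} [Fintype ι] [Fintype κ] [DecidableEq ι]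
    [DecidableEq κ] (s : ℝ) (p : ι → ℝ) : IsImplementable κ (transvEquiv s (p, 0)) :=
  ⟨_, _, isLocalExtension_chirp s p,
    fun a b T => by rw [chirpEquiv_dispOp, transv_joint]; rfl,
    fun a b T => by rw [chirpEquiv_quadObs, transv_joint]; rfl⟩

theorem fourierRot_joint {ι κ : Type} (a : PhaseSpace ι) (b : PhaseSpace κ) :
    fourierRot (joint a b) = joint (fourierRot a) (fourierRot b) := by
  ext i <;> rcases i with i | i <;> simp [joint, fourierRot]

theorem sympProd_fourierRot {ι : Type} [Fintype ι] (u v : PhaseSpace ι) :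
    sympProd (fourierRot u) (fourierRot v) = sympProd u v := by
  simp only [sympProd, fourierRot, Pi.smul_apply, smul_eq_mul]
  refine Finset.sum_congr rfl fun i _ => ?_
  have := Real.pi_ne_zero
  field_simp
  ring

theorem fourierRot_transv {ι : Type} [Fintype ι] (s : ℝ) (a u : PhaseSpace ι) :
    fourierRot (transv s a u) = transv s (fourierRot a) (fourierRot u) := by
  simp only [transv, sympProd_fourierRot]
  ext i <;> simp [fourierRot] <;> ring

/-- The extension is conjugated by the Fourier transform of all modes, the unitary by that of the
sender's modes only. These match because the chirp does not touch the receiver, where the transform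
and its inverse cancel. -/
theorem isImplementable_transv_snd (κ : Type) {ι : Type} [Fintype ι] [Fintype κ] [DecidableEq ι]
    [DecidableEq κ] (s : ℝ) (x : ι → ℝ) : IsImplementable κ (transvEquiv s (0, x)) := by
  obtain ⟨U, W, h1, h2, h3⟩ := isImplementable_transv_fst κ s ((-(2 * Real.pi)) • x)
  have hrot : (((-(2 * Real.pi)) • x, 0) : PhaseSpace ι) = fourierRot (0, x) := by
    simp [fourierRot]
  set FL := Lp.fourierTransformₗᵢ (Config ι) ℂ
  set FG := FourierTransform.fourierCLE ℂ (GenState (ι ⊕ κ))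
  refine ⟨(FL.trans U).trans FL.symm, (FG.trans W).trans FG.symm, fun F G => ?_, fun a b T => ?_,
    fun a b T => ?_⟩
  · simp only [ContinuousLinearEquiv.trans_apply, LinearIsometryEquiv.trans_apply]
    rw [ContinuousLinearEquiv.symm_apply_eq]
    change W (𝓕 (Lp.toTemperedDistribution (tensorState F G))) =
      𝓕 (Lp.toTemperedDistribution (tensorState (FL.symm (U (FL F))) G))
    rw [Lp.fourier_toTemperedDistribution_eq, Lp.fourier_toTemperedDistribution_eq,
      fourier_tensorState, fourier_tensorState, h1]
    congr 2
    exact (FL.apply_symm_apply _).symm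
  · simp only [ContinuousLinearEquiv.trans_apply]
    rw [ContinuousLinearEquiv.symm_apply_eq]
    change W (𝓕 (dispOp (joint a b) T)) = 𝓕 (dispOp _ (FG.symm (W (𝓕 T))))
    rw [fourier_dispOp, fourier_dispOp, fourierRot_joint, fourierRot_joint, h2, transvEquiv_apply,
      transvEquiv_apply, fourierRot_transv, hrot]
    congr 1
    exact (FG.apply_symm_apply _).symm
  · simp only [ContinuousLinearEquiv.trans_apply]
    rw [ContinuousLinearEquiv.symm_apply_eq]
    change W (𝓕 (quadObs (joint a b) T)) = 𝓕 (quadObs _ (FG.symm (W (𝓕 T))))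
    rw [fourier_quadObs, fourier_quadObs, fourierRot_joint, fourierRot_joint, h3,
      transvEquiv_apply, transvEquiv_apply, fourierRot_transv, hrot]
    congr 1
    exact (FG.apply_symm_apply _).symm

theorem transv_conj {ι : Type} [Fintype ι] (s : ℝ) (a u : PhaseSpace ι)
    {g : PhaseSpace ι ≃ₗ[ℝ] PhaseSpace ι} (hg : ∀ u v, sympProd (g u) (g v) = sympProd u v) :
    g (transv s a u) = transv s (g a) (g u) := by
  simp only [transv, map_add, map_smul, hg]

/-- For `x ≠ 0`, a product `g` of the two implementable kinds carries `(p|x)` to `(t x|0)`; the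
transvection along `(p|x)` is then the `g`-conjugate of one along a pure momentum vector. -/
theorem isImplementable_transv (κ : Type) {ι : Type} [Fintype ι] [Fintype κ] [DecidableEq ι]
    [DecidableEq κ] (s : ℝ) (a : PhaseSpace ι) : IsImplementable κ (transvEquiv s a) := by
  obtain ⟨p, x⟩ := a
  by_cases hx : x = 0
  · rw [hx]; exact isImplementable_transv_fst κ s p
  have hxx : 0 < ∑ i, x i * x i := by
    refine lt_of_le_of_ne (Finset.sum_nonneg fun i _ => mul_self_nonneg _) fun h => hx ?_
    ext i
    have := (Finset.sum_eq_zero_iff_of_nonneg fun i _ => mul_self_nonneg (x i)).1 h.symm i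
      (Finset.mem_univ i)
    simpa using this
  -- As `x · x > 0`, the affine function of `t` has one root, so `1` or `2` avoids it.
  obtain ⟨t, ht0, ht⟩ : ∃ t : ℝ, t ≠ 0 ∧ t * ∑ i, x i * x i - ∑ i, p i * x i ≠ 0 := by
    by_cases h : (1 : ℝ) * ∑ i, x i * x i - ∑ i, p i * x i ≠ 0
    · exact ⟨1, one_ne_zero, h⟩
    · exact ⟨2, two_ne_zero, fun h' => by rw [not_not] at h; linarith⟩
  set y : ι → ℝ := t • x - p with hy
  have hyx : ∑ i, y i * x i ≠ 0 := by
    simpa [hy, sub_mul, mul_assoc, ← Finset.mul_sum] using ht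
  -- The first factor adds `(y|0)`, turning `(p|x)` into `(t x|x)`; the second then subtracts
  -- `(0|x)`. The scalars normalise the two products to `1` and `-1`.
  set g := (transvEquiv (∑ i, y i * x i)⁻¹ ((y, 0) : PhaseSpace ι)).trans
    (transvEquiv (t * ∑ i, x i * x i)⁻¹ (0, x)) with hg
  have hgi : IsImplementable κ g :=
    (isImplementable_transv_fst κ _ _).trans (isImplementable_transv_snd κ _ _)
  have hgs : ∀ u v, sympProd (g u) (g v) = sympProd u v := fun u v => by
    simp only [hg, LinearEquiv.trans_apply, transvEquiv_apply, sympProd_transv]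
  have hga : g (p, x) = (t • x, 0) := by
    have h1 : transv (∑ i, y i * x i)⁻¹ ((y, 0) : PhaseSpace ι) (p, x) = (t • x, x) := by
      have : sympProd ((y, 0) : PhaseSpace ι) (p, x) = ∑ i, y i * x i := by simp [sympProd]
      rw [transv, this, inv_mul_cancel₀ hyx]
      ext i <;> simp [hy]
    have h2 : sympProd ((0, x) : PhaseSpace ι) (t • x, x) = -(t * ∑ i, x i * x i) := by
      simp only [sympProd, Pi.zero_apply, Pi.smul_apply, smul_eq_mul, Finset.mul_sum,
        ← Finset.sum_neg_distrib]
      exact Finset.sum_congr rfl fun i _ => by ring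
    have h3 : t * ∑ i, x i * x i ≠ 0 := mul_ne_zero ht0 hxx.ne'
    simp only [hg, LinearEquiv.trans_apply, transvEquiv_apply, h1]
    rw [transv, h2, mul_neg, inv_mul_cancel₀ h3]
    ext i <;> simp
  have hc : transvEquiv s (p, x) = (g.trans (transvEquiv s (t • x, 0))).trans g.symm := by
    ext1 u
    rw [LinearEquiv.trans_apply, LinearEquiv.trans_apply, LinearEquiv.eq_symm_apply,
      transvEquiv_apply, transvEquiv_apply, transv_conj s _ _ hgs, hga]
  rw [hc]
  exact (hgi.trans (isImplementable_transv_fst κ s _)).trans hgi.symm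

/-! ### Witt-type transitivity on hyperbolic pairs -/

/-- Implementable symplectic automorphisms that fix all vectors of `K`. -/
def IsImplementableFixing (κ : Type) {ι : Type} [Fintype ι] [Fintype κ] [DecidableEq ι]
    [DecidableEq κ] (K : Set (PhaseSpace ι)) (g : PhaseSpace ι ≃ₗ[ℝ] PhaseSpace ι) : Prop :=
  IsImplementable κ g ∧ (∀ u v, sympProd (g u) (g v) = sympProd u v) ∧ ∀ w ∈ K, g w = w

section Fixing

variable {κ ι : Type} [Fintype ι] [Fintype κ] [DecidableEq ι] [DecidableEq κ]
  {K : Set (PhaseSpace ι)}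

theorem IsImplementableFixing.trans {g g' : PhaseSpace ι ≃ₗ[ℝ] PhaseSpace ι}
    (h : IsImplementableFixing κ K g) (h' : IsImplementableFixing κ K g') :
    IsImplementableFixing κ K (g.trans g') :=
  ⟨h.1.trans h'.1, fun u v => by rw [LinearEquiv.trans_apply, LinearEquiv.trans_apply, h'.2.1,
    h.2.1], fun w hw => by rw [LinearEquiv.trans_apply, h.2.2 w hw, h'.2.2 w hw]⟩

/-- The transvection along `a' - a` adds a multiple of `a' - a` to `a`, and the scalar `(a' ⊙ a)⁻¹`
makes this multiple `1`. It fixes everything orthogonal to `a' - a`. -/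
theorem exists_fixing_of_sympProd_ne_zero {a a' : PhaseSpace ι}
    (hK : ∀ w ∈ K, sympProd (a' - a) w = 0) (haa' : sympProd a a' ≠ 0) :
    ∃ g, IsImplementableFixing κ K g ∧ g a = a' := by
  refine ⟨transvEquiv (sympProd a' a)⁻¹ (a' - a), ⟨isImplementable_transv κ _ _,
    fun u v => sympProd_transv _ _ _ _, fun w hw => ?_⟩, ?_⟩
  · rw [transvEquiv_apply, transv, hK w hw]; simp
  · have h : sympProd a' a ≠ 0 := by rw [sympProd_swap]; exact neg_ne_zero.2 haa'
    rw [transvEquiv_apply, transv, sympProd_sub_left, sympProd_self, sub_zero,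
      inv_mul_cancel₀ h]
    simp

theorem exists_fixing_of_sympProd_ne_zero₂ {a z a' : PhaseSpace ι}
    (hK : ∀ w ∈ K, sympProd (z - a) w = 0) (hK' : ∀ w ∈ K, sympProd (a' - z) w = 0)
    (haz : sympProd a z ≠ 0) (hza' : sympProd z a' ≠ 0) :
    ∃ g, IsImplementableFixing κ K g ∧ g a = a' := by
  obtain ⟨g, hg, hga⟩ := exists_fixing_of_sympProd_ne_zero (κ := κ) hK haz
  obtain ⟨g', hg', hga'⟩ := exists_fixing_of_sympProd_ne_zero (κ := κ) hK' hza'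
  exact ⟨g.trans g', hg.trans hg', by rw [LinearEquiv.trans_apply, hga, hga']⟩

/-- If `a ⊙ e = 0`, the passage goes through a vector with nonzero product with both: `f` or `b` if
one of them qualifies, and otherwise `b + f`, whose products with `a` and `e` are then `±1`. -/
theorem exists_fixing_map_fst {a b e f : PhaseSpace ι} (ha : ∀ w ∈ K, sympProd a w = 0)
    (hb : ∀ w ∈ K, sympProd b w = 0) (he : ∀ w ∈ K, sympProd e w = 0)
    (hf : ∀ w ∈ K, sympProd f w = 0) (hab : sympProd a b = 1) (hef : sympProd e f = 1) :
    ∃ g, IsImplementableFixing κ K g ∧ g a = e := by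
  by_cases hae : sympProd a e = 0
  swap
  · exact exists_fixing_of_sympProd_ne_zero
      (fun w hw => by rw [sympProd_sub_left, he w hw, ha w hw, sub_zero]) hae
  obtain ⟨z, hz, haz, hze⟩ : ∃ z, (∀ w ∈ K, sympProd z w = 0) ∧ sympProd a z ≠ 0 ∧
      sympProd z e ≠ 0 := by
    by_cases haf : sympProd a f = 0
    · by_cases hbe : sympProd b e = 0
      · refine ⟨b + f, fun w hw => by rw [sympProd_add_left, hb w hw, hf w hw, add_zero], ?_, ?_⟩
        · rw [sympProd_add_right, hab, haf]; norm_num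
        · rw [sympProd_add_left, hbe, sympProd_swap, hef]; norm_num
      · exact ⟨b, hb, by rw [hab]; norm_num, hbe⟩
    · exact ⟨f, hf, haf, by rw [sympProd_swap, hef]; norm_num⟩
  exact exists_fixing_of_sympProd_ne_zero₂ (z := z)
    (fun w hw => by rw [sympProd_sub_left, hz w hw, ha w hw, sub_zero])
    (fun w hw => by rw [sympProd_sub_left, he w hw, hz w hw, sub_zero]) haz hze

/-- After `a` has reached `e`, the image `b'` of `b` and the target `f` have the same product with
`e`. So `f - b'` is orthogonal to `e`, and the second move can fix `e` along with `K`. -/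
theorem exists_fixing_map_pair {a b e f : PhaseSpace ι} (ha : ∀ w ∈ K, sympProd a w = 0)
    (hb : ∀ w ∈ K, sympProd b w = 0) (he : ∀ w ∈ K, sympProd e w = 0)
    (hf : ∀ w ∈ K, sympProd f w = 0) (hab : sympProd a b = 1) (hef : sympProd e f = 1) :
    ∃ g, IsImplementableFixing κ K g ∧ g a = e ∧ g b = f := by
  obtain ⟨g, hg, hga⟩ := exists_fixing_map_fst (κ := κ) ha hb he hf hab hef
  set b' := g b with hb'
  have hb'K : ∀ w ∈ K, sympProd b' w = 0 := fun w hw => by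
    rw [← hg.2.2 w hw, hb', hg.2.1, hb w hw]
  have heb' : sympProd e b' = 1 := by rw [← hga, hb', hg.2.1, hab]
  obtain ⟨g', hg', hgb'⟩ : ∃ g', IsImplementableFixing κ (insert e K) g' ∧ g' b' = f := by
    by_cases h : sympProd b' f = 0
    -- The detour through `b' + e` keeps the product with `e`, and has products `-1` and `1` with
    -- the two ends.
    · refine exists_fixing_of_sympProd_ne_zero₂ (z := b' + e) ?_ ?_ ?_ ?_
      · rintro w (rfl | hw)
        · rw [add_sub_cancel_left, sympProd_self]
        · rw [add_sub_cancel_left, he w hw]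
      · rintro w (rfl | hw)
        · rw [sympProd_sub_left, sympProd_add_left, sympProd_self, sympProd_swap, hef,
            sympProd_swap, heb']
          norm_num
        · rw [sympProd_sub_left, sympProd_add_left, hf w hw, hb'K w hw, he w hw]
          norm_num
      · rw [sympProd_add_right, sympProd_self, sympProd_swap, heb']
        norm_num
      · rw [sympProd_add_left, h, hef]
        norm_num
    · refine exists_fixing_of_sympProd_ne_zero ?_ h
      rintro w (rfl | hw)
      · rw [sympProd_sub_left, sympProd_swap, hef, sympProd_swap, heb']
        norm_num
      · rw [sympProd_sub_left, hf w hw, hb'K w hw, sub_zero]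
  have hg'K : IsImplementableFixing κ K g' :=
    ⟨hg'.1, hg'.2.1, fun w hw => hg'.2.2 w (Set.mem_insert_of_mem _ hw)⟩
  refine ⟨g.trans g', hg.trans hg'K, ?_, ?_⟩
  · rw [LinearEquiv.trans_apply, hga, hg'.2.2 e (Set.mem_insert _ _)]
  · rw [LinearEquiv.trans_apply, ← hb', hgb']

end Fixing

theorem isSymplecticBasis_std {ι : Type} [Fintype ι] [DecidableEq ι] :
    IsSymplecticBasis (stdP : ι → PhaseSpace ι) stdX := by
  refine ⟨fun i j => ?_, fun i j => ?_, fun i j => ?_⟩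
  · simp [sympProd, stdP, stdX, Pi.single_apply, eq_comm]
  · simp [sympProd, stdP]
  · simp [sympProd, stdX]

/-- Every symplectic basis is carried to the standard one by an implementable map. -/
theorem IsSymplecticBasis.exists_isImplementable (κ : Type) {ι : Type} [Fintype ι] [Fintype κ]
    [DecidableEq ι] [DecidableEq κ] {u v : ι → PhaseSpace ι} (h : IsSymplecticBasis u v) :
    ∃ Υ : PhaseSpace ι ≃ₗ[ℝ] PhaseSpace ι, IsImplementable κ Υ ∧
      (∀ u v, sympProd (Υ u) (Υ v) = sympProd u v) ∧
      ∀ i, Υ (u i) = stdP i ∧ Υ (v i) = stdX i := by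
  have key : ∀ s : Finset ι, ∃ Υ : PhaseSpace ι ≃ₗ[ℝ] PhaseSpace ι, IsImplementable κ Υ ∧
      (∀ u v, sympProd (Υ u) (Υ v) = sympProd u v) ∧
      ∀ i ∈ s, Υ (u i) = stdP i ∧ Υ (v i) = stdX i := by
    intro s
    induction s using Finset.induction_on with
    | empty => exact ⟨LinearEquiv.refl ℝ _, IsImplementable.refl κ, fun _ _ => rfl, by simp⟩
    | insert j s hj ih =>
      obtain ⟨Υ, h1, h2, h3⟩ := ih
      obtain ⟨s1, s2, s3⟩ := isSymplecticBasis_std (ι := ι)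
      obtain ⟨t1, t2, t3⟩ := h
      have hne : ∀ i ∈ s, j ≠ i := fun i hi hji => hj (hji ▸ hi)
      -- The standard vectors already reached; fixing them preserves the earlier part of the
      -- construction.
      set K : Set (PhaseSpace ι) := {w | ∃ i ∈ s, w = stdP i ∨ w = stdX i}
      obtain ⟨g, hg, hgu, hgv⟩ := exists_fixing_map_pair (κ := κ) (K := K) (a := Υ (u j))
        (b := Υ (v j)) (e := stdP j) (f := stdX j)
        (by
          rintro w ⟨i, hi, rfl | rfl⟩
          · rw [← (h3 i hi).1, h2, t2]
          · rw [← (h3 i hi).2, h2, t1, if_neg (hne i hi)])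
        (by
          rintro w ⟨i, hi, rfl | rfl⟩
          · rw [← (h3 i hi).1, h2, sympProd_swap, t1, if_neg (hne i hi).symm, neg_zero]
          · rw [← (h3 i hi).2, h2, t3])
        (by
          rintro w ⟨i, hi, rfl | rfl⟩
          · rw [s2]
          · rw [s1, if_neg (hne i hi)])
        (by
          rintro w ⟨i, hi, rfl | rfl⟩
          · rw [sympProd_swap, s1, if_neg (hne i hi).symm, neg_zero]
          · rw [s3])
        (by rw [h2, t1, if_pos rfl]) (by rw [s1, if_pos rfl])
      refine ⟨Υ.trans g, h1.trans hg.1, fun u v => ?_, fun i hi => ?_⟩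
      · rw [LinearEquiv.trans_apply, LinearEquiv.trans_apply, hg.2.1, h2]
      · rw [LinearEquiv.trans_apply, LinearEquiv.trans_apply]
        rcases Finset.mem_insert.1 hi with rfl | hi
        · exact ⟨hgu, hgv⟩
        · rw [(h3 i hi).1, (h3 i hi).2]
          exact ⟨hg.2.2 _ ⟨i, hi, Or.inl rfl⟩, hg.2.2 _ ⟨i, hi, Or.inr rfl⟩⟩
  obtain ⟨Υ, h1, h2, h3⟩ := key Finset.univ
  exact ⟨Υ, h1, h2, fun i => h3 i (Finset.mem_univ i)⟩

/-! ### Adapted symplectic bases -/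

/-- The symplectic product as a bilinear form. -/
def sympForm (ι : Type) [Fintype ι] : LinearMap.BilinForm ℝ (PhaseSpace ι) :=
  LinearMap.mk₂ ℝ sympProd sympProd_add_left sympProd_smul_left sympProd_add_right
    sympProd_smul_right

theorem sympForm_apply {ι : Type} [Fintype ι] (u v : PhaseSpace ι) :
    sympForm ι u v = sympProd u v := rfl

theorem sympProd_sum_left {ι I : Type} [Fintype ι] [Fintype I] (c : I → ℝ) (u : I → PhaseSpace ι)
    (w : PhaseSpace ι) : sympProd (∑ i, c i • u i) w = ∑ i, c i * sympProd (u i) w := by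
  simp [← sympForm_apply]

/-- Pairing a linear relation with the partner of a vector isolates that vector's coefficient. -/
theorem linearIndependent_of_sympProd {ι I : Type} [Fintype ι] [Fintype I] {u v : I → PhaseSpace ι}
    (h1 : ∀ i, sympProd (u i) (v i) = 1) (h2 : ∀ i j, i ≠ j → sympProd (u i) (v j) = 0)
    (h3 : ∀ i j, sympProd (u i) (u j) = 0) (h4 : ∀ i j, sympProd (v i) (v j) = 0) :
    LinearIndependent ℝ (Sum.elim u v) := by
  classical
  rw [Fintype.linearIndependent_iff]
  intro g hg
  rw [Fintype.sum_sum_type] at hg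
  simp only [Sum.elim_inl, Sum.elim_inr] at hg
  have hw : ∀ w, ∑ i, g (Sum.inl i) * sympProd (u i) w + ∑ i, g (Sum.inr i) * sympProd (v i) w =
      0 := fun w => by
    rw [← sympProd_sum_left, ← sympProd_sum_left, ← sympProd_add_left, hg, sympProd_zero_left]
  rintro (j | j)
  · have := hw (v j)
    simp only [h4, mul_zero, Finset.sum_const_zero, add_zero] at this
    rw [Finset.sum_eq_single j (fun i _ hij => by rw [h2 i j hij, mul_zero]) (by simp), h1,
      mul_one] at this
    exact this
  · have := hw (u j)
    simp only [h3, mul_zero, Finset.sum_const_zero, zero_add] at this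
    rw [Finset.sum_eq_single j (fun i _ hij => by
      rw [sympProd_swap, h2 j i hij.symm, neg_zero, mul_zero]) (by simp), sympProd_swap, h1] at this
    linarith

/-- `(u_i, v_i)` are hyperbolic pairs spanning `E`, of which the `u_i` with `Q i` and the `v_i` with
`P i` span `V`. -/
structure IsAdaptedFamily {ι I : Type} [Fintype ι] (E V : Submodule ℝ (PhaseSpace ι))
    (u v : I → PhaseSpace ι) (P Q : I → Prop) : Prop where
  pair : ∀ i, sympProd (u i) (v i) = 1
  uv : ∀ i j, i ≠ j → sympProd (u i) (v j) = 0
  uu : ∀ i j, sympProd (u i) (u j) = 0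
  vv : ∀ i j, sympProd (v i) (v j) = 0
  span_eq : E = Submodule.span ℝ (Set.range u ∪ Set.range v)
  span_eq' : V = Submodule.span ℝ (u '' {i | Q i} ∪ v '' {i | P i})
  imp : ∀ i, P i → Q i

theorem mem_sympDual_span_pair {ι : Type} [Fintype ι] (a b w : PhaseSpace ι) :
    w ∈ sympDual (Submodule.span ℝ {a, b}) ↔ sympProd w a = 0 ∧ sympProd w b = 0 := by
  constructor
  · intro h
    exact ⟨h a (Submodule.subset_span (by simp)), h b (Submodule.subset_span (by simp))⟩
  · rintro ⟨h1, h2⟩ x hx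
    obtain ⟨r, s, rfl⟩ := Submodule.mem_span_pair.1 hx
    rw [sympProd_add_right, sympProd_smul_right, sympProd_smul_right, h1, h2]; ring

/-- The inductive step of the construction: a family of an orthogonal complement is enlarged by one
hyperbolic pair, with index `none`. -/
theorem IsAdaptedFamily.option {ι I : Type} [Fintype ι] {E V E' V' : Submodule ℝ (PhaseSpace ι)}
    {u v : I → PhaseSpace ι} {P Q : I → Prop} (h : IsAdaptedFamily E' V' u v P Q)
    {a b : PhaseSpace ι} (hab : sympProd a b = 1)
    (hE' : E' ≤ sympDual (Submodule.span ℝ {a, b})) (hE : E = E' ⊔ Submodule.span ℝ {a, b})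
    {p q : Prop} (hpq : p → q)
    (hV : V = V' ⊔ Submodule.span ℝ ({x | x = a ∧ q} ∪ {x | x = b ∧ p})) :
    IsAdaptedFamily E V (fun o : Option I => o.elim a u) (fun o => o.elim b v)
      (fun o => o.elim p P) (fun o => o.elim q Q) := by
  have hu : ∀ i, sympProd (u i) a = 0 ∧ sympProd (u i) b = 0 := fun i =>
    (mem_sympDual_span_pair a b _).1 (hE' (h.span_eq ▸ Submodule.subset_span (Or.inl ⟨i, rfl⟩)))
  have hv : ∀ i, sympProd (v i) a = 0 ∧ sympProd (v i) b = 0 := fun i =>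
    (mem_sympDual_span_pair a b _).1 (hE' (h.span_eq ▸ Submodule.subset_span (Or.inr ⟨i, rfl⟩)))
  refine ⟨?_, ?_, ?_, ?_, ?_, ?_, ?_⟩
  · rintro (_ | i)
    · exact hab
    · exact h.pair i
  · rintro (_ | i) (_ | j) hij
    · exact absurd rfl hij
    · change sympProd a (v j) = 0
      rw [sympProd_swap, (hv j).1, neg_zero]
    · exact (hu i).2
    · exact h.uv i j fun hij' => hij (by rw [hij'])
  · rintro (_ | i) (_ | j)
    · exact sympProd_self a
    · change sympProd a (u j) = 0
      rw [sympProd_swap, (hu j).1, neg_zero]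
    · exact (hu i).1
    · exact h.uu i j
  · rintro (_ | i) (_ | j)
    · exact sympProd_self b
    · change sympProd b (v j) = 0
      rw [sympProd_swap, (hv j).2, neg_zero]
    · exact (hv i).2
    · exact h.vv i j
  · rw [hE, h.span_eq, ← Submodule.span_union]
    congr 1
    ext x
    simp only [Set.mem_union, Set.mem_range, Set.mem_insert_iff, Set.mem_singleton_iff,
      Option.exists, Option.elim]
    grind
  · rw [hV, h.span_eq', ← Submodule.span_union]
    congr 1
    ext x
    simp only [Set.mem_union, Set.mem_image, Set.mem_ofPred_eq, Option.exists, Option.elim]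
    grind
  · rintro (_ | i)
    · exact hpq
    · exact h.imp i

/-- Induction on a bound for the dimension of the nondegenerate space `E`: a hyperbolic pair
compatible with `V` is split off, and its orthogonal complement in `E` is again nondegenerate and
strictly smaller. -/
theorem exists_isAdaptedFamily {ι : Type} [Fintype ι] : ∀ (N : ℕ)
    (E V : Submodule ℝ (PhaseSpace ι)), Module.finrank ℝ E ≤ N → V ≤ E →
    (∀ w ∈ E, (∀ e ∈ E, sympProd w e = 0) → w = 0) →
    ∃ (I : Type) (_ : Fintype I) (u v : I → PhaseSpace ι) (P Q : I → Prop),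
      IsAdaptedFamily E V u v P Q := by
  intro N
  induction N with
  | zero =>
    intro E V hN hV _
    have hE : E = ⊥ := Submodule.finrank_eq_zero.1 (Nat.le_zero.1 hN)
    have hV' : V = ⊥ := by rwa [hE, le_bot_iff] at hV
    refine ⟨Empty, inferInstance, Empty.elim, Empty.elim, Empty.elim, Empty.elim, ?_⟩
    refine ⟨nofun, nofun, nofun, nofun, ?_, ?_, nofun⟩
    · rw [hE, eq_comm, Submodule.span_eq_bot]
      rintro x (⟨⟨⟩, _⟩ | ⟨⟨⟩, _⟩)
    · rw [hV', eq_comm, Submodule.span_eq_bot]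
      rintro x (⟨⟨⟩, _⟩ | ⟨⟨⟩, _⟩)
  | succ N ih =>
    intro E V hN hV hnd
    by_cases hE : E = ⊥
    · exact ih E V (by rw [hE, finrank_bot]; exact Nat.zero_le _) hV hnd
    -- Here `q` and `p` record whether `a` and `b` are placed in `V`. The decomposition clause says
    -- that projecting `V` along the pair stays in `V` and uses only the members recorded there.
    obtain ⟨a, b, p, q, ha, hb, hab, hpq, hdec, hq, hp⟩ : ∃ (a b : PhaseSpace ι) (p q : Prop),
        a ∈ E ∧ b ∈ E ∧ sympProd a b = 1 ∧ (p → q) ∧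
        (∀ w ∈ V, w - sympProd w b • a + sympProd w a • b ∈ V ∧
          (¬q → sympProd w b = 0) ∧ (¬p → sympProd w a = 0)) ∧ (q → a ∈ V) ∧ (p → b ∈ V) := by
      have hscale : ∀ a b : PhaseSpace ι, sympProd a b ≠ 0 →
          sympProd a ((sympProd a b)⁻¹ • b) = 1 := fun a b h => by
        rw [sympProd_smul_right, inv_mul_cancel₀ h]
      by_cases h1 : ∃ a ∈ V, ∃ b ∈ V, sympProd a b ≠ 0
      · obtain ⟨a, ha, b, hb, hab⟩ := h1
        have hb' : (sympProd a b)⁻¹ • b ∈ V := V.smul_mem _ hb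
        exact ⟨a, _, True, True, hV ha, hV hb', hscale a b hab, id,
          fun w hw => ⟨V.add_mem (V.sub_mem hw (V.smul_mem _ ha)) (V.smul_mem _ hb'),
            fun h => absurd trivial h, fun h => absurd trivial h⟩, fun _ => ha, fun _ => hb'⟩
      · push Not at h1
        by_cases h2 : V = ⊥
        · obtain ⟨a, ha, ha0⟩ := E.ne_bot_iff.1 hE
          obtain ⟨b, hb, hab⟩ : ∃ b ∈ E, sympProd a b ≠ 0 := by
            by_contra! h
            exact ha0 (hnd a ha h)
          refine ⟨a, _, False, False, ha, E.smul_mem _ hb, hscale a b hab, id, fun w hw => ?_,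
            fun h => h.elim, fun h => h.elim⟩
          rw [h2, Submodule.mem_bot] at hw
          simp [hw, sympProd_zero_left]
        -- For nonzero isotropic `V`, `a` is taken from `V` and its partner from `E`. The
        -- coefficient of `b` in the projection vanishes on `V` by isotropy.
        · obtain ⟨a, ha, ha0⟩ := V.ne_bot_iff.1 h2
          obtain ⟨b, hb, hab⟩ : ∃ b ∈ E, sympProd a b ≠ 0 := by
            by_contra! h
            exact ha0 (hnd a (hV ha) h)
          refine ⟨a, _, False, True, hV ha, E.smul_mem _ hb, hscale a b hab, fun _ => trivial,
            fun w hw => ⟨?_, fun h => absurd trivial h, fun _ => h1 w hw a ha⟩, fun _ => ha,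
            fun h => h.elim⟩
          rw [h1 w hw a ha, zero_smul, add_zero]
          exact V.sub_mem hw (V.smul_mem _ ha)
    set D := sympDual (Submodule.span ℝ {a, b}) with hD
    have hdecD : ∀ w, w - sympProd w b • a + sympProd w a • b ∈ D := fun w => by
      rw [hD, mem_sympDual_span_pair]
      simp only [sympProd_add_left, sympProd_sub_left, sympProd_smul_left, sympProd_self, hab,
        sympProd_swap b a]
      constructor <;> ring
    have hdecE : ∀ w ∈ E, w - sympProd w b • a + sympProd w a • b ∈ E ⊓ D := fun w hw =>
      ⟨E.add_mem (E.sub_mem hw (E.smul_mem _ ha)) (E.smul_mem _ hb), hdecD w⟩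
    have hlt : E ⊓ D < E := by
      refine lt_of_le_of_ne inf_le_left fun h => ?_
      have : a ∈ D := (h.ge ha).2
      rw [hD, mem_sympDual_span_pair, hab] at this
      exact one_ne_zero this.2
    have hspan : Submodule.span ℝ {a, b} ≤ E := by
      rw [Submodule.span_le]
      rintro x (rfl | rfl)
      · exact ha
      · exact hb
    obtain ⟨I, hI, u, v, P, Q, hf⟩ := ih (E ⊓ D) (V ⊓ D)
      -- Nondegeneracy passes to the complement: a vector of `E ⊓ D` has the same product with `e`
      -- as with the projection of `e`.
      (by have := Submodule.finrank_lt_finrank_of_lt hlt; omega) (inf_le_inf_right _ hV) (by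
        intro w hw hwe
        refine hnd w hw.1 fun e he => ?_
        have h1 := hwe _ (hdecE e he)
        have h2 := (mem_sympDual_span_pair a b w).1 hw.2
        rw [sympProd_add_right, sympProd_sub_right, sympProd_smul_right, sympProd_smul_right,
          h2.1, h2.2] at h1
        linarith)
    refine ⟨Option I, inferInstance, _, _, _, _, hf.option hab inf_le_right ?_ hpq ?_⟩
    · refine le_antisymm (fun w hw => ?_) (sup_le inf_le_left hspan)
      have : w = (w - sympProd w b • a + sympProd w a • b) +
          (sympProd w b • a + (-sympProd w a) • b) := by module
      rw [this]
      exact Submodule.add_mem_sup (hdecE w hw) (Submodule.mem_span_pair.2 ⟨_, _, rfl⟩)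
    · refine le_antisymm (fun w hw => ?_) (sup_le inf_le_left ?_)
      · have : w = (w - sympProd w b • a + sympProd w a • b) +
            (sympProd w b • a + (-sympProd w a) • b) := by module
        rw [this]
        obtain ⟨h1, h2, h3⟩ := hdec w hw
        refine Submodule.add_mem_sup ⟨h1, hdecD w⟩ (Submodule.add_mem _ ?_ ?_)
        · by_cases hq' : q
          · exact Submodule.smul_mem _ _ (Submodule.subset_span (Or.inl ⟨rfl, hq'⟩))
          · rw [h2 hq', zero_smul]; exact Submodule.zero_mem _
        · by_cases hp' : p
          · exact Submodule.smul_mem _ _ (Submodule.subset_span (Or.inr ⟨rfl, hp'⟩))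
          · rw [h3 hp', neg_zero, zero_smul]; exact Submodule.zero_mem _
      · rw [Submodule.span_le]
        rintro x (⟨rfl, h⟩ | ⟨rfl, h⟩)
        · exact hq h
        · exact hp h

theorem eq_zero_of_sympProd {ι : Type} [Fintype ι] (w : PhaseSpace ι)
    (h : ∀ e, sympProd w e = 0) : w = 0 := by
  classical
  ext i
  · have := h (stdX i)
    simpa [sympProd, stdX, Pi.single_apply] using this
  · have := h (stdP i)
    simpa [sympProd, stdP, Pi.single_apply] using this

/-- The index set of an adapted family has `n` elements, since its `2 |I|` vectors form a basis of a
`2n`-dimensional space. It remains to sort the pairs by how many members lie in `V`. -/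
theorem exists_symplecticBasis_span_parityRows {n : ℕ} (V : Submodule ℝ (PhaseSpace (Fin n))) :
    ∃ (c l k : ℕ) (hn : c + l + k = n) (u v : Fin n → PhaseSpace (Fin n)),
      IsSymplecticBasis u v ∧
      Submodule.span ℝ (Set.range (parityRows (modeLayout hn) u v)) = V := by
  classical
  obtain ⟨I, _, u, v, P, Q, h⟩ := exists_isAdaptedFamily _ ⊤ V le_rfl le_top
    (fun w _ hw => eq_zero_of_sympProd w fun e => hw e trivial)
  have hcard : Fintype.card I = n := by
    have hli := linearIndependent_of_sympProd h.pair h.uv h.uu h.vv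
    have hb := Module.finrank_eq_card_basis (Module.Basis.mk hli (by
      rw [Set.Sum.elim_range]; exact h.span_eq.le))
    have h2 : Module.finrank ℝ (PhaseSpace (Fin n)) = n + n := by simp
    rw [h2, Fintype.card_sum] at hb
    omega
  -- Pairs with `P` become entangled modes, those with `Q` but not `P` ancillas, and those without
  -- `Q` data modes.
  let e1 : I ≃ {i // Q i} ⊕ {i // ¬Q i} := (Equiv.sumCompl Q).symm
  let e2 : {i // Q i} ≃ {i : {i // Q i} // P i} ⊕ {i : {i // Q i} // ¬P i} :=
    (Equiv.sumCompl fun i : {i // Q i} => P i).symm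
  let eP := Fintype.equivFin {i : {i // Q i} // P i}
  let eQ := Fintype.equivFin {i : {i // Q i} // ¬P i}
  let eR := Fintype.equivFin {i // ¬Q i}
  let e : I ≃ (Fin _ ⊕ Fin _) ⊕ Fin _ := e1.trans ((e2.trans (eP.sumCongr eQ)).sumCongr eR)
  have hn : Fintype.card {i : {i // Q i} // P i} + Fintype.card {i : {i // Q i} // ¬P i} +
      Fintype.card {i // ¬Q i} = n := by
    rw [← hcard, Fintype.card_congr e]; simp
  have hs1 : ∀ a, e.symm (Sum.inl (Sum.inl a)) = (eP.symm a).1.1 := fun a => rfl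
  have hs2 : ∀ a, e.symm (Sum.inl (Sum.inr a)) = (eQ.symm a).1.1 := fun a => rfl
  refine ⟨_, _, _, hn, fun i => u (e.symm ((modeLayout hn).symm i)),
    fun i => v (e.symm ((modeLayout hn).symm i)), ⟨fun i j => ?_, fun i j => h.uu _ _,
      fun i j => h.vv _ _⟩, ?_⟩
  · by_cases hij : i = j
    · rw [if_pos hij, hij]; exact h.pair _
    · rw [if_neg hij]
      exact h.uv _ _ fun h => hij ((modeLayout hn).symm.injective (e.symm.injective h))
  · rw [h.span_eq']
    congr 1
    ext x
    constructor
    · rintro ⟨((a | a) | a), rfl⟩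
      · exact Or.inl ⟨_, (eP.symm a).1.2, by simp [parityRows, hs1]⟩
      · exact Or.inl ⟨_, (eQ.symm a).1.2, by simp [parityRows, hs2]⟩
      · exact Or.inr ⟨_, (eP.symm a).2, by simp [parityRows, hs1]⟩
    · rintro (⟨i, hi, rfl⟩ | ⟨i, hi, rfl⟩)
      · by_cases hp : P i
        · exact ⟨Sum.inl (Sum.inl (eP ⟨⟨i, hi⟩, hp⟩)), by simp [parityRows, hs1]⟩
        · exact ⟨Sum.inl (Sum.inr (eQ ⟨⟨i, hi⟩, hp⟩)), by simp [parityRows, hs2]⟩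
      · exact ⟨Sum.inr (eP ⟨⟨i, h.imp i hi⟩, hi⟩), by simp [parityRows, hs1]⟩

/-! ### Primitives of Schwartz functions along a line -/

section Primitive

variable {E : Type} [NormedAddCommGroup E] [InnerProductSpace ℝ E]

theorem SchwartzMap.exists_norm_le {E F : Type*} [NormedAddCommGroup E] [NormedSpace ℝ E]
    [NormedAddCommGroup F] [NormedSpace ℝ F] (f : 𝓢(E, F)) (k : ℕ) :
    ∃ C, 0 ≤ C ∧ ∀ x, (1 + ‖x‖) ^ k * ‖f x‖ ≤ C := by
  have h := fun x => SchwartzMap.one_add_le_sup_seminorm_apply (𝕜 := ℝ) (m := (k, 0)) (k := k)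
    (n := 0) le_rfl le_rfl f x
  simp only [norm_iteratedFDeriv_zero] at h
  exact ⟨_, le_trans (by positivity) (h 0), h⟩

theorem integrable_one_add_abs_inv_sq : Integrable (fun s : ℝ => ((1 + |s|) ^ 2)⁻¹) := by
  have h := integrable_one_add_norm (E := ℝ) (μ := volume) (r := 2) (by simp)
  refine h.congr (Filter.Eventually.of_forall fun s => ?_)
  have : (0 : ℝ) ≤ 1 + |s| := by positivity
  simp only [Real.norm_eq_abs]
  rw [Real.rpow_neg this]
  norm_cast

/-- A Peetre-type inequality, `1 + |s| ≤ (1 + ‖x + s e‖)(1 + ‖x‖)`, turns decay of `f` into an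
integrable bound along the line. -/
theorem SchwartzMap.exists_norm_line_le {F : Type*} [NormedAddCommGroup F] [NormedSpace ℝ F]
    (f : 𝓢(E, F)) {e : E} (he : ‖e‖ = 1) :
    ∃ C, 0 ≤ C ∧ ∀ x (s : ℝ), ‖f (x + s • e)‖ ≤ C * (1 + ‖x‖) ^ 2 * ((1 + |s|) ^ 2)⁻¹ := by
  obtain ⟨C, hC, h⟩ := f.exists_norm_le 2
  refine ⟨C, hC, fun x s => ?_⟩
  rw [← div_eq_mul_inv, le_div_iff₀ (by positivity)]
  have h1 : 1 + |s| ≤ (1 + ‖x + s • e‖) * (1 + ‖x‖) := by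
    have : |s| ≤ ‖x + s • e‖ + ‖x‖ := by
      have := norm_sub_le (x + s • e) x
      rwa [add_sub_cancel_left, norm_smul, he, mul_one, Real.norm_eq_abs] at this
    nlinarith [norm_nonneg x, norm_nonneg (x + s • e)]
  calc ‖f (x + s • e)‖ * (1 + |s|) ^ 2
      ≤ ‖f (x + s • e)‖ * ((1 + ‖x + s • e‖) * (1 + ‖x‖)) ^ 2 := by gcongr
    _ = ((1 + ‖x + s • e‖) ^ 2 * ‖f (x + s • e)‖) * (1 + ‖x‖) ^ 2 := by ring
    _ ≤ C * (1 + ‖x‖) ^ 2 := by gcongr; exact h _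

theorem SchwartzMap.integrable_line {F : Type*} [NormedAddCommGroup F] [NormedSpace ℝ F]
    (f : 𝓢(E, F)) {e : E} (he : ‖e‖ = 1) (x : E) : Integrable fun s : ℝ => f (x + s • e) := by
  obtain ⟨C, hC, h⟩ := f.exists_norm_line_le he
  exact (integrable_one_add_abs_inv_sq.const_mul _).mono'
    (f.continuous.comp (by fun_prop)).aestronglyMeasurable
    (Filter.Eventually.of_forall fun s => h x s)

/-- The set `A` is a half-line for the primitive and the whole line for the vanishing condition. On
the unit ball about `x` the line bound is uniform, since `1 + ‖y‖ ≤ 2 + ‖x‖`. -/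
theorem SchwartzMap.hasFDerivAt_integral_line {F : Type*} [NormedAddCommGroup F]
    [NormedSpace ℝ F] [CompleteSpace F] (f : 𝓢(E, F)) {e : E} (he : ‖e‖ = 1) (A : Set ℝ) (x : E) :
    HasFDerivAt (fun x => ∫ s in A, f (x + s • e))
      (∫ s in A, fderivCLM ℝ E F f (x + s • e)) x := by
  obtain ⟨C, hC, h⟩ := (fderivCLM ℝ E F f).exists_norm_line_le he
  refine hasFDerivAt_integral_of_dominated_of_fderiv_le
    (F' := fun x s => fderivCLM ℝ E F f (x + s • e))
    (bound := fun s => C * (2 + ‖x‖) ^ 2 * ((1 + |s|) ^ 2)⁻¹) (Metric.ball_mem_nhds x one_pos)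
    (Filter.Eventually.of_forall fun y =>
      (f.continuous.comp (by fun_prop)).aestronglyMeasurable)
    (f.integrable_line he x).integrableOn
    ((fderivCLM ℝ E F f).continuous.comp (by fun_prop)).aestronglyMeasurable
    (Filter.Eventually.of_forall fun s y hy => ?_)
    (integrable_one_add_abs_inv_sq.const_mul _).integrableOn
    (Filter.Eventually.of_forall fun s y _ => ?_)
  · refine (h y s).trans ?_
    have : ‖y‖ ≤ 1 + ‖x‖ := by
      have h1 := norm_sub_norm_le y x
      have h2 := mem_ball_iff_norm.1 hy
      linarith
    exact mul_le_mul_of_nonneg_right (mul_le_mul_of_nonneg_left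
      (pow_le_pow_left₀ (by positivity) (by linarith) 2) hC) (by positivity)
  · have h1 : HasFDerivAt (fun y : E => y + s • e) (ContinuousLinearMap.id ℝ E) y :=
      (hasFDerivAt_id y).add_const _
    have h2 := (f.hasFDerivAt (y + s • e)).comp y h1
    simpa [Function.comp_def] using h2

/-- For `s ≤ 0` and `⟪x, e⟫ ≤ 0` the cross term in `‖x + s e‖²` is nonnegative, so `‖x + s e‖`
dominates both `‖x‖` and `|s|`. -/
theorem SchwartzMap.exists_norm_halfLine_le {F : Type*} [NormedAddCommGroup F]
    [NormedSpace ℝ F] (f : 𝓢(E, F)) {e : E} (he : ‖e‖ = 1) (k : ℕ) :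
    ∃ C, ∀ x : E, inner ℝ x e ≤ 0 → ‖x‖ ^ k * ‖∫ s in Set.Iic (0 : ℝ), f (x + s • e)‖ ≤ C := by
  obtain ⟨C, hC, h⟩ := f.exists_norm_le (k + 2)
  refine ⟨∫ s in Set.Iic (0 : ℝ), C * ((1 + |s|) ^ 2)⁻¹, fun x hx => ?_⟩
  rw [← norm_norm x, ← norm_pow, ← norm_smul, ← integral_smul]
  refine norm_integral_le_of_norm_le (integrable_one_add_abs_inv_sq.const_mul C).integrableOn ?_
  refine (ae_restrict_iff' measurableSet_Iic).2 (Filter.Eventually.of_forall fun s hs => ?_)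
  have hs' : s ≤ 0 := hs
  rw [norm_smul, norm_pow, norm_norm, ← div_eq_mul_inv, le_div_iff₀ (by positivity)]
  have hsq : ‖x + s • e‖ ^ 2 = ‖x‖ ^ 2 + 2 * (s * inner ℝ x e) + s ^ 2 := by
    rw [norm_add_sq_real, inner_smul_right, norm_smul, he, mul_one, Real.norm_eq_abs, sq_abs]
  have hse : 0 ≤ s * inner ℝ x e := mul_nonneg_of_nonpos_of_nonpos hs' hx
  have h1 : ‖x‖ ≤ ‖x + s • e‖ := by
    refine (sq_le_sq₀ (norm_nonneg _) (norm_nonneg _)).1 ?_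
    nlinarith [sq_nonneg s]
  have h2 : |s| ≤ ‖x + s • e‖ := by
    refine (sq_le_sq₀ (abs_nonneg _) (norm_nonneg _)).1 ?_
    rw [sq_abs]
    nlinarith [sq_nonneg ‖x‖]
  calc ‖x‖ ^ k * ‖f (x + s • e)‖ * (1 + |s|) ^ 2
      ≤ (1 + ‖x + s • e‖) ^ k * ‖f (x + s • e)‖ * (1 + ‖x + s • e‖) ^ 2 := by
        gcongr
        linarith
    _ = (1 + ‖x + s • e‖) ^ (k + 2) * ‖f (x + s • e)‖ := by ring
    _ ≤ C := h _

/-- Where `⟪x, e⟫ ≥ 0`, the vanishing line integral replaces the half-line by the opposite one up to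
sign, and the half-line bound applies with `-e`. -/
theorem SchwartzMap.exists_norm_primitive_le {F : Type*} [NormedAddCommGroup F]
    [NormedSpace ℝ F] (f : 𝓢(E, F)) {e : E} (he : ‖e‖ = 1)
    (hf : ∀ x, ∫ s : ℝ, f (x + s • e) = 0) (k : ℕ) :
    ∃ C, ∀ x : E, ‖x‖ ^ k * ‖∫ s in Set.Iic (0 : ℝ), f (x + s • e)‖ ≤ C := by
  obtain ⟨C, h⟩ := f.exists_norm_halfLine_le he k
  obtain ⟨C', h'⟩ := f.exists_norm_halfLine_le (e := -e) (by rwa [norm_neg]) k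
  refine ⟨max C C', fun x => ?_⟩
  rcases le_total (inner ℝ x e) 0 with hx | hx
  · exact (h x hx).trans (le_max_left _ _)
  · refine le_trans (le_of_eq ?_) ((h' x (by rw [inner_neg_right]; linarith)).trans
      (le_max_right _ _))
    have h1 := intervalIntegral.integral_Iic_add_Ioi (b := (0 : ℝ))
      (f.integrable_line he x).integrableOn (f.integrable_line he x).integrableOn
    rw [hf] at h1
    have h2 := integral_comp_neg_Iic (0 : ℝ) fun s => f (x + s • e)
    simp only [neg_zero, neg_smul] at h2
    simp only [smul_neg]
    rw [h2, eq_neg_of_add_eq_zero_left h1, norm_neg]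

/-- The derivative of the primitive is the primitive of `fderivCLM f`, whose line integrals vanish
too. As the target space changes with each derivative, `F` is quantified inside the induction. -/
theorem SchwartzMap.contDiff_primitive {e : E} (he : ‖e‖ = 1) (n : ℕ) :
    ∀ (F : Type) [NormedAddCommGroup F] [NormedSpace ℝ F] [CompleteSpace F] (f : 𝓢(E, F)),
      (∀ x, ∫ s : ℝ, f (x + s • e) = 0) →
      ContDiff ℝ n (fun x => ∫ s in Set.Iic (0 : ℝ), f (x + s • e)) ∧
      ∀ k, ∃ C, ∀ x : E, ‖x‖ ^ k *
        ‖iteratedFDeriv ℝ n (fun x => ∫ s in Set.Iic (0 : ℝ), f (x + s • e)) x‖ ≤ C := by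
  induction n with
  | zero =>
    intro F _ _ _ f hf
    refine ⟨?_, fun k => ?_⟩
    · rw [Nat.cast_zero, contDiff_zero, continuous_iff_continuousAt]
      exact fun x => (f.hasFDerivAt_integral_line he _ x).continuousAt
    · simpa only [norm_iteratedFDeriv_zero] using f.exists_norm_primitive_le he hf k
  | succ n ih =>
    intro F _ _ _ f hf
    have hfd : fderiv ℝ (fun x => ∫ s in Set.Iic (0 : ℝ), f (x + s • e)) =
        fun x => ∫ s in Set.Iic (0 : ℝ), fderivCLM ℝ E F f (x + s • e) :=
      funext fun x => (f.hasFDerivAt_integral_line he _ x).fderiv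
    have hf' : ∀ x, ∫ s : ℝ, fderivCLM ℝ E F f (x + s • e) = 0 := by
      intro x
      have h1 := f.hasFDerivAt_integral_line he Set.univ x
      simp only [Measure.restrict_univ, hf] at h1
      exact h1.unique (hasFDerivAt_const 0 x)
    obtain ⟨h1, h2⟩ := ih (E →L[ℝ] F) (fderivCLM ℝ E F f) hf'
    refine ⟨?_, fun k => ?_⟩
    · push_cast
      rw [contDiff_succ_iff_fderiv, hfd]
      exact ⟨fun x => (f.hasFDerivAt_integral_line he _ x).differentiableAt, by simp, h1⟩
    · simpa only [← norm_iteratedFDeriv_fderiv, hfd] using h2 k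

/-- A Schwartz function whose integrals over the lines parallel to `e` vanish is the derivative of
a Schwartz function in the direction `e`. -/
theorem SchwartzMap.exists_lineDeriv_eq {F : Type} [NormedAddCommGroup F] [NormedSpace ℝ F]
    [CompleteSpace F] (f : 𝓢(E, F)) {e : E} (he : ‖e‖ = 1)
    (hf : ∀ x, ∫ s : ℝ, f (x + s • e) = 0) : ∃ g : 𝓢(E, F), ∂_{e} g = f := by
  refine ⟨⟨fun x => ∫ s in Set.Iic (0 : ℝ), f (x + s • e),
    contDiff_infty.2 fun n => (contDiff_primitive he n F f hf).1,
    fun k n => (contDiff_primitive he n F f hf).2 k⟩, ?_⟩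
  ext x
  rw [lineDerivOp_apply_eq_fderiv]
  change fderiv ℝ (fun x => ∫ s in Set.Iic (0 : ℝ), f (x + s • e)) x e = f x
  rw [(f.hasFDerivAt_integral_line he _ x).fderiv, ContinuousLinearMap.integral_apply
    ((fderivCLM ℝ E F f).integrable_line he x).integrableOn]
  -- Along the line the directional derivative is the derivative in `s`, so the integral equals `f
  -- x` minus the limit at `-∞`, which is zero.
  have hd : ∀ s : ℝ, HasDerivAt (fun s : ℝ => f (x + s • e))
      (fderivCLM ℝ E F f (x + s • e) e) s := by
    intro s
    have h1 : HasDerivAt (fun s : ℝ => x + s • e) e s := by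
      simpa using ((hasDerivAt_id s).smul_const e).const_add x
    exact (f.hasFDerivAt (x + s • e)).comp_hasDerivAt s h1
  have hi : IntegrableOn (fun s : ℝ => fderivCLM ℝ E F f (x + s • e) e) (Set.Iic 0) :=
    (((fderivCLM ℝ E F f).integrable_line he x).apply_continuousLinearMap e).integrableOn
  have ht : Filter.Tendsto (fun s : ℝ => f (x + s • e)) Filter.atBot (nhds 0) := by
    obtain ⟨C, hC, h⟩ := f.exists_norm_line_le he
    refine squeeze_zero_norm (h x) ?_
    rw [← mul_zero (C * (1 + ‖x‖) ^ 2)]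
    refine Filter.Tendsto.const_mul _ (Filter.Tendsto.inv_tendsto_atTop ?_)
    refine (Filter.tendsto_pow_atTop two_ne_zero).comp ?_
    exact Filter.tendsto_atTop_add_const_left _ _ Filter.tendsto_abs_atBot_atTop
  have := integral_Iic_of_hasDerivAt_of_tendsto (hd 0).continuousAt.continuousWithinAt
    (fun s _ => hd s) hi ht
  simpa using this

end Primitive

/-! ### Distributions annihilated by coordinates or by partial derivatives -/

theorem pullback_apply {ι κ : Type} [Fintype ι] [Fintype κ] (L : Config ι →ₗ[ℝ] Config κ)
    (hL : LinearMap.ker L = ⊥) (f : 𝓢(Config κ, ℂ)) (x : Config ι) :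
    pullback L hL f x = f (L x) := rfl

theorem lineDerivOp_pullback {ι κ : Type} [Fintype ι] [Fintype κ] (L : Config ι →ₗ[ℝ] Config κ)
    (hL : LinearMap.ker L = ⊥) (f : 𝓢(Config κ, ℂ)) (m : Config ι) :
    ∂_{m} (pullback L hL f) = pullback L hL (∂_{L m} f) := by
  ext x
  rw [pullback_apply, SchwartzMap.lineDerivOp_apply_eq_fderiv,
    SchwartzMap.lineDerivOp_apply_eq_fderiv]
  have h : HasFDerivAt (pullback L hL f) _ x := (f.hasFDerivAt (L x)).comp x
    (LinearMap.toContinuousLinearMap L).hasFDerivAt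
  rw [h.fderiv]
  rfl

theorem inner_single {ι : Type} [Fintype ι] [DecidableEq ι] (i : ι) (x : Config ι) :
    inner ℝ x (EuclideanSpace.single i (1 : ℝ)) = x i := by
  simp [EuclideanSpace.inner_single_right]

theorem smulLeft_inner_single_apply {ι : Type} [Fintype ι] [DecidableEq ι] (i : ι)
    (f : 𝓢(Config ι, ℂ)) (x : Config ι) :
    SchwartzMap.smulLeftCLM ℂ (fun x : Config ι =>
      (inner ℝ x (EuclideanSpace.single i (1 : ℝ)) : ℝ)) f x = (x i : ℂ) * f x := by
  rw [SchwartzMap.smulLeftCLM_apply_apply (by fun_prop), Complex.real_smul, inner_single]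

/-- On the Fourier side, vanishing on `x₀ = 0` means that the partial integral vanishes, so `𝓕⁻ f`
is a derivative `∂_e g`. Transforming back makes the derivative multiplication by `2πi x₀`. -/
theorem exists_eq_coord_mul_of_unique {υ κ : Type} [hυ : Fintype υ] [Fintype κ] [Unique υ]
    (f : 𝓢(Config (υ ⊕ κ), ℂ)) (hf : ∀ z, f (joinPt 0 z) = 0) :
    ∃ g : 𝓢(Config (υ ⊕ κ), ℂ), ∀ w, f w = (w (Sum.inl default) : ℂ) * g w := by
  classical
  obtain rfl : hυ = Unique.fintype := Subsingleton.elim _ _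
  set h := 𝓕⁻ f with hh
  have hFh : 𝓕 h = f := FourierTransform.fourier_fourierInv_eq f
  have h0 : integrateOut υ κ h = 0 := by
    change 𝓕⁻ (pullback inrPt ker_inrPt (𝓕 h)) = 0
    have : pullback inrPt ker_inrPt (𝓕 h) = 0 := by
      rw [hFh]; ext z; exact hf z
    rw [this, FourierTransform.fourierInv_zero]
  set e : Config (υ ⊕ κ) := EuclideanSpace.single (Sum.inl default) 1 with he
  have hline : ∀ x, ∫ s : ℝ, h (x + s • e) = 0 := by
    intro x
    have h1 : ∫ y : Config υ, h (joinPt y (inrPart x)) = 0 := by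
      rw [← integrateOut_apply, h0]; rfl
    have hmp : MeasurePreserving (fun s : ℝ => (WithLp.toLp 2 (fun _ => s) : Config υ))
        volume volume :=
      (PiLp.volume_preserving_toLp υ).comp
        (volume_preserving_funUnique υ ℝ).symm
    have hme : MeasurableEmbedding (fun s : ℝ => (WithLp.toLp 2 (fun _ => s) : Config υ)) :=
      (MeasurableEquiv.toLp 2 (υ → ℝ)).measurableEmbedding.comp
        (MeasurableEquiv.funUnique υ ℝ).symm.measurableEmbedding
    rw [← hmp.integral_comp hme] at h1
    -- The parameter is shifted by the first coordinate of `x`, so the line may start at any base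
    -- point.
    rw [← integral_add_left_eq_self _ (x (Sum.inl default))] at h1
    rw [← h1]
    refine integral_congr_ae (Filter.Eventually.of_forall fun s => ?_)
    change h _ = h _
    congr 1
    ext i
    rcases i with i | i
    · rw [Unique.eq_default i]; simp [he, joinPt]
    · simp [he, joinPt, inrPart]
  obtain ⟨g, hg⟩ := h.exists_lineDeriv_eq (by simp [he]) hline
  refine ⟨(2 * Real.pi * Complex.I : ℂ) • 𝓕 g, fun w => ?_⟩
  rw [← hFh, ← hg, SchwartzMap.fourier_lineDerivOp_eq, smul_apply, smul_apply, he,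
    smulLeft_inner_single_apply]
  simp only [smul_eq_mul]
  ring

/-- Hadamard's lemma for Schwartz functions. -/
theorem exists_eq_coord_mul {ι : Type} [Fintype ι] [DecidableEq ι] (j : ι) (f : 𝓢(Config ι, ℂ))
    (hf : ∀ x : Config ι, x j = 0 → f x = 0) :
    ∃ g : 𝓢(Config ι, ℂ), ∀ x, f x = (x j : ℂ) * g x := by
  -- A reindexing that isolates `j` as the only element of a singleton type.
  set A := LinearIsometryEquiv.piLpCongrLeft 2 ℝ ℝ (Equiv.sumCompl fun i => i = j)
  have hA : ∀ w, A w j = w (Sum.inl default) := fun w => by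
    change w ((Equiv.sumCompl fun i => i = j).symm j) = _
    rw [Equiv.sumCompl_symm_apply_of_pos (p := fun i => i = j) rfl]
    rfl
  obtain ⟨g, hg⟩ := exists_eq_coord_mul_of_unique
    (SchwartzMap.compCLMOfContinuousLinearEquiv ℂ A.toContinuousLinearEquiv f) (fun z =>
      hf _ (by
        change A (joinPt 0 z) j = 0
        rw [hA]; simp [joinPt]))
  refine ⟨SchwartzMap.compCLMOfContinuousLinearEquiv ℂ A.symm.toContinuousLinearEquiv g,
    fun x => ?_⟩
  have h1 := hg (A.symm x)
  rw [← hA, A.apply_symm_apply] at h1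
  rw [SchwartzMap.compCLMOfContinuousLinearEquiv_apply] at h1 ⊢
  simpa using h1

theorem exists_schwartz_eq_one_at_zero (ι : Type) [Fintype ι] :
    ∃ ρ : 𝓢(Config ι, ℂ), ρ 0 = 1 := by
  let b : ContDiffBump (0 : Config ι) := ⟨1, 2, one_pos, one_lt_two⟩
  have h1 : HasCompactSupport (fun x => ((b x : ℝ) : ℂ)) :=
    b.hasCompactSupport.comp_left (g := fun r : ℝ => (r : ℂ)) Complex.ofReal_zero
  have h2 : ContDiff ℝ ((⊤ : ℕ∞) : WithTop ℕ∞) (fun x => ((b x : ℝ) : ℂ)) :=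
    Complex.ofRealCLM.contDiff.comp b.contDiff
  refine ⟨h1.toSchwartzMap h2, ?_⟩
  change ((b 0 : ℝ) : ℂ) = 1
  rw [b.one_of_mem_closedBall (Metric.mem_closedBall_self b.rIn_pos.le), Complex.ofReal_one]

/-- `x ↦ (x_j, x - x_j e_j)`. -/
noncomputable def splitCoord {ι : Type} [Fintype ι] [DecidableEq ι] (j : ι) :
    Config ι →ₗ[ℝ] Config (Unit ⊕ ι) where
  toFun x := joinPt (WithLp.toLp 2 fun _ => x j) (x - x j • EuclideanSpace.single j 1)
  map_add' x y := by
    ext i; rcases i with i | i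
    · simp [joinPt]
    · simp [joinPt]; ring
  map_smul' r x := by
    ext i; rcases i with i | i
    · simp [joinPt]
    · simp [joinPt]; ring

theorem ker_splitCoord {ι : Type} [Fintype ι] [DecidableEq ι] (j : ι) :
    LinearMap.ker (splitCoord j) = ⊥ := by
  rw [LinearMap.ker_eq_bot']
  intro x hx
  have h0 : x j = 0 := congrArg (fun w : Config (Unit ⊕ ι) => w (Sum.inl ())) hx
  ext i
  have := congrArg (fun w : Config (Unit ⊕ ι) => w (Sum.inr i)) hx
  simpa [splitCoord, joinPt, h0] using this

/-- A Schwartz function vanishing on the common zero set is a sum of coordinate multiples; one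
coordinate is removed at a time by subtracting an extension of the restriction to `x_j = 0`. -/
theorem GenState.apply_eq_zero_of_posOp {ι : Type} [Fintype ι] [DecidableEq ι] (T : GenState ι)
    (s : Finset ι) : (∀ i ∈ s, posOp i T = 0) → ∀ f : 𝓢(Config ι, ℂ),
      (∀ x, (∀ i ∈ s, x i = 0) → f x = 0) → T f = 0 := by
  induction s using Finset.induction_on with
  | empty =>
    intro _ f hf
    have : f = 0 := by ext x; exact hf x (by simp)
    rw [this, map_zero]
  | insert j s hj ih =>
    intro hT f hf
    obtain ⟨ρ, hρ⟩ := exists_schwartz_eq_one_at_zero Unit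
    -- This is `ρ(x_j) f(x - x_j e_j)`: it agrees with `f` on `x_j = 0`, vanishes where the
    -- remaining coordinates do, and `ρ` supplies the decay in the direction `e_j`.
    set f' := pullback (splitCoord j) (ker_splitCoord j) (tensorS ρ f) with hf'
    have hf'x : ∀ x, f' x = ρ (WithLp.toLp 2 fun _ => x j) *
        f (x - x j • EuclideanSpace.single j 1) := fun x => rfl
    have h1 : T f' = 0 := by
      refine ih (fun i hi => hT i (Finset.mem_insert_of_mem hi)) f' fun x hx => ?_
      rw [hf'x, hf, mul_zero]
      intro i hi
      rcases Finset.mem_insert.1 hi with rfl | hi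
      · simp
      · have : i ≠ j := fun h => hj (h ▸ hi)
        simp [hx i hi, this]
    obtain ⟨g, hg⟩ := exists_eq_coord_mul j (f - f') fun x hx => by
      have h0 : (WithLp.toLp 2 fun _ => (0 : ℝ) : Config Unit) = 0 := rfl
      rw [sub_apply, hf'x, hx, h0, hρ]
      simp
    have h2 : T (f - f') = 0 := by
      have : f - f' = SchwartzMap.smulLeftCLM ℂ (fun x : Config ι => ((x j : ℝ) : ℂ)) g := by
        ext x
        rw [hg, SchwartzMap.smulLeftCLM_apply_apply (hasTemperateGrowth_coordC j), smul_eq_mul]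
      rw [this, ← posOp_apply, hT j (Finset.mem_insert_self _ _)]
      rfl
    rw [map_sub, h1, sub_zero] at h2
    exact h2

theorem pullback_inrPt_tensorS {ι κ : Type} [Fintype ι] [Fintype κ] {ρ : 𝓢(Config ι, ℂ)}
    (hρ : ρ 0 = 1) (g : 𝓢(Config κ, ℂ)) : pullback inrPt ker_inrPt (tensorS ρ g) = g := by
  ext z
  have h1 : inlPart (inrPt z : Config (ι ⊕ κ)) = 0 := rfl
  have h2 : inrPart (inrPt z : Config (ι ⊕ κ)) = z := rfl
  rw [pullback_apply, tensorS_apply, h1, h2, hρ, one_mul]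

/-- A generalized state annihilated by the coordinates of `ι` is supported, without transversal
derivatives, on the subspace where they vanish. -/
theorem GenState.exists_eq_pullback {ι κ : Type} [Fintype ι] [Fintype κ] [DecidableEq ι]
    [DecidableEq κ] (T : GenState (ι ⊕ κ)) (hT : ∀ i : ι, posOp (Sum.inl i) T = 0) :
    ∃ φ : GenState κ, ∀ f, T f = φ (pullback inrPt ker_inrPt f) := by
  obtain ⟨ρ, hρ⟩ := exists_schwartz_eq_one_at_zero ι
  -- The map `g ↦ ρ ⊗ g` is a right inverse of restriction to the subspace, so `φ` must be `T`
  -- evaluated on `ρ ⊗ g`.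
  refine ⟨PointwiseConvergenceCLM.precomp ℂ (tensorS ρ) T, fun f => ?_⟩
  change T f = T (tensorS ρ (pullback inrPt ker_inrPt f))
  rw [← sub_eq_zero, ← map_sub]
  refine T.apply_eq_zero_of_posOp (Finset.univ.map Function.Embedding.inl) ?_ _ fun x hx => ?_
  · intro i hi
    obtain ⟨i, -, rfl⟩ := Finset.mem_map.1 hi
    exact hT i
  · have h0 : inlPart x = 0 := by
      ext i; exact hx (Sum.inl i) (Finset.mem_map.2 ⟨i, Finset.mem_univ _, rfl⟩)
    have hx' : inrPt (inrPart x) = x := by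
      conv_rhs => rw [← joinPt_inlPart_inrPart x, h0]
      rfl
    rw [sub_apply, tensorS_apply, h0, hρ, one_mul, pullback_apply, hx', sub_self]

/-- A generalized state annihilated by the partial derivatives of `ι` depends only on the partial
integrals over these variables. -/
theorem GenState.exists_eq_integrateOut {ι κ : Type} [Fintype ι] [Fintype κ] [DecidableEq ι]
    [DecidableEq κ] (T : GenState (ι ⊕ κ))
    (hT : ∀ (i : ι) (f : 𝓢(Config (ι ⊕ κ), ℂ)),
      T (∂_{(EuclideanSpace.single (Sum.inl i) (1 : ℝ) : Config (ι ⊕ κ))} f) = 0) :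
    ∃ φ : GenState κ, ∀ f, T f = φ (integrateOut ι κ f) := by
  -- The inverse Fourier transform of `T` is annihilated by coordinates instead of derivatives, and
  -- `integrateOut` is restriction conjugated by the Fourier transform.
  obtain ⟨φ, hφ⟩ := GenState.exists_eq_pullback (𝓕⁻ T) fun i => by
    ext f
    rw [posOp_apply, TemperedDistribution.fourierInv_apply]
    have h1 := SchwartzMap.lineDerivOp_fourierInv_eq f
      (EuclideanSpace.single (Sum.inl i) (1 : ℝ) : Config (ι ⊕ κ))
    have h2 := hT i (𝓕⁻ f)
    rw [h1, FourierTransform.fourierInv_smul, map_smul, smul_eq_mul] at h2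
    have h3 : (2 * Real.pi * Complex.I : ℂ) ≠ 0 := by
      simp [Real.pi_ne_zero]
    have h4 := (mul_eq_zero.1 h2).resolve_left h3
    refine Eq.trans ?_ h4
    congr 2
    ext x
    rw [smulLeft_inner_single_apply,
      SchwartzMap.smulLeftCLM_apply_apply (hasTemperateGrowth_coordC _), smul_eq_mul]
  refine ⟨𝓕 φ, fun f => ?_⟩
  rw [TemperedDistribution.fourier_apply]
  change _ = φ (𝓕 (𝓕⁻ (pullback inrPt ker_inrPt (𝓕 f))))
  rw [FourierTransform.fourier_fourierInv_eq, ← hφ, TemperedDistribution.fourierInv_apply,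
    FourierTransform.fourierInv_fourier_eq]

/-- On the Fourier side the derivative is a multiple of the frequency in direction `i`, which is
zero at the points `(0, ζ)`. -/
theorem integrateOut_lineDerivOp {ι κ : Type} [Fintype ι] [Fintype κ] [DecidableEq ι]
    [DecidableEq κ] (i : ι) (f : 𝓢(Config (ι ⊕ κ), ℂ)) :
    integrateOut ι κ (∂_{(EuclideanSpace.single (Sum.inl i) (1 : ℝ) : Config (ι ⊕ κ))} f) = 0 := by
  change 𝓕⁻ (pullback inrPt ker_inrPt (𝓕
    (∂_{(EuclideanSpace.single (Sum.inl i) (1 : ℝ) : Config (ι ⊕ κ))} f))) = 0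
  have : pullback inrPt ker_inrPt (𝓕
      (∂_{(EuclideanSpace.single (Sum.inl i) (1 : ℝ) : Config (ι ⊕ κ))} f)) = 0 := by
    ext z
    rw [pullback_apply, SchwartzMap.fourier_lineDerivOp_eq, smul_apply,
      smulLeft_inner_single_apply]
    simp [inrPt, joinPt]
  rw [this, FourierTransform.fourierInv_zero]

/-! ### The canonical code -/

section CanonicalCode

variable {n c l k : ℕ} (σ : (Fin c ⊕ Fin l) ⊕ Fin k ≃ Fin n)

/-- The coordinates in which the canonical code is a product: relative positions of the entangled
modes, ancilla positions, receiver positions, data positions. -/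
noncomputable def decodeEquiv :
    Config (Fin n ⊕ Fin c) ≃ₗ[ℝ] Config ((Fin c ⊕ Fin l) ⊕ (Fin c ⊕ Fin k)) where
  toFun w := WithLp.toLp 2 (Sum.elim
    (Sum.elim (fun i => w (Sum.inl (σ (Sum.inl (Sum.inl i)))) - w (Sum.inr i))
      (fun a => w (Sum.inl (σ (Sum.inl (Sum.inr a))))))
    (Sum.elim (fun i => w (Sum.inr i)) (fun m => w (Sum.inl (σ (Sum.inr m))))))
  invFun w := WithLp.toLp 2 (Sum.elim
    (fun i => Sum.elim (Sum.elim (fun j => w (Sum.inr (Sum.inl j)) + w (Sum.inl (Sum.inl j)))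
      (fun a => w (Sum.inl (Sum.inr a)))) (fun m => w (Sum.inr (Sum.inr m))) (σ.symm i))
    (fun j => w (Sum.inr (Sum.inl j))))
  map_add' w w' := by
    ext i
    rcases i with (i | i) | (i | i) <;> simp [add_sub_add_comm]
  map_smul' r w := by
    ext i
    rcases i with (i | i) | (i | i) <;> simp [mul_sub]
  left_inv w := by
    ext i
    rcases i with i | i
    · obtain ⟨j, rfl⟩ := σ.surjective i
      rcases j with (j | j) | j <;> simp
    · simp
  right_inv w := by
    ext i
    rcases i with (i | i) | (i | i) <;> simp

/-- In the decoded coordinates the canonical encoder only sees the subspace where relative and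
ancilla positions vanish. -/
theorem decodeEquiv_encPoint (w : Config (Fin c ⊕ Fin k)) :
    decodeEquiv σ (encPoint σ w) = inrPt w := by
  ext i
  rcases i with (i | i) | (i | i) <;> simp [decodeEquiv, encPoint, inrPt, joinPt]

theorem linForm_rows_inl (a : Fin c ⊕ Fin l) (x : Config (Fin n ⊕ Fin c)) :
    linForm (augmentedRows σ stdP stdX (Sum.inl a)).1 x =
      ((decodeEquiv σ x (Sum.inl a) : ℝ) : ℂ) := by
  rcases a with i | j
  · simp [linForm, augmentedRows, joint, parityRows, receiverRows, stdP, decodeEquiv,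
      Fintype.sum_sum_type, Pi.single_apply, sub_eq_add_neg]
  · simp [linForm, augmentedRows, joint, parityRows, receiverRows, stdP, decodeEquiv,
      Pi.single_apply]

/-- The vectors in these rows have no position part, so the observables are multiplications by the
decoded coordinates that vanish on the code. -/
theorem quadS_rows_inl (a : Fin c ⊕ Fin l) (f : 𝓢(Config (Fin n ⊕ Fin c), ℂ))
    (x : Config (Fin n ⊕ Fin c)) : quadS (augmentedRows σ stdP stdX (Sum.inl a)) f x =
      ((decodeEquiv σ x (Sum.inl a) : ℝ) : ℂ) * f x := by
  have h : (WithLp.toLp 2 (augmentedRows σ stdP stdX (Sum.inl a)).2 : Config (Fin n ⊕ Fin c)) =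
      0 := by
    ext i
    rcases a with a | a <;> rcases i with i | i <;>
      simp [augmentedRows, joint, parityRows, receiverRows, stdP]
  rw [quadS_apply, linForm_rows_inl, h, map_zero, mul_zero, sub_zero]

/-- The direction of joint translation of the `i`-th entangled modes. -/
noncomputable def entangledDir (i : Fin c) : Config (Fin n ⊕ Fin c) :=
  encPoint σ (EuclideanSpace.single (Sum.inl i) 1)

theorem quadS_rows_inr (i : Fin c) (f : 𝓢(Config (Fin n ⊕ Fin c), ℂ)) :
    quadS (augmentedRows σ stdP stdX (Sum.inr i)) f =
      (-Complex.I) • ∂_{entangledDir σ i} f := by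
  ext x
  have h : (WithLp.toLp 2 (augmentedRows σ stdP stdX (Sum.inr i)).2 : Config (Fin n ⊕ Fin c)) =
      entangledDir σ i := by
    ext m
    rcases m with m | m
    · obtain ⟨j, rfl⟩ := σ.surjective m
      rcases j with (j | j) | j <;>
        simp [augmentedRows, joint, parityRows, stdX, entangledDir, encPoint, Pi.single_apply]
    · simp [augmentedRows, joint, receiverRows, stdX, entangledDir, encPoint, Pi.single_apply]
  have h1 : linForm (augmentedRows σ stdP stdX (Sum.inr i)).1 x = 0 := by
    simp [linForm, augmentedRows, joint, parityRows, receiverRows, stdX]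
  rw [quadS_apply, h, h1, smul_apply, SchwartzMap.lineDerivOp_apply_eq_fderiv, smul_eq_mul]
  ring

theorem canonicalEncoder_apply (φ : GenState (Fin k)) (f : 𝓢(Config (Fin n ⊕ Fin c), ℂ)) :
    canonicalEncoder σ φ f = (((Real.sqrt Real.pi)⁻¹ ^ c : ℝ) : ℂ) *
      φ (integrateOut (Fin c) (Fin k) (pullback (encPoint σ) (ker_encPoint σ) f)) := rfl

theorem canonicalEncoder_mem_zeroEigenspace (φ : GenState (Fin k)) :
    canonicalEncoder σ φ ∈ zeroEigenspace (augmentedRows σ stdP stdX) := by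
  intro r
  ext f
  rw [quadObs_apply, canonicalEncoder_apply]
  have h : integrateOut (Fin c) (Fin k) (pullback (encPoint σ) (ker_encPoint σ)
      (quadS (augmentedRows σ stdP stdX r) f)) = 0 := by
    rcases r with a | i
    · have : pullback (encPoint σ) (ker_encPoint σ)
          (quadS (augmentedRows σ stdP stdX (Sum.inl a)) f) = 0 := by
        ext w
        rw [pullback_apply, quadS_rows_inl, decodeEquiv_encPoint]
        simp [inrPt, joinPt]
      rw [this, map_zero]
    · rw [quadS_rows_inr, map_smul, map_smul, entangledDir, ← lineDerivOp_pullback,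
        integrateOut_lineDerivOp, smul_zero]
  rw [h, map_zero, mul_zero]
  rfl

/-- After the linear change of coordinates, the rows of the `u_i` make `T` factor through
restriction to the code subspace; the rows of the `v_i` make the factor invariant under joint
translation, so that it factors through the partial integral. -/
theorem exists_canonicalEncoder_eq (T : GenState (Fin n ⊕ Fin c))
    (hT : T ∈ zeroEigenspace (augmentedRows σ stdP stdX)) :
    ∃ φ : GenState (Fin k), canonicalEncoder σ φ = T := by
  set A := (decodeEquiv σ).toContinuousLinearEquiv with hA
  set B := SchwartzMap.compCLMOfContinuousLinearEquiv ℂ (F := ℂ) A with hB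
  have hAx : ∀ x, A x = decodeEquiv σ x := fun x => rfl
  have hBx : ∀ f x, B f x = f (A x) := fun f x => rfl
  -- The coordinate change acts on test functions, so no Jacobian appears.
  set T' : GenState ((Fin c ⊕ Fin l) ⊕ (Fin c ⊕ Fin k)) := PointwiseConvergenceCLM.precomp ℂ B T
  have hT' : ∀ f, T' f = T (B f) := fun f => rfl
  obtain ⟨φ₁, hφ₁⟩ := T'.exists_eq_pullback fun a => by
    ext f
    rw [posOp_apply, hT']
    have h1 : B (SchwartzMap.smulLeftCLM ℂ (fun x => ((x (Sum.inl a) : ℝ) : ℂ)) f) =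
        quadS (augmentedRows σ stdP stdX (Sum.inl a)) (B f) := by
      ext x
      rw [quadS_rows_inl, hBx, hBx,
        SchwartzMap.smulLeftCLM_apply_apply (hasTemperateGrowth_coordC _), hAx, smul_eq_mul]
    rw [h1, ← quadObs_apply, hT]
    rfl
  obtain ⟨ρ, hρ⟩ := exists_schwartz_eq_one_at_zero (Fin c ⊕ Fin l)
  -- Since `φ₁` is known only through restrictions, the test function `g` is first extended to `ρ ⊗
  -- g`.
  obtain ⟨φ, hφ⟩ := φ₁.exists_eq_integrateOut fun i g => by
    rw [← pullback_inrPt_tensorS hρ g, lineDerivOp_pullback, ← hφ₁, hT']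
    have h1 : A (entangledDir σ i) = inrPt (EuclideanSpace.single (Sum.inl i) 1) := by
      rw [hAx, entangledDir, decodeEquiv_encPoint]
    rw [← h1, hB, ← SchwartzMap.lineDerivOp_compCLMOfContinuousLinearEquiv, ← hB]
    have h2 := congrArg (fun S : GenState (Fin n ⊕ Fin c) => S (B (tensorS ρ g))) (hT (Sum.inr i))
    simp only [quadObs_apply, quadS_rows_inr, map_smul, smul_eq_mul] at h2
    exact (mul_eq_zero.1 h2).resolve_left (neg_ne_zero.2 Complex.I_ne_zero)
  set s : ℂ := (((Real.sqrt Real.pi)⁻¹ ^ c : ℝ) : ℂ) with hs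
  have hs0 : s ≠ 0 := by
    rw [hs]
    exact Complex.ofReal_ne_zero.2 (pow_ne_zero _ (inv_ne_zero (Real.sqrt_pos.2 Real.pi_pos).ne'))
  refine ⟨s⁻¹ • φ, ?_⟩
  ext f
  have h1 : T f = T' (SchwartzMap.compCLMOfContinuousLinearEquiv ℂ (F := ℂ) A.symm f) := by
    rw [hT']
    congr 1
    ext x
    rw [hBx, SchwartzMap.compCLMOfContinuousLinearEquiv_apply]
    simp
  have h2 : pullback inrPt ker_inrPt (SchwartzMap.compCLMOfContinuousLinearEquiv ℂ (F := ℂ)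
      A.symm f) = pullback (encPoint σ) (ker_encPoint σ) f := by
    ext w
    rw [pullback_apply, pullback_apply, ← decodeEquiv_encPoint σ w, ← hAx,
      SchwartzMap.compCLMOfContinuousLinearEquiv_apply]
    simp
  rw [h1, hφ₁, hφ, h2, canonicalEncoder_apply, smul_apply, smul_eq_mul, ← mul_assoc,
    mul_inv_cancel₀ hs0, one_mul]

theorem range_canonicalEncoder :
    Set.range (canonicalEncoder σ) = zeroEigenspace (augmentedRows σ stdP stdX) := by
  ext T
  constructor
  · rintro ⟨φ, rfl⟩
    exact canonicalEncoder_mem_zeroEigenspace σ φ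
  · exact exists_canonicalEncoder_eq σ T

end CanonicalCode

/-! ### Symplectic duals and parity checks -/

theorem sympDual_sympDual {ι : Type} [Fintype ι] (V : Submodule ℝ (PhaseSpace ι)) :
    sympDual (sympDual V) = V := by
  have hr : (sympForm ι).IsRefl := fun u v h => by
    rw [sympForm_apply] at h ⊢
    rw [sympProd_swap, h, neg_zero]
  have hd : ∀ V, sympDual V = (sympForm ι).orthogonal V := fun V => by
    ext w
    refine forall₂_congr fun u _ => ?_
    change sympProd w u = 0 ↔ sympProd u w = 0
    rw [sympProd_swap, neg_eq_zero]
  have hn : (sympForm ι).Nondegenerate :=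
    hr.nondegenerate_iff_separatingLeft.2 fun w h => eq_zero_of_sympProd w h
  rw [hd, hd, LinearMap.BilinForm.orthogonal_orthogonal hn hr]

theorem mem_sympDual_span_range {ι I : Type} [Fintype ι] (f : I → PhaseSpace ι)
    (w : PhaseSpace ι) :
    w ∈ sympDual (Submodule.span ℝ (Set.range f)) ↔ ∀ i, sympProd w (f i) = 0 := by
  refine ⟨fun h i => h _ (Submodule.subset_span ⟨i, rfl⟩), fun h x hx => ?_⟩
  induction hx using Submodule.span_induction with
  | mem x hx => obtain ⟨i, rfl⟩ := hx; exact h i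
  | zero => exact sympProd_zero_right w
  | add x y _ _ hx hy => rw [sympProd_add_right, hx, hy, add_zero]
  | smul r x _ hx => rw [sympProd_smul_right, hx, mul_zero]

section ParityRows

variable {n c l k : ℕ} (σ : (Fin c ⊕ Fin l) ⊕ Fin k ≃ Fin n) {u v : Fin n → PhaseSpace (Fin n)}

theorem IsSymplecticBasis.linearIndependent (h : IsSymplecticBasis u v) :
    LinearIndependent ℝ (Sum.elim u v) :=
  linearIndependent_of_sympProd (fun i => by rw [h.1, if_pos rfl])
    (fun i j hij => by rw [h.1, if_neg hij]) h.2.1 h.2.2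

theorem IsSymplecticBasis.finrank_span_parityRows (h : IsSymplecticBasis u v) :
    Module.finrank ℝ (Submodule.span ℝ (Set.range (parityRows σ u v))) = 2 * c + l := by
  have h1 : parityRows σ u v = Sum.elim u v ∘
      Sum.map (fun a => σ (Sum.inl a)) (fun i => σ (Sum.inl (Sum.inl i))) := by
    funext r
    rcases r with r | r <;> rfl
  have h2 : LinearIndependent ℝ (parityRows σ u v) := by
    rw [h1]
    refine h.linearIndependent.comp _ (Sum.map_injective.2 ⟨?_, ?_⟩)
    · exact σ.injective.comp Sum.inl_injective
    · exact σ.injective.comp (Sum.inl_injective.comp Sum.inl_injective)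
  rw [finrank_span_eq_card h2]
  simp
  ring

theorem IsSymplecticBasis.finrank_span_ancilla (h : IsSymplecticBasis u v) :
    Module.finrank ℝ (Submodule.span ℝ
      (Set.range fun j : Fin l => u (σ (Sum.inl (Sum.inr j))))) = l := by
  have h2 : LinearIndependent ℝ fun j : Fin l => u (σ (Sum.inl (Sum.inr j))) :=
    h.linearIndependent.comp (fun j : Fin l => Sum.inl (σ (Sum.inl (Sum.inr j))))
      (Sum.inl_injective.comp (σ.injective.comp (Sum.inl_injective.comp Sum.inr_injective)))
  rw [finrank_span_eq_card h2, Fintype.card_fin]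

/-- Pairing with `v_i` and `u_i`, `i ≤ c`, kills the coefficients of complete pairs; the `u_j` of
the ancillas have no partner in the span. -/
theorem IsSymplecticBasis.span_ancilla_eq_isoPart (h : IsSymplecticBasis u v) :
    Submodule.span ℝ (Set.range fun j : Fin l => u (σ (Sum.inl (Sum.inr j)))) =
      isoPart (Submodule.span ℝ (Set.range (parityRows σ u v))) := by
  obtain ⟨h1, h2, h3⟩ := h
  apply le_antisymm
  · rw [Submodule.span_le]
    rintro _ ⟨j, rfl⟩
    refine ⟨Submodule.subset_span ⟨Sum.inl (Sum.inr j), rfl⟩, ?_⟩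
    refine (mem_sympDual_span_range _ _).2 ?_
    rintro (r | r)
    · exact h2 _ _
    · simp [parityRows, h1]
  · rintro w ⟨hw, hw'⟩
    obtain ⟨t, rfl⟩ := (Submodule.mem_span_range_iff_exists_fun ℝ).1 hw
    rw [SetLike.mem_coe, mem_sympDual_span_range] at hw'
    have hc : ∀ i, t (Sum.inl (Sum.inl i)) = 0 := fun i => by
      have := hw' (Sum.inr i)
      rw [sympProd_sum_left] at this
      simpa [parityRows, h1, h3, Fintype.sum_sum_type] using this
    have hd : ∀ i, t (Sum.inr i) = 0 := fun i => by
      have := hw' (Sum.inl (Sum.inl i))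
      rw [sympProd_sum_left] at this
      simpa [parityRows, h1, h2, sympProd_swap (v _), Fintype.sum_sum_type] using this
    simp only [Fintype.sum_sum_type, hc, hd, zero_smul, Finset.sum_const_zero, zero_add, add_zero]
    exact Submodule.sum_mem _ fun j _ => Submodule.smul_mem _ _ (Submodule.subset_span ⟨j, rfl⟩)

/-- The sender's product `u_i ⊙ v_i = 1` is cancelled by the receiver's `(-δ_i|0) ⊙ (0|δ_i) = -1`.
-/
theorem IsSymplecticBasis.sympProd_augmentedRows (h : IsSymplecticBasis u v)
    (r r' : (Fin c ⊕ Fin l) ⊕ Fin c) :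
    sympProd (augmentedRows σ u v r) (augmentedRows σ u v r') = 0 := by
  obtain ⟨h1, h2, h3⟩ := h
  obtain ⟨g1, g2, g3⟩ := isSymplecticBasis_std (ι := Fin c)
  simp only [augmentedRows, sympProd_joint]
  rcases r with (r | r) | r <;> rcases r' with (r' | r') | r' <;>
    simp [parityRows, receiverRows, h1, h2, h3, g1, g2, g3, sympProd_swap (v _),
      sympProd_swap (stdX _), sympProd_neg_left, sympProd_neg_right, sympProd_zero_left,
      sympProd_zero_right]

end ParityRows

theorem commute_quadObs {ι : Type} [Fintype ι] [DecidableEq ι] {u v : PhaseSpace ι}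
    (h : sympProd u v = 0) : Commute (quadObs u) (quadObs v) := by
  ext T : 1
  have := quadObs_quadObs u v T
  rw [h, Complex.ofReal_zero, mul_zero] at this
  exact sub_eq_zero.1 (this.trans (zero_smul ℂ T))

/-! ### Correctable sets of displacements -/

theorem joint_add_zero {ι κ : Type} (a b : PhaseSpace ι) :
    joint a (0 : PhaseSpace κ) + joint b 0 = joint (a + b) 0 := by
  ext i <;> rcases i with i | i <;> simp [joint]

section Corrects

variable {ι κ ρ : Type} [Fintype ι] [Fintype κ] [DecidableEq ι] [DecidableEq κ]

theorem exists_dispOp_dispOp_eq_smul {ι : Type} [Fintype ι] (u v : PhaseSpace ι) :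
    ∃ β : ℂ, ‖β‖ = 1 ∧ ∀ T : GenState ι, dispOp u (dispOp v T) = β • dispOp (u + v) T :=
  ⟨_, norm_exp_I_mul _, dispOp_dispOp u v⟩

/-- By the Weyl relation `D(-u)` inverts `D(u)` up to a phase. This makes the syndrome of an error
unique. -/
theorem dispOp_ne_zero {ι : Type} [Fintype ι] (u : PhaseSpace ι) {T : GenState ι} (hT : T ≠ 0) :
    dispOp u T ≠ 0 := fun h => by
  obtain ⟨β, hβ, h1⟩ := exists_dispOp_dispOp_eq_smul (-u) u
  have h2 := h1 T
  rw [h, map_zero, neg_add_cancel, dispOp_zero] at h2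
  have hβ0 : β ≠ 0 := norm_ne_zero_iff.1 (hβ ▸ one_ne_zero)
  refine hT ?_
  ext f
  have h3 : 0 = β * T f := congrArg (fun A : GenState ι => A f) h2
  exact (mul_eq_zero.1 h3.symm).resolve_left hβ0

theorem quadObs_dispOp_of_mem {H : ρ → PhaseSpace (ι ⊕ κ)} {T : GenState (ι ⊕ κ)}
    (hT : T ∈ zeroEigenspace H) (w : PhaseSpace (ι ⊕ κ)) (r : ρ) : quadObs (H r) (dispOp w T) =
      ((-(Real.sqrt Real.pi * sympProd w (H r)) : ℝ) : ℂ) • dispOp w T := by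
  rw [quadObs_dispOp, hT r, map_zero, zero_sub, Complex.ofReal_neg]
  exact (neg_smul _ _).symm

theorem quadObs_mem_zeroEigenspace {H : ρ → PhaseSpace (ι ⊕ κ)} {T : GenState (ι ⊕ κ)}
    (hT : T ∈ zeroEigenspace H) {h : PhaseSpace (ι ⊕ κ)} (hh : ∀ r, sympProd (H r) h = 0) :
    quadObs h T ∈ zeroEigenspace H := fun r => by
  have := congrArg (fun A : GenState (ι ⊕ κ) →L[ℂ] GenState (ι ⊕ κ) => A T)
    (commute_quadObs (hh r)).eq
  exact this.trans (by change quadObs h (quadObs (H r) T) = 0; rw [hT r, map_zero])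

/-- If the displacements along `iso(V)`, where `V` is spanned by the sender's parts of the checks, fix
the code, then the correctable sets are those whose nonzero differences lie outside `V^⊥` or in
`iso(V)`. -/
theorem corrects_zeroEigenspace_iff (p : ρ → PhaseSpace ι) (q : ρ → PhaseSpace κ)
    (h0 : ∃ T ∈ zeroEigenspace fun r => joint (p r) (q r), T ≠ 0)
    (hfix : ∀ a ∈ isoPart (Submodule.span ℝ (Set.range p)),
      ∀ T ∈ zeroEigenspace fun r => joint (p r) (q r), dispOp (joint a 0) T = T)
    (S : Set (PhaseSpace ι)) :
    Corrects (zeroEigenspace fun r => joint (p r) (q r)) (fun r => joint (p r) (q r)) S ↔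
      ∀ w ∈ S, ∀ w' ∈ S, w ≠ w' → w - w' ∉ sympDual (Submodule.span ℝ (Set.range p)) ∨
        w - w' ∈ isoPart (Submodule.span ℝ (Set.range p)) := by
  set V := Submodule.span ℝ (Set.range p) with hV
  set H : ρ → PhaseSpace (ι ⊕ κ) := fun r => joint (p r) (q r) with hH
  have hpr : ∀ w r, sympProd (joint w 0) (H r) = sympProd w (p r) := fun w r => by
    rw [hH, sympProd_joint, sympProd_zero_left, add_zero]
  set syn : PhaseSpace ι → ρ → ℝ := fun w r => -(Real.sqrt Real.pi * sympProd w (p r)) with hsyn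
  have hpi : Real.sqrt Real.pi ≠ 0 := (Real.sqrt_pos.2 Real.pi_pos).ne'
  have hsyn_iff : ∀ w w', syn w = syn w' ↔ w - w' ∈ sympDual V := fun w w' => by
    rw [hV, mem_sympDual_span_range, funext_iff]
    refine forall_congr' fun r => ?_
    rw [hsyn, sympProd_sub_left, sub_eq_zero]
    exact ⟨fun h => mul_left_cancel₀ hpi (neg_injective h), fun h => by simp only [h]⟩
  have heig : ∀ w, ∀ T ∈ zeroEigenspace H, ∀ r, quadObs (H r) (dispOp (joint w 0) T) =
      ((syn w r : ℝ) : ℂ) • dispOp (joint w 0) T := fun w T hT r => by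
    rw [quadObs_dispOp_of_mem hT, hpr]
  constructor
  · rintro ⟨R, hR⟩ w hw w' hw' -
    by_cases hC : w - w' ∈ sympDual V
    swap
    · exact Or.inl hC
    refine Or.inr ⟨?_, hC⟩
    obtain ⟨T₀, hT₀, hT₀0⟩ := h0
    -- A nonzero code state determines the eigenvalues, so the syndrome supplied by `Corrects` must
    -- be `syn w`.
    have hs : ∀ (w : PhaseSpace ι) (s : ρ → ℝ), (∀ T ∈ zeroEigenspace H, ∀ r,
        quadObs (H r) (dispOp (joint w 0) T) = ((s r : ℝ) : ℂ) • dispOp (joint w 0) T) →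
        s = syn w := fun w s h => by
      funext r
      have h1 := (h T₀ hT₀ r).symm.trans (heig w T₀ hT₀ r)
      exact Complex.ofReal_injective (smul_left_injective ℂ (dispOp_ne_zero _ hT₀0) h1)
    obtain ⟨s, h1, β, hβ, h2⟩ := hR w hw
    obtain ⟨s', h1', β', hβ', h2'⟩ := hR w' hw'
    have hss : s = s' := by rw [hs w s h1, hs w' s' h1', (hsyn_iff w w').2 hC]
    subst hss
    -- Equal syndromes mean the same recovery, so by the Weyl relation `D(w - w')` is a scalar on
    -- the code.
    obtain ⟨γ, hγ, h3⟩ : ∃ γ : ℂ, γ ≠ 0 ∧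
        ∀ T ∈ zeroEigenspace H, dispOp (joint (w - w') 0) T = γ • T := by
      obtain ⟨a, ha, ha'⟩ := exists_dispOp_dispOp_eq_smul (joint (-R s) (0 : PhaseSpace κ))
        (joint w 0)
      obtain ⟨a', ha₁, ha₁'⟩ := exists_dispOp_dispOp_eq_smul (joint (-R s) (0 : PhaseSpace κ))
        (joint w' 0)
      obtain ⟨b, hb, hb'⟩ := exists_dispOp_dispOp_eq_smul (joint (w - w') (0 : PhaseSpace κ))
        (joint (-R s + w') 0)
      simp only [joint_add_zero] at ha' ha₁' hb'
      have hne : ∀ {z : ℂ}, ‖z‖ = 1 → z ≠ 0 := fun h => norm_ne_zero_iff.1 (h ▸ one_ne_zero)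
      refine ⟨b * a' * a⁻¹ * β * β'⁻¹, by simp [hne ha, hne ha₁, hne hb, hne hβ, hne hβ'],
        fun T hT => ?_⟩
      have e1 : dispOp (joint (-R s + w) (0 : PhaseSpace κ)) T = (a⁻¹ * β) • T := by
        rw [mul_smul, ← h2 T hT, ha', inv_smul_smul₀ (hne ha)]
      have e2 : T = (β'⁻¹ * a') • dispOp (joint (-R s + w') (0 : PhaseSpace κ)) T := by
        rw [mul_smul, ← ha₁', h2' T hT, inv_smul_smul₀ (hne hβ')]
      have e3 : w - w' + (-R s + w') = -R s + w := by abel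
      conv_lhs => rw [e2]
      rw [map_smul, hb', e3, e1, smul_smul, smul_smul]
      congr 1
      ring
    -- For `h ∈ V^⊥` the sender observable `M(h)` preserves the code, so the scalar `γ` commutes
    -- past it. The commutator term `√π ((w - w') ⊙ h) γ T₀` must therefore vanish.
    rw [← sympDual_sympDual V]
    intro h hh
    have hcomm : ∀ r, sympProd (H r) (joint h 0) = 0 := fun r => by
      rw [sympProd_swap, hpr, (mem_sympDual_span_range p h).1 hh r, neg_zero]
    have h4 := quadObs_dispOp (joint h 0) (joint (w - w') (0 : PhaseSpace κ)) T₀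
    rw [h3 _ hT₀, h3 _ (quadObs_mem_zeroEigenspace hT₀ hcomm), map_smul, eq_comm,
      sub_eq_self, smul_smul, smul_eq_zero, or_iff_left hT₀0, mul_eq_zero, or_iff_left hγ,
      Complex.ofReal_eq_zero, mul_eq_zero, or_iff_right hpi, sympProd_joint, sympProd_zero_left,
      add_zero] at h4
    exact h4
  · intro hS
    classical
    -- The recovery vector is any error of `S` with the given syndrome; the value `0` at other
    -- syndromes is irrelevant.
    refine ⟨fun s => if h : ∃ w ∈ S, syn w = s then h.choose else 0, fun w hw =>
      ⟨syn w, heig w, ?_⟩⟩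
    have hex : ∃ w' ∈ S, syn w' = syn w := ⟨w, hw, rfl⟩
    rw [show (fun s => if h : ∃ w ∈ S, syn w = s then h.choose else 0) (syn w) = hex.choose from
      dif_pos hex]
    set w' := hex.choose with hw'
    obtain ⟨hw'S, hw's⟩ := hex.choose_spec
    have hiso : w - w' ∈ isoPart V := by
      by_cases hww : w = w'
      · rw [hww, sub_self]; exact Submodule.zero_mem _
      · exact (hS w hw w' hw'S hww).resolve_left (not_not.2 ((hsyn_iff _ _).1 hw's.symm))
    obtain ⟨β, hβ, h⟩ := exists_dispOp_dispOp_eq_smul (joint (-w') (0 : PhaseSpace κ)) (joint w 0)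
    refine ⟨β, hβ, fun T hT => ?_⟩
    rw [h, joint_add_zero, neg_add_eq_sub, hfix _ hiso T hT]

end Corrects

/-! ### The canonical encoder and displacements -/

section Encoder

variable {n c l k : ℕ} (σ : (Fin c ⊕ Fin l) ⊕ Fin k ≃ Fin n)

/-- The encoded delta function, tested on a bump at the origin, gives a positive multiple of the
integral of a nonnegative continuous function that is `1` at `0`. -/
theorem exists_canonicalEncoder_ne_zero : ∃ φ : GenState (Fin k), canonicalEncoder σ φ ≠ 0 := by
  refine ⟨TemperedDistribution.delta 0, fun h => ?_⟩
  let b : ContDiffBump (0 : Config (Fin n ⊕ Fin c)) := ⟨1, 2, one_pos, one_lt_two⟩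
  have h1 : HasCompactSupport (fun x => ((b x : ℝ) : ℂ)) :=
    b.hasCompactSupport.comp_left (g := fun r : ℝ => (r : ℂ)) Complex.ofReal_zero
  have h2 : ContDiff ℝ ((⊤ : ℕ∞) : WithTop ℕ∞) (fun x => ((b x : ℝ) : ℂ)) :=
    Complex.ofRealCLM.contDiff.comp b.contDiff
  set g : Config (Fin c) → ℝ := fun y => b (encPoint σ (joinPt y 0)) with hg
  set f := pullback (encPoint σ) (ker_encPoint σ) (h1.toSchwartzMap h2) with hf
  have hfx : ∀ y, f (joinPt y 0) = ((g y : ℝ) : ℂ) := fun y => rfl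
  have hcj : Continuous fun y : Config (Fin c) => (joinPt y (0 : Config (Fin k))) := by
    refine (PiLp.continuous_toLp 2 _).comp (continuous_pi fun i => ?_)
    rcases i with i | i
    · exact (EuclideanSpace.proj (𝕜 := ℝ) i : Config (Fin c) →L[ℝ] ℝ).continuous
    · exact continuous_const
  have hgc : Continuous g :=
    b.continuous.comp ((LinearMap.continuous_of_finiteDimensional (encPoint σ)).comp hcj)
  have hgs : HasCompactSupport g := by
    refine HasCompactSupport.intro (isCompact_closedBall (0 : Config (Fin c)) 2) fun y hy => ?_
    refine b.zero_of_le_dist ?_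
    rw [Metric.mem_closedBall, not_le, dist_zero_right] at hy
    rw [dist_zero_right]
    refine hy.le.trans ?_
    rw [EuclideanSpace.norm_eq, EuclideanSpace.norm_eq]
    refine Real.sqrt_le_sqrt ?_
    rw [Fintype.sum_sum_type]
    exact le_add_of_nonneg_left (Finset.sum_nonneg fun i _ => by positivity)
  have hpos : 0 < ∫ y, g y := by
    refine hgc.integral_pos_of_hasCompactSupport_nonneg_nonzero hgs (fun y => b.nonneg) (x := 0) ?_
    have : encPoint σ (joinPt (0 : Config (Fin c)) (0 : Config (Fin k))) = 0 := by
      rw [← map_zero (encPoint σ)]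
      congr 1
      ext i
      rcases i with i | i <;> rfl
    rw [hg]
    simp only [this]
    rw [b.one_of_mem_closedBall (Metric.mem_closedBall_self b.rIn_pos.le)]
    exact one_ne_zero
  have h3 : integrateOut (Fin c) (Fin k) f 0 = ((∫ y, g y : ℝ) : ℂ) := by
    rw [integrateOut_apply]
    simp only [hfx]
    exact integral_ofReal
  have h4 := congrArg (fun T : GenState (Fin n ⊕ Fin c) => T (h1.toSchwartzMap h2)) h
  simp only [canonicalEncoder_apply, ← hf] at h4
  rw [TemperedDistribution.delta_apply, h3, ← Complex.ofReal_mul] at h4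
  refine mul_ne_zero ?_ hpos.ne' (Complex.ofReal_eq_zero.1 h4)
  exact pow_ne_zero _ (inv_ne_zero (Real.sqrt_pos.2 Real.pi_pos).ne')

/-- Without a position part the displacement is multiplication by a phase, and the second hypothesis
makes this phase `1` on the image of `encPoint`, which is all the encoder sees. -/
theorem dispOp_canonicalEncoder {b : PhaseSpace (Fin n)} (hb : b.2 = 0)
    (hb' : ∀ w : Config (Fin c ⊕ Fin k), ∑ i, b.1 i * encPoint σ w (Sum.inl i) = 0)
    (φ : GenState (Fin k)) :
    dispOp (joint b 0) (canonicalEncoder σ φ) = canonicalEncoder σ φ := by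
  ext f
  rw [dispOp_apply, canonicalEncoder_apply, canonicalEncoder_apply]
  congr 3
  ext w
  have h : shiftVec (joint b (0 : PhaseSpace (Fin c))) = 0 := by
    ext i
    rcases i with i | i <;> simp [shiftVec, joint, hb]
  rw [pullback_apply, pullback_apply, dispS_apply, h, add_zero]
  have h2 : dispPhase (joint b (0 : PhaseSpace (Fin c))) (encPoint σ w) = 1 := by
    rw [dispPhase]
    simp [joint, hb, hb', Fintype.sum_sum_type]
  rw [h2, one_mul]

end Encoder

theorem implements_of_intertwines {ι κ : Type} [Fintype ι] [Fintype κ] [DecidableEq ι]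
    [DecidableEq κ] {Υ : PhaseSpace ι →ₗ[ℝ] PhaseSpace ι}
    {W : GenState (ι ⊕ κ) ≃L[ℂ] GenState (ι ⊕ κ)}
    (hD : ∀ a (b : PhaseSpace κ) T, W (dispOp (joint a b) T) = dispOp (joint (Υ a) b) (W T))
    (hM : ∀ a (b : PhaseSpace κ) T, W (quadObs (joint a b) T) = quadObs (joint (Υ a) b) (W T)) :
    Implements Υ W := by
  refine ⟨fun a b => ⟨1, norm_one, ?_⟩, fun a b => ?_⟩
  · ext T : 1
    change W (dispOp (joint a b) (W.symm T)) = (1 : ℂ) • dispOp (joint (Υ a) b) T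
    rw [hD, W.apply_symm_apply]
    exact (one_smul ℂ _).symm
  · ext T : 1
    change W (quadObs (joint a b) (W.symm T)) = quadObs (joint (Υ a) b) T
    rw [hM, W.apply_symm_apply]

/-! ### The main theorem -/

theorem mainTheorem1 (n : ℕ) (C : Submodule ℝ (PhaseSpace (Fin n))) :
    ∃ (c l k : ℕ) (hn : c + l + k = n),
      -- `C^⊥` has dimension `2c + l`, and its isotropic part has dimension `l`
      Module.finrank ℝ (sympDual C) = 2 * c + l ∧
      Module.finrank ℝ (isoPart (sympDual C)) = l ∧
      ∃ (u v : Fin n → PhaseSpace (Fin n))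
        (Υ : PhaseSpace (Fin n) →ₗ[ℝ] PhaseSpace (Fin n))
        (U : HilbertState (Fin n) ≃ₗᵢ[ℂ] HilbertState (Fin n))
        (W : GenState (Fin n ⊕ Fin c) ≃L[ℂ] GenState (Fin n ⊕ Fin c)),
        -- `u_1, …, u_{c+l}, v_1, …, v_c`, the rows of `H`, are part of a symplectic basis
        -- and span `C^⊥`; `u_{c+1}, …, u_{c+l}` span its isotropic part
        IsSymplecticBasis u v ∧
        Submodule.span ℝ (Set.range (parityRows (modeLayout hn) u v)) = sympDual C ∧
        Submodule.span ℝ (Set.range fun j : Fin l => u (modeLayout hn (Sum.inl (Sum.inr j)))) =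
          isoPart (sympDual C) ∧
        -- `Υ` is symplectic and carries this basis to the standard one
        IsSymplecticMap Υ ∧
        (∀ i, Υ (u i) = stdP i ∧ Υ (v i) = stdX i) ∧
        -- the unitary `U` on the sender's modes, with extension `W` to the generalized states of
        -- all modes, is a unitary `U_Υ` corresponding to `Υ`
        IsLocalExtension U W ∧
        Implements Υ W ∧
        -- the observables `M(h)`, for the rows `h` of `H_aug`, commute
        (∀ r r', Commute (quadObs (augmentedRows (modeLayout hn) u v r))
          (quadObs (augmentedRows (modeLayout hn) u v r'))) ∧
        -- measuring `M(h)` and then applying `U_Υ` amounts to applying `U_Υ` and then measuring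
        -- the canonical observable
        (∀ r T, W (quadObs (augmentedRows (modeLayout hn) u v r) T) =
          quadObs (augmentedRows (modeLayout hn) stdP stdX r) (W T)) ∧
        -- the code encoded by `U_Υ⁻¹ U_0` is the simultaneous zero eigenspace of the `M(h)`
        Set.range (fun φ : GenState (Fin k) => W.symm (canonicalEncoder (modeLayout hn) φ)) =
          zeroEigenspace (augmentedRows (modeLayout hn) u v) ∧
        -- the correctable error sets
        (∀ S : Set (PhaseSpace (Fin n)),
          Corrects (Set.range fun φ : GenState (Fin k) =>
              W.symm (canonicalEncoder (modeLayout hn) φ))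
            (augmentedRows (modeLayout hn) u v) S ↔
          ∀ w ∈ S, ∀ w' ∈ S, w ≠ w' → w - w' ∉ C ∨ w - w' ∈ isoPart (sympDual C)) := by
  obtain ⟨c, l, k, hn, u, v, hb, hspan⟩ := exists_symplecticBasis_span_parityRows (sympDual C)
  set σ := modeLayout hn with hσ
  obtain ⟨Υ, ⟨U, W, hU, hD, hM⟩, hsymp, hstd⟩ := hb.exists_isImplementable (Fin c)
  have hancilla := hspan ▸ hb.span_ancilla_eq_isoPart σ
  have hquad : ∀ r T, W (quadObs (augmentedRows σ u v r) T) =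
      quadObs (augmentedRows σ stdP stdX r) (W T) := fun r T => by
    have h1 : augmentedRows σ stdP stdX r = joint (Υ (parityRows σ u v r)) (receiverRows c l r) := by
      rcases r with r | r
      · rw [augmentedRows, parityRows, parityRows, (hstd _).1]
      · rw [augmentedRows, parityRows, parityRows, (hstd _).2]
    rw [h1, ← hM]
    rfl
  have hcode : Set.range (fun φ : GenState (Fin k) => W.symm (canonicalEncoder σ φ)) =
      zeroEigenspace (augmentedRows σ u v) := by
    ext T
    have h1 : T ∈ zeroEigenspace (augmentedRows σ u v) ↔
        W T ∈ Set.range (canonicalEncoder σ) := by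
      rw [range_canonicalEncoder]
      refine forall_congr' fun r => ?_
      rw [← hquad]
      exact W.map_eq_zero_iff.symm
    rw [h1]
    exact exists_congr fun φ => W.symm_apply_eq
  refine ⟨c, l, k, hn, hspan ▸ hb.finrank_span_parityRows σ, hancilla ▸ hb.finrank_span_ancilla σ,
    u, v, Υ, U, W, hb, hspan, hancilla, hsymp, hstd, hU, implements_of_intertwines hD hM,
    fun r r' => commute_quadObs (hb.sympProd_augmentedRows σ r r'), hquad, hcode, fun S => ?_⟩
  rw [hcode]
  -- The parity rows span `C^⊥`, so the dual of their span is `C`.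
  have hcor := corrects_zeroEigenspace_iff (parityRows σ u v) (receiverRows c l) ?_ ?_ S
  · rwa [hspan, sympDual_sympDual] at hcor
  · obtain ⟨φ, hφ⟩ := exists_canonicalEncoder_ne_zero σ
    exact ⟨W.symm (canonicalEncoder σ φ), hcode ▸ ⟨φ, rfl⟩,
      fun h => hφ (W.symm.map_eq_zero_iff.1 h)⟩
  · intro a ha T hT
    obtain ⟨φ, rfl⟩ : T ∈ Set.range fun φ : GenState (Fin k) => W.symm (canonicalEncoder σ φ) :=
      hcode ▸ hT
    -- Transport by `W` reduces the claim to the canonical code and the displacement by `Υ a`.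
    refine W.injective ?_
    simp only [hD, W.apply_symm_apply]
    rw [hspan, ← hancilla] at ha
    -- As `a` is a combination of ancilla vectors `u_j`, its image is a combination of the `stdP` of
    -- ancilla modes, and `encPoint` places those modes at `0`.
    have hΥa : (Υ a).2 = 0 ∧ ∀ w : Config (Fin c ⊕ Fin k),
        ∑ i, (Υ a).1 i * encPoint σ w (Sum.inl i) = 0 := by
      clear hT
      induction ha using Submodule.span_induction with
      | mem x hx =>
        obtain ⟨j, rfl⟩ := hx
        simp [(hstd _).1, stdP, Pi.single_apply, encPoint]
      | zero => simp
      | add x y _ _ hx hy =>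
        rw [map_add]
        exact ⟨by rw [Prod.snd_add, hx.1, hy.1, add_zero], fun w => by
          simp only [Prod.fst_add, Pi.add_apply, add_mul, Finset.sum_add_distrib, hx.2 w, hy.2 w,
            add_zero]⟩
      | smul r x _ hx =>
        rw [map_smul]
        exact ⟨by rw [Prod.smul_snd, hx.1, smul_zero], fun w => by
          simp only [Prod.smul_fst, Pi.smul_apply, smul_eq_mul, mul_assoc, ← Finset.mul_sum, hx.2 w,
            mul_zero]⟩
    exact dispOp_canonicalEncoder σ hΥa.1 hΥa.2 φ
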